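/- Let $N\ge 1$ be an integer and $\omega\in\mathbb{C}$ a primitive $N$-th root of unity; write $\mathbb{Z}_N=\mathbb{Z}/N\mathbb{Z}$, and $\omega^a$ for $a\in\mathbb{Z}_N$. **The algebra.** Let $A=C(S_N^+(R))$ be the universal unital $C^*$-algebra with generators $q_{ij}$, $i,j\in\mathbb{Z}_N$, subject to the relations (for all $i,j,k\in\mathbb{Z}_N$) 1. $q_{0i}=q_{i0}=\delta_{i0}$; 2. $q_{ij}^*=\omega^{-i(i-j)}\,q_{-i,-j}$; 3. $q_{k,i+j}=\sum_{l\in\mathbb{Z}_N}\omega^{-l(i-k+l)}\,q_{k-l,i}\,q_{lj}$; 4. $q_{i+j,k}=\sum_{l\in\mathbb{Z}_N}\omega^{-i(l-j)}\,q_{jl}\,q_{i,k-l}$; that is, the completion of the universal unital $*$-algebra with these generators and relations in its largest $C^*$-seminorm. It is a $\mathbb{Z}_N$-$C^*$-algebra (a unital $C^*$-algebra with a coaction of $C(\mathbb{Z}_N)$ satisfying the Podleś condition) for the coaction $\rho:A\to A\otimes C(\mathbb{Z}_N)=C(\mathbb{Z}_N,A)$, $\rho_t(q_{ij})=\omega^{t(j-i)}q_{ij}$.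 **Braided tensor products.** A faithful equivariant representation of a $\mathbb{Z}_N$-$C^*$-algebra $(X,\rho)$ is a Hilbert space $\mathcal{L}$ with a unitary representation $U$ of $\mathbb{Z}_N$ and an injective unital $*$-homomorphism $\pi:X\to\mathbb{B}(\mathcal{L})$ with $\pi(\rho_t(x))=U_t\pi(x)U_t^*$. A vector $v$ has degree $m\in\mathbb{Z}_N$ if $U_tv=\omega^{tm}v$ for all $t$. Given such representations of $X$ on $\mathcal{L}$ and of $Y$ on $\mathcal{K}$, let $c:\mathcal{L}\otimes\mathcal{K}\to\mathcal{K}\otimes\mathcal{L}$ be the unitary with $c(v\otimes w)=\omega^{mn}\,w\otimes v$ for $v$ of degree $m$ and $w$ of degree $n$, and let $c'=c^{-1}$, so that $c'(w\otimes v)=\omega^{-mn}\,v\otimes w$. Put $j_1(x)=\pi_X(x)\otimes 1$ and $j_2(y)=c'(\pi_Y(y)\otimes 1)c$. The braided tensor product $X\boxtimes_R Y$ is the $C^*$-subalgebra of $\mathbb{B}(\mathcal{L}\otimes\mathcal{K})$ generated by all $j_1(x)j_2(y)$, with the unique coaction for which $j_1$ and $j_2$ are equivariant (implemented by the diagonal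 representation of $\mathbb{Z}_N$ on $\mathcal{L}\otimes\mathcal{K}$). Iterated braided tensor products are formed in these representations. For equivariant unital $*$-homomorphisms $f,g$, the map $f\boxtimes_R g$ is the equivariant unital $*$-homomorphism with $j_1(x)j_2(y)\mapsto j_1(f(x))j_2(g(y))$. **Theorem.** The $\mathbb{Z}_N$-$C^*$-algebra $(A,\rho)$ has a faithful equivariant representation on some Hilbert space. For every such representation, with $A\boxtimes_R A$ formed in it, there is a unique unital $*$-homomorphism $$\Delta: A\longrightarrow A\boxtimes_R A\qquad\text{with}\qquad \Delta(q_{ij})=\sum_{k\in\mathbb{Z}_N}j_1(q_{ik})\,j_2(q_{kj})\quad(i,j\in\mathbb{Z}_N).$$ Moreover: * $\Delta$ is $\mathbb{Z}_N$-equivariant; * $\Delta$ is coassociative: the maps $\Delta\boxtimes_R\mathrm{id}_A$ and $\mathrm{id}_A\boxtimes_R\Delta$ exist, and so does the canonical isomorphism $(A\boxtimes_R A)\boxtimes_R A\cong A\boxtimes_R(A\boxtimes_R A)$ that respects the three embeddings of $A$, and $(\Delta\boxtimes_R\mathrm{id}_A)\circ\Delta=(\mathrm{id}_A\boxtimes_R\Delta)\circ\Delta$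 under it; * $\Delta$ is bisimplifiable: the closed linear span of $\{\Delta(x)j_2(y): x,y\in A\}$ and the closed linear span of $\{\Delta(x)j_1(y): x,y\in A\}$ are both equal to $A\boxtimes_R A$. Thus $S_N^+(R)=(A,\rho,\Delta)$ is an anyonic compact quantum group for every primitive $N$-th root of unity $\omega$. -/

import Mathlib

namespace Anyonic

/-! ### The free unital `*`-algebra -/

/-- The free unital `*`-algebra over `ℂ` on a set `X`: the free algebra on letters
`x = (x, false)` and `x* = (x, true)`. -/
def FreeStarAlgebra (X : Type*) : Type _ := FreeAlgebra ℂ (X × Bool)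

namespace FreeStarAlgebra

variable {X : Type*}

noncomputable instance : Ring (FreeStarAlgebra X) := inferInstanceAs (Ring (FreeAlgebra ℂ (X × Bool)))

noncomputable instance : Algebra ℂ (FreeStarAlgebra X) :=
  inferInstanceAs (Algebra ℂ (FreeAlgebra ℂ (X × Bool)))

/-- The letters. -/
noncomputable def letter (a : X × Bool) : FreeStarAlgebra X := FreeAlgebra.ι ℂ a

/-- The free generators. -/
noncomputable def gen (x : X) : FreeStarAlgebra X := letter (x, false)

/-- The opposite algebra with conjugate scalars; the involution is an algebra map into it. -/
def ConjOp (X : Type*) : Type _ := (FreeStarAlgebra X)ᵐᵒᵖ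

noncomputable instance : Ring (ConjOp X) := inferInstanceAs (Ring (FreeStarAlgebra X)ᵐᵒᵖ)

noncomputable instance : Algebra ℂ (ConjOp X) :=
  RingHom.toAlgebra' ((algebraMap ℂ (FreeStarAlgebra X)ᵐᵒᵖ).comp (starRingEnd ℂ))
    (fun c x => Algebra.commutes (A := (FreeStarAlgebra X)ᵐᵒᵖ) (starRingEnd ℂ c) x)

/-- The involution as an algebra map: it swaps `x` and `x*`, reverses words, and conjugates
scalars. -/
noncomputable def starAux : FreeStarAlgebra X →ₐ[ℂ] ConjOp X :=
  FreeAlgebra.lift ℂ (fun a : X × Bool => (MulOpposite.op (letter (a.1, !a.2)) : ConjOp X))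

noncomputable instance : Star (FreeStarAlgebra X) where
  star x := MulOpposite.unop (α := FreeStarAlgebra X) (starAux x)

theorem star_def (x : FreeStarAlgebra X) :
    star x = MulOpposite.unop (α := FreeStarAlgebra X) (starAux x) := rfl

theorem star_letter (a : X × Bool) : star (letter a) = letter (a.1, !a.2) := by
  rw [star_def, starAux, letter]
  exact congrArg _ (FreeAlgebra.lift_ι_apply _ _)

theorem star_algebraMap' (c : ℂ) :
    star (algebraMap ℂ (FreeStarAlgebra X) c) = algebraMap ℂ (FreeStarAlgebra X) (star c) := by
  rw [star_def, AlgHom.commutes]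
  rfl

theorem star_mul' (x y : FreeStarAlgebra X) : star (x * y) = star y * star x := by
  rw [star_def, map_mul]
  rfl

theorem star_add' (x y : FreeStarAlgebra X) : star (x + y) = star x + star y := by
  rw [star_def, map_add]
  rfl

/-- Induction on elements of the free `*`-algebra. -/
theorem induction {C : FreeStarAlgebra X → Prop}
    (h1 : ∀ c, C (algebraMap ℂ (FreeStarAlgebra X) c)) (h2 : ∀ a, C (letter a))
    (h3 : ∀ x y, C x → C y → C (x * y)) (h4 : ∀ x y, C x → C y → C (x + y))
    (x : FreeStarAlgebra X) : C x :=
  FreeAlgebra.induction ℂ (X × Bool) h1 h2 h3 h4 x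

noncomputable instance : StarRing (FreeStarAlgebra X) where
  star_involutive x := by
    induction x using induction with
    | h1 c => rw [star_algebraMap', star_algebraMap', star_star]
    | h2 a => rw [star_letter, star_letter]; simp
    | h3 x y hx hy => rw [star_mul', star_mul', hx, hy]
    | h4 x y hx hy => rw [star_add', star_add', hx, hy]
  star_mul := star_mul'
  star_add := star_add'

instance : StarModule ℂ (FreeStarAlgebra X) where
  star_smul c x := by
    rw [Algebra.smul_def, star_mul', star_algebraMap', ← Algebra.commutes, ← Algebra.smul_def]

theorem star_gen (x : X) : star (gen x) = letter (x, true) := star_letter _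

/-- Evaluation of noncommutative `*`-polynomials. -/
noncomputable def eval {B : Type*} [Ring B] [StarRing B] [Algebra ℂ B] [StarModule ℂ B]
    (b : X → B) : FreeStarAlgebra X →⋆ₐ[ℂ] B where
  toAlgHom := (FreeAlgebra.lift ℂ (fun a : X × Bool => if a.2 then star (b a.1) else b a.1) :
    FreeAlgebra ℂ (X × Bool) →ₐ[ℂ] B)
  map_star' x := by
    set f : FreeStarAlgebra X →ₐ[ℂ] B :=
      (FreeAlgebra.lift ℂ (fun a : X × Bool => if a.2 then star (b a.1) else b a.1) :
        FreeAlgebra ℂ (X × Bool) →ₐ[ℂ] B) with hf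
    have hl : ∀ a, f (letter a) = if a.2 then star (b a.1) else b a.1 :=
      fun a => FreeAlgebra.lift_ι_apply _ _
    change f (star x) = star (f x)
    induction x using induction with
    | h1 c => rw [star_algebraMap', AlgHom.commutes, AlgHom.commutes, algebraMap_star_comm]
    | h2 a =>
      obtain ⟨x, e⟩ := a
      rw [star_letter, hl, hl]
      cases e <;> simp
    | h3 x y hx hy => rw [star_mul, map_mul, map_mul, star_mul, hx, hy]
    | h4 x y hx hy => rw [star_add, map_add, map_add, star_add, hx, hy]

theorem eval_gen {B : Type*} [Ring B] [StarRing B] [Algebra ℂ B] [StarModule ℂ B]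
    (b : X → B) (x : X) : eval b (gen x) = b x := by
  have : eval b (gen x) = if ((x, false) : X × Bool).2 then star (b x) else b x :=
    FreeAlgebra.lift_ι_apply _ _
  simpa using this

end FreeStarAlgebra

/-! ### `C*`-seminorms and the associated completions -/

/-- A `C*`-seminorm on a unital `*`-algebra. -/
structure CStarSeminorm (A : Type*) [Ring A] [StarRing A] [Algebra ℂ A] extends
    Seminorm ℂ A where
  mul_le' : ∀ x y, toFun (x * y) ≤ toFun x * toFun y
  star_mul_self' : ∀ x, toFun (star x * x) = toFun x ^ 2

namespace CStarSeminorm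

section
variable {A : Type*} [Ring A] [StarRing A] [Algebra ℂ A]

noncomputable instance : CoeFun (CStarSeminorm A) (fun _ => A → ℝ) := ⟨fun p => p.toSeminorm⟩

theorem mul_le (p : CStarSeminorm A) (x y : A) : p (x * y) ≤ p x * p y := p.mul_le' x y

theorem star_mul_self (p : CStarSeminorm A) (x : A) : p (star x * x) = p x ^ 2 :=
  p.star_mul_self' x

theorem nonneg (p : CStarSeminorm A) (x : A) : 0 ≤ p x := apply_nonneg p.toSeminorm x

theorem le_star (p : CStarSeminorm A) (x : A) : p x ≤ p (star x) := by
  have h1 := p.star_mul_self x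
  have h2 := p.mul_le (star x) x
  rcases (p.nonneg x).eq_or_lt with h | h
  · rw [← h]; exact p.nonneg _
  · nlinarith

theorem star (p : CStarSeminorm A) (x : A) : p (star x) = p x :=
  le_antisymm (by simpa using p.le_star (Star.star x)) (p.le_star x)

theorem one_le (p : CStarSeminorm A) : p 1 ≤ 1 := by
  have h := p.star_mul_self 1
  rw [star_one, one_mul] at h
  nlinarith [p.nonneg 1]

/-- `A` regarded as a seminormed algebra through `p`. -/
def Pre (_p : CStarSeminorm A) : Type _ := A

variable (p : CStarSeminorm A)

noncomputable instance : Ring p.Pre := inferInstanceAs (Ring A)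
noncomputable instance : StarRing p.Pre := inferInstanceAs (StarRing A)
noncomputable instance : Algebra ℂ p.Pre := inferInstanceAs (Algebra ℂ A)
instance [StarModule ℂ A] : StarModule ℂ p.Pre := inferInstanceAs (StarModule ℂ A)

noncomputable instance : SeminormedAddCommGroup p.Pre :=
  { p.toSeminorm.toAddGroupSeminorm.toSeminormedAddCommGroup with
    toAddCommGroup := inferInstanceAs (AddCommGroup A) }

/-- The identity map of `A`, seen as a map into the seminormed algebra. -/
noncomputable def toPre : A →⋆ₐ[ℂ] p.Pre := StarAlgHom.id ℂ A

theorem norm_toPre (x : A) : ‖p.toPre x‖ = p x := rfl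

theorem norm_pre (x : p.Pre) : ‖x‖ = p (x : A) := rfl

noncomputable instance : SeminormedRing p.Pre where
  __ := (inferInstance : SeminormedAddCommGroup p.Pre)
  __ := (inferInstance : Ring p.Pre)
  norm_mul_le := p.mul_le

noncomputable instance : NormedSpace ℂ p.Pre where
  norm_smul_le c x := (map_smul_eq_mul p.toSeminorm c (x : A)).le

instance : NormedStarGroup p.Pre where
  norm_star_le x := (p.star (x : A)).le

/-- The `C*`-algebra obtained from `A` by dividing out the kernel of `p` and completing. -/
abbrev Compl : Type _ := UniformSpace.Completion p.Pre

noncomputable instance : NormedAlgebra ℂ p.Compl where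
  norm_smul_le := norm_smul_le (α := ℂ) (β := UniformSpace.Completion p.Pre)

/-- The canonical map into the completion. -/
noncomputable def coe (x : A) : p.Compl := ((p.toPre x : p.Pre) : UniformSpace.Completion p.Pre)

theorem norm_coe (x : A) : ‖p.coe x‖ = p x := UniformSpace.Completion.norm_coe _

theorem coe_add (x y : A) : p.coe (x + y) = p.coe x + p.coe y :=
  UniformSpace.Completion.coe_add _ _

theorem coe_mul (x y : A) : p.coe (x * y) = p.coe x * p.coe y :=
  UniformSpace.Completion.coe_mul _ _

theorem coe_one : p.coe 1 = 1 := rfl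

theorem coe_zero : p.coe 0 = 0 := rfl

theorem coe_smul (c : ℂ) (x : A) : p.coe (c • x) = c • p.coe x :=
  UniformSpace.Completion.coe_smul c (p.toPre x)

theorem denseRange_coe : DenseRange p.coe := UniformSpace.Completion.denseRange_coe (α := p.Pre)

/-- To check a closed property on the completion it suffices to check it on `A`. -/
theorem compl_induction {C : p.Compl → Prop} (x : p.Compl) (hc : IsClosed {x | C x})
    (h : ∀ a, C (p.coe a)) : C x :=
  UniformSpace.Completion.induction_on x hc h

theorem compl_induction₂ {C : p.Compl → p.Compl → Prop} (x y : p.Compl)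
    (hc : IsClosed {z : p.Compl × p.Compl | C z.1 z.2})
    (h : ∀ a b, C (p.coe a) (p.coe b)) : C x y :=
  UniformSpace.Completion.induction_on₂ x y hc h

noncomputable instance : Star p.Compl where
  star := UniformSpace.Completion.map (fun x : p.Pre => Star.star x)

theorem uniformContinuous_star : UniformContinuous (fun x : p.Pre => Star.star x) :=
  (starNormedAddGroupHom : NormedAddGroupHom p.Pre p.Pre).uniformContinuous

theorem star_coe (x : A) : Star.star (p.coe x) = p.coe (Star.star x) :=
  UniformSpace.Completion.map_coe p.uniformContinuous_star _

instance : ContinuousStar p.Compl where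
  continuous_star := UniformSpace.Completion.continuous_map

noncomputable instance : StarRing p.Compl where
  star_involutive x := by
    refine p.compl_induction (C := fun x => Star.star (Star.star x) = x) x
      (isClosed_eq (by fun_prop) (by fun_prop)) fun a => ?_
    rw [star_coe, star_coe, star_star]
  star_mul x y := by
    refine p.compl_induction₂
      (C := fun x y => Star.star (x * y) = Star.star y * Star.star x) x y
      (isClosed_eq (by fun_prop) (by fun_prop)) fun a b => ?_
    rw [← coe_mul, star_coe, star_mul, coe_mul, star_coe, star_coe]
  star_add x y := by
    refine p.compl_induction₂
      (C := fun x y => Star.star (x + y) = Star.star x + Star.star y) x y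
      (isClosed_eq (by fun_prop) (by fun_prop)) fun a b => ?_
    rw [← coe_add, star_coe, star_add, coe_add, star_coe, star_coe]

noncomputable instance [StarModule ℂ A] : CStarAlgebra p.Compl where
  norm_mul_self_le x := by
    refine p.compl_induction (C := fun x => ‖x‖ * ‖x‖ ≤ ‖Star.star x * x‖) x
      (isClosed_le (by fun_prop) (by fun_prop)) fun a => ?_
    rw [star_coe, ← coe_mul, norm_coe, norm_coe, star_mul_self, sq]
  star_smul c x := by
    refine p.compl_induction (C := fun x => Star.star (c • x) = Star.star c • Star.star x) x
      (isClosed_eq (continuous_id.const_smul c).star (continuous_id.star.const_smul (Star.star c))) fun a => ?_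
    rw [← coe_smul, star_coe, star_smul, coe_smul, star_coe]

/-- The canonical `*`-homomorphism into the completion. -/
noncomputable def coeHom [StarModule ℂ A] : A →⋆ₐ[ℂ] p.Compl where
  toFun := p.coe
  map_one' := p.coe_one
  map_mul' := p.coe_mul
  map_zero' := p.coe_zero
  map_add' := p.coe_add
  commutes' c := by
    rw [Algebra.algebraMap_eq_smul_one, coe_smul, coe_one, ← Algebra.algebraMap_eq_smul_one]
  map_star' x := (p.star_coe x).symm

/-- The extension to the completion of a `*`-homomorphism that is bounded by `p`. -/
noncomputable def extend [StarModule ℂ A] {B : Type*} [CStarAlgebra B] (f : A →⋆ₐ[ℂ] B)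
    (hf : ∀ x, ‖f x‖ ≤ p x) : p.Compl →⋆ₐ[ℂ] B := by
  let g : p.Pre →L[ℂ] B := LinearMap.mkContinuous (f.toAlgHom.toLinearMap : A →ₗ[ℂ] B) 1
    (fun x => (one_mul (p (x : A))).symm ▸ hf x)
  let G : p.Compl →L[ℂ] B := g.fromCompletion
  have hG : ∀ a, G (p.coe a) = f a := fun a => g.fromCompletion_apply_coe _
  exact
  { toFun := G
    map_one' := by rw [← coe_one, hG, map_one]
    map_mul' := fun x y => by
      refine p.compl_induction₂ (C := fun x y => G (x * y) = G x * G y) x y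
        (isClosed_eq (by fun_prop) (by fun_prop)) fun a b => ?_
      rw [← coe_mul, hG, hG, hG, map_mul]
    map_zero' := map_zero G
    map_add' := map_add G
    commutes' := fun c => by
      rw [Algebra.algebraMap_eq_smul_one, map_smul, ← coe_one, hG, map_one,
        ← Algebra.algebraMap_eq_smul_one]
    map_star' := fun x => by
      refine p.compl_induction (C := fun x => G (Star.star x) = Star.star (G x)) x
        (isClosed_eq (by fun_prop) (by fun_prop)) fun a => ?_
      rw [star_coe, hG, hG, map_star] }

theorem extend_coe [StarModule ℂ A] {B : Type*} [CStarAlgebra B] (f : A →⋆ₐ[ℂ] B)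
    (hf : ∀ x, ‖f x‖ ≤ p x) (a : A) : p.extend f hf (p.coe a) = f a :=
  ContinuousLinearMap.fromCompletion_apply_coe _ _

/-- Two `*`-homomorphisms out of the completion agree if they agree on `A`. -/
theorem hom_ext [StarModule ℂ A] {B : Type*} [CStarAlgebra B] {f g : p.Compl →⋆ₐ[ℂ] B}
    (h : ∀ a, f (p.coe a) = g (p.coe a)) : f = g := by
  refine StarAlgHom.ext fun x => ?_
  have hc : ∀ f : p.Compl →⋆ₐ[ℂ] B, Continuous f := fun f =>
    AddMonoidHomClass.continuous_of_bound f 1 fun x => by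
      simpa using NonUnitalStarAlgHom.norm_apply_le f x
  exact p.compl_induction x (isClosed_eq (hc f) (hc g)) h

/-- The pullback of a `C*`-norm along a `*`-homomorphism. -/
noncomputable def ofHom {B : Type*} [CStarAlgebra B] (f : A →⋆ₐ[ℂ] B) : CStarSeminorm A where
  toSeminorm := (normSeminorm ℂ B).comp f.toAlgHom.toLinearMap
  mul_le' x y := by
    change ‖f (x * y)‖ ≤ ‖f x‖ * ‖f y‖
    rw [map_mul]; exact norm_mul_le _ _
  star_mul_self' x := by
    change ‖f (Star.star x * x)‖ = ‖f x‖ ^ 2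
    rw [map_mul, map_star, CStarRing.norm_star_mul_self, sq]

theorem ofHom_apply {B : Type*} [CStarAlgebra B] (f : A →⋆ₐ[ℂ] B) (x : A) :
    ofHom f x = ‖f x‖ := rfl

/-- The largest element of a pointwise bounded non-empty set of `C*`-seminorms, i.e. its pointwise
supremum. -/
noncomputable def sup (S : Set (CStarSeminorm A)) (hS : S.Nonempty)
    (hb : ∀ x, BddAbove ((fun p : CStarSeminorm A => p x) '' S)) : CStarSeminorm A :=
  have hle : ∀ p ∈ S, ∀ x, p x ≤ sSup ((fun p : CStarSeminorm A => p x) '' S) :=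
    fun p hp x => le_csSup (hb x) ⟨p, hp, rfl⟩
  have hge : ∀ x c, (∀ p ∈ S, p x ≤ c) → sSup ((fun p : CStarSeminorm A => p x) '' S) ≤ c :=
    fun x c h => csSup_le (hS.image _) (by rintro _ ⟨p, hp, rfl⟩; exact h p hp)
  have h0 : ∀ x, 0 ≤ sSup ((fun p : CStarSeminorm A => p x) '' S) := fun x => by
    obtain ⟨p, hp⟩ := hS
    exact (p.nonneg x).trans (hle p hp x)
  { toSeminorm := Seminorm.of (fun x => sSup ((fun p : CStarSeminorm A => p x) '' S))
      (fun x y => hge _ _ fun p hp => (map_add_le_add p.toSeminorm x y).trans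
        (add_le_add (hle p hp x) (hle p hp y)))
      (fun c x => by
        have key : ∀ (c : ℂ) x, sSup ((fun p : CStarSeminorm A => p (c • x)) '' S) ≤
            ‖c‖ * sSup ((fun p : CStarSeminorm A => p x) '' S) := fun c x =>
          hge _ _ fun p hp => (map_smul_eq_mul p.toSeminorm c x).le.trans
            (mul_le_mul_of_nonneg_left (hle p hp x) (norm_nonneg c))
        refine le_antisymm (key c x) ?_
        rcases eq_or_ne c 0 with rfl | hc
        · rw [norm_zero, zero_mul]; exact h0 _
        · have h := key c⁻¹ (c • x)
          simp only [smul_smul, inv_mul_cancel₀ hc, one_smul, norm_inv] at h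
          rwa [inv_mul_eq_div, le_div_iff₀ (norm_pos_iff.2 hc), mul_comm] at h)
    mul_le' := fun x y => hge _ _ fun p hp => (p.mul_le x y).trans
      (mul_le_mul (hle p hp x) (hle p hp y) (p.nonneg y) (h0 x))
    star_mul_self' := fun x => by
      refine le_antisymm (hge _ _ fun p hp => ?_) ?_
      · rw [p.star_mul_self]
        exact pow_le_pow_left₀ (p.nonneg x) (hle p hp x) 2
      · refine (Real.le_sqrt (h0 _) (h0 _)).1 (hge _ _ fun p hp => ?_)
        refine Real.le_sqrt_of_sq_le ?_
        rw [← p.star_mul_self]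
        exact hle p hp _ }

theorem sup_apply (S : Set (CStarSeminorm A)) (hS : S.Nonempty)
    (hb : ∀ x, BddAbove ((fun p : CStarSeminorm A => p x) '' S)) (x : A) :
    sup S hS hb x = sSup ((fun p : CStarSeminorm A => p x) '' S) := rfl

end
end CStarSeminorm

/-! ### Powers of the root of unity -/

/-- `ω ^ a` for an exponent `a` modulo `N`. -/
noncomputable def rootPow {N : ℕ} (ω : ℂ) (a : ZMod N) : ℂ := ω ^ a.val

section rootPow
variable {N : ℕ} {ω : ℂ}

theorem rootPow_zero : rootPow ω (0 : ZMod N) = 1 := by simp [rootPow]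

theorem rootPow_add [NeZero N] (hω : IsPrimitiveRoot ω N) (a b : ZMod N) : rootPow ω (a + b) = rootPow ω a * rootPow ω b := by
  rw [rootPow, rootPow, rootPow, ← pow_add, ZMod.val_add]
  exact (pow_eq_pow_mod _ hω.pow_eq_one).symm

theorem star_rootPow [NeZero N] (hω : IsPrimitiveRoot ω N) (a : ZMod N) : star (rootPow ω a) = rootPow ω (-a) := by
  have h1 : rootPow ω a * rootPow ω (-a) = 1 := by
    rw [← rootPow_add hω, add_neg_cancel, rootPow_zero]
  have hn : ‖ω‖ = 1 := Complex.norm_eq_one_of_pow_eq_one hω.pow_eq_one (NeZero.ne N)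
  have h2 : star (rootPow ω a) * rootPow ω a = 1 := by
    rw [rootPow, star_pow, ← mul_pow]
    have : star ω * ω = 1 := by
      rw [mul_comm]
      simpa [Complex.normSq_eq_norm_sq, hn] using Complex.mul_conj ω
    rw [this, one_pow]
  calc star (rootPow ω a) = star (rootPow ω a) * (rootPow ω a * rootPow ω (-a)) := by
        rw [h1, mul_one]
    _ = rootPow ω (-a) := by rw [← mul_assoc, h2, one_mul]

end rootPow

/-! ### The universal `C*`-algebra of the anyonic quantum permutation group -/

/-- The defining relations of the anyonic quantum permutation group, for a matrix `q` over a unital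
`*`-algebra; `E x y` is the sense in which two elements are required to be equal. -/
structure PermRelations {N : ℕ} [NeZero N] (ω : ℂ) {B : Type*} [Ring B] [StarRing B] [Algebra ℂ B]
    (E : B → B → Prop) (q : ZMod N → ZMod N → B) : Prop where
  zero_left : ∀ i, E (q 0 i) (if i = 0 then 1 else 0)
  zero_right : ∀ i, E (q i 0) (if i = 0 then 1 else 0)
  star_eq : ∀ i j, E (star (q i j)) (rootPow ω (-(i * (i - j))) • q (-i) (-j))
  col_add : ∀ i j k, E (q k (i + j))
    (∑ l, rootPow ω (-(l * (i - k + l))) • (q (k - l) i * q l j))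
  row_add : ∀ i j k, E (q (i + j) k)
    (∑ l, rootPow ω (-(i * (l - j))) • (q j l * q i (k - l)))

section Perm

variable {N : ℕ} [NeZero N] {ω : ℂ}

/-- The matrix of free generators. -/
noncomputable def freeGen (i j : ZMod N) : FreeStarAlgebra (ZMod N × ZMod N) :=
  FreeStarAlgebra.gen (i, j)

/-- The `C*`-seminorms on the free unital `*`-algebra on the symbols `q i j` for which the defining
relations hold, i.e. the `C*`-seminorms on the universal unital `*`-algebra with generators `q i j`
subject to the defining relations. -/
def permSeminorms (N : ℕ) [NeZero N] (ω : ℂ) :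
    Set (CStarSeminorm (FreeStarAlgebra (ZMod N × ZMod N))) :=
  {p | PermRelations ω (fun x y => p (x - y) = 0) freeGen}

/-- `*`-homomorphisms transport the relations. -/
theorem PermRelations.map {A B : Type*} [Ring A] [StarRing A] [Algebra ℂ A] [Ring B] [StarRing B]
    [Algebra ℂ B] {E : A → A → Prop} {F : B → B → Prop} {q : ZMod N → ZMod N → A}
    (h : PermRelations ω E q) (f : A →⋆ₐ[ℂ] B) (hf : ∀ x y, E x y → F (f x) (f y)) :
    PermRelations ω F (fun i j => f (q i j)) where
  zero_left i := by simpa [apply_ite f] using hf _ _ (h.zero_left i)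
  zero_right i := by simpa [apply_ite f] using hf _ _ (h.zero_right i)
  star_eq i j := by simpa [map_star] using hf _ _ (h.star_eq i j)
  col_add i j k := by simpa using hf _ _ (h.col_add i j k)
  row_add i j k := by simpa using hf _ _ (h.row_add i j k)

/-- A homomorphism whose values on generators satisfy the relations identifies both sides of each
relation among the free generators. -/
theorem PermRelations.comap {A B : Type*} [Ring A] [StarRing A] [Algebra ℂ A] [Ring B] [StarRing B]
    [Algebra ℂ B] {E : A → A → Prop} {F : B → B → Prop} {q : ZMod N → ZMod N → A}
    (f : A →⋆ₐ[ℂ] B) (h : PermRelations ω F (fun i j => f (q i j)))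
    (hf : ∀ x y, F (f x) (f y) → E x y) :
    PermRelations ω E q where
  zero_left i := hf _ _ (by simpa [apply_ite f] using h.zero_left i)
  zero_right i := hf _ _ (by simpa [apply_ite f] using h.zero_right i)
  star_eq i j := hf _ _ (by simpa [map_star] using h.star_eq i j)
  col_add i j k := hf _ _ (by simpa using h.col_add i j k)
  row_add i j k := hf _ _ (by simpa using h.row_add i j k)

/-- The columns of a matrix satisfying the relations are orthonormal. -/
theorem PermRelations.column_unitary {B : Type*} [Ring B] [StarRing B]
    [Algebra ℂ B] {q : ZMod N → ZMod N → B} (h : PermRelations ω Eq q) (j : ZMod N) :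
    ∑ l, star (q l j) * q l j = 1 := by
  have h1 := h.col_add (-j) j 0
  rw [neg_add_cancel, h.zero_left 0, if_pos rfl] at h1
  rw [h1]
  refine Finset.sum_congr rfl fun l _ => ?_
  rw [h.star_eq, smul_mul_assoc, zero_sub]
  congr 3
  ring

theorem PermRelations.norm_le_one {B : Type*} [CStarAlgebra B]
    {q : ZMod N → ZMod N → B} (h : PermRelations ω Eq q) (i j : ZMod N) : ‖q i j‖ ≤ 1 := by
  let := CStarAlgebra.spectralOrder B
  have := CStarAlgebra.spectralOrderedRing B
  have h1 : star (q i j) * q i j ≤ 1 := by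
    rw [← h.column_unitary j]
    exact Finset.single_le_sum (f := fun l => star (q l j) * q l j)
      (fun l _ => star_mul_self_nonneg _) (Finset.mem_univ i)
  have h2 : ‖star (q i j) * q i j‖ ≤ 1 :=
    (CStarAlgebra.norm_le_one_iff_of_nonneg _ (star_mul_self_nonneg _)).2 h1
  rw [CStarRing.norm_star_mul_self] at h2
  nlinarith [norm_nonneg (q i j)]

theorem permSeminorms_nonempty : (permSeminorms N ω).Nonempty := by
  refine ⟨{ toSeminorm := 0, mul_le' := fun x y => ?_, star_mul_self' := fun x => ?_ }, ?_⟩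
  · exact (mul_zero (0 : ℝ)).ge
  · exact (zero_pow two_ne_zero).symm
  · exact ⟨fun _ => rfl, fun _ => rfl, fun _ _ => rfl, fun _ _ _ => rfl, fun _ _ _ => rfl⟩

theorem coeHom_relations {p : CStarSeminorm (FreeStarAlgebra (ZMod N × ZMod N))}
    (hp : p ∈ permSeminorms N ω) :
    PermRelations ω Eq (fun i j => p.coeHom (freeGen (N := N) i j)) :=
  PermRelations.map hp p.coeHom fun x y h => by
    rw [← sub_eq_zero, ← map_sub, ← norm_eq_zero]
    exact (p.norm_coe _).trans h

theorem permSeminorms_bddAbove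
    (x : FreeStarAlgebra (ZMod N × ZMod N)) :
    BddAbove ((fun p : CStarSeminorm (FreeStarAlgebra (ZMod N × ZMod N)) => p x) ''
      permSeminorms N ω) := by
  suffices h : ∃ c : ℝ, 0 ≤ c ∧ ∀ p ∈ permSeminorms N ω, p x ≤ c by
    obtain ⟨c, -, hc⟩ := h
    exact ⟨c, by rintro _ ⟨p, hp, rfl⟩; exact hc p hp⟩
  induction x using FreeStarAlgebra.induction with
  | h1 c =>
    refine ⟨‖c‖, norm_nonneg c, fun p _ => ?_⟩
    rw [Algebra.algebraMap_eq_smul_one]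
    refine (map_smul_eq_mul p.toSeminorm c 1).le.trans ?_
    exact mul_le_of_le_one_right (norm_nonneg c) p.one_le
  | h2 a =>
    refine ⟨1, zero_le_one, fun p hp => ?_⟩
    obtain ⟨⟨i, j⟩, e⟩ := a
    have h1 : p (freeGen i j) ≤ 1 :=
      (p.norm_coe _).symm.le.trans ((coeHom_relations hp).norm_le_one i j)
    cases e
    · exact h1
    · rw [← FreeStarAlgebra.star_gen, p.star]; exact h1
  | h3 x y hx hy =>
    obtain ⟨c, hc0, hc⟩ := hx
    obtain ⟨d, hd0, hd⟩ := hy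
    exact ⟨c * d, mul_nonneg hc0 hd0, fun p hp => (p.mul_le x y).trans
      (mul_le_mul (hc p hp) (hd p hp) (p.nonneg y) hc0)⟩
  | h4 x y hx hy =>
    obtain ⟨c, hc0, hc⟩ := hx
    obtain ⟨d, hd0, hd⟩ := hy
    exact ⟨c + d, add_nonneg hc0 hd0, fun p hp => (map_add_le_add p.toSeminorm x y).trans
      (add_le_add (hc p hp) (hd p hp))⟩

/-- The largest `C*`-seminorm for which the relations hold. -/
noncomputable def permSeminorm (N : ℕ) [NeZero N] (ω : ℂ) :
    CStarSeminorm (FreeStarAlgebra (ZMod N × ZMod N)) :=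
  CStarSeminorm.sup (permSeminorms N ω) permSeminorms_nonempty (permSeminorms_bddAbove)

theorem permSeminorm_mem : permSeminorm N ω ∈ permSeminorms N ω := by
  have key : ∀ x, (∀ p ∈ permSeminorms N ω, p x = 0) → permSeminorm N ω x = 0 := fun x hx => by
    refine le_antisymm (csSup_le (permSeminorms_nonempty.image _) ?_) ((permSeminorm N ω).nonneg x)
    rintro _ ⟨p, hp, rfl⟩
    exact (hx p hp).le
  exact ⟨fun i => key _ fun p hp => hp.zero_left i, fun i => key _ fun p hp => hp.zero_right i,
    fun i j => key _ fun p hp => hp.star_eq i j, fun i j k => key _ fun p hp => hp.col_add i j k,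
    fun i j k => key _ fun p hp => hp.row_add i j k⟩

/-- The universal unital `C*`-algebra with generators `q i j` subject to the defining relations:
the completion of the universal unital `*`-algebra in its largest `C*`-seminorm. -/
def PermAlg (N : ℕ) [NeZero N] (ω : ℂ) : Type := (permSeminorm N ω).Compl

noncomputable instance instCStarAlgebraPermAlg : CStarAlgebra (PermAlg N ω) :=
  inferInstanceAs (CStarAlgebra (permSeminorm N ω).Compl)

/-- The generators of the universal `C*`-algebra. -/
noncomputable def permGen (N : ℕ) [NeZero N] (ω : ℂ) (i j : ZMod N) : PermAlg N ω :=
  (permSeminorm N ω).coeHom (freeGen i j)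

theorem permGen_relations : PermRelations ω Eq (permGen N ω) :=
  coeHom_relations permSeminorm_mem

theorem eval_le_permSeminorm {B : Type*} [CStarAlgebra B]
    {b : ZMod N → ZMod N → B} (hb : PermRelations ω Eq b)
    (x : FreeStarAlgebra (ZMod N × ZMod N)) :
    ‖FreeStarAlgebra.eval (fun ij : ZMod N × ZMod N => b ij.1 ij.2) x‖ ≤ permSeminorm N ω x := by
  set f := FreeStarAlgebra.eval (fun ij : ZMod N × ZMod N => b ij.1 ij.2) with hf
  have hfg : ∀ i j, f (freeGen i j) = b i j := fun i j => FreeStarAlgebra.eval_gen _ _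
  refine le_csSup (permSeminorms_bddAbove x) ⟨CStarSeminorm.ofHom f, ?_, rfl⟩
  refine PermRelations.comap (F := Eq) f ?_ fun x y h => ?_
  · simpa only [hfg] using hb
  · change ‖f (x - y)‖ = 0
    rw [map_sub, h, sub_self, norm_zero]

/-- The universal property: existence. -/
noncomputable def permLift {B : Type*} [CStarAlgebra B]
    (b : ZMod N → ZMod N → B) (hb : PermRelations ω Eq b) : PermAlg N ω →⋆ₐ[ℂ] B :=
  (permSeminorm N ω).extend (FreeStarAlgebra.eval (fun ij : ZMod N × ZMod N => b ij.1 ij.2))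
    (eval_le_permSeminorm hb)

theorem permLift_gen {B : Type*} [CStarAlgebra B]
    (b : ZMod N → ZMod N → B) (hb : PermRelations ω Eq b) (i j : ZMod N) :
    permLift b hb (permGen N ω i j) = b i j :=
  ((permSeminorm N ω).extend_coe _ _ _).trans (FreeStarAlgebra.eval_gen _ _)

/-- The universal property: uniqueness. -/
theorem permAlg_hom_ext {B : Type*} [CStarAlgebra B]
    {f g : PermAlg N ω →⋆ₐ[ℂ] B} (h : ∀ i j, f (permGen N ω i j) = g (permGen N ω i j)) : f = g := by
  refine (permSeminorm N ω).hom_ext fun a => ?_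
  change f ((permSeminorm N ω).coeHom a) = g ((permSeminorm N ω).coeHom a)
  induction a using FreeStarAlgebra.induction with
  | h1 c =>
    rw [AlgHomClass.commutes]
    exact (AlgHomClass.commutes f c).trans (AlgHomClass.commutes g c).symm
  | h2 a =>
    obtain ⟨⟨i, j⟩, e⟩ := a
    cases e
    · exact h i j
    · rw [← FreeStarAlgebra.star_gen, map_star]
      exact (map_star f _).trans ((congrArg star (h i j)).trans (map_star g _).symm)
  | h3 x y hx hy =>
    rw [map_mul]
    exact (map_mul f _ _).trans ((congrArg₂ _ hx hy).trans (map_mul g _ _).symm)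
  | h4 x y hx hy =>
    rw [map_add]
    exact (map_add f _ _).trans ((congrArg₂ _ hx hy).trans (map_add g _ _).symm)

end Perm
end Anyonic
namespace Anyonic

/-! ### Coactions of `C(ℤ/N)` -/

/-- A coaction of `C(ℤ/N)` on a unital `C*`-algebra `X`. Here `X ⊗ C(ℤ/N)` is identified with
`C(ℤ/N, X)`, and `X ⊗ C(ℤ/N) ⊗ C(ℤ/N)` with functions of two variables. -/
structure Coaction (N : ℕ) [NeZero N] (X : Type*) [CStarAlgebra X] where
  /-- The coaction, with `ρ x t` the value at `t` of the function `ρ x`. -/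
  ρ : X →⋆ₐ[ℂ] (ZMod N → X)
  coassoc : ∀ x s t, ρ (ρ x t) s = ρ x (s + t)
  podles : (Submodule.span ℂ {F : ZMod N → X | ∃ (x : X) (f : ZMod N → ℂ),
    F = fun t => f t • ρ x t}).topologicalClosure = ⊤

/-- A `*`-homomorphism between `ℤ/N`-`C*`-algebras is equivariant. -/
def IsEquivariant {N : ℕ} [NeZero N] {X Y : Type*} [CStarAlgebra X] [CStarAlgebra Y]
    (α : Coaction N X) (β : Coaction N Y) (f : X →⋆ₐ[ℂ] Y) : Prop :=
  ∀ x t, β.ρ (f x) t = f (α.ρ x t)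

/-- A family of `*`-endomorphisms forming an action of `ℤ/N` gives a coaction of `C(ℤ/N)`. -/
def Coaction.ofAction {N : ℕ} [NeZero N] {X : Type*} [CStarAlgebra X]
    (σ : ZMod N → X →⋆ₐ[ℂ] X) (h0 : ∀ x, σ 0 x = x)
    (hadd : ∀ x s t, σ s (σ t x) = σ (s + t) x) : Coaction N X where
  ρ :=
    { toFun := fun x t => σ t x
      map_one' := by funext t; simp
      map_mul' := fun x y => by funext t; simp
      map_zero' := by funext t; simp
      map_add' := fun x y => by funext t; simp
      commutes' := fun c => by
        funext t
        exact AlgHomClass.commutes (σ t) c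
      map_star' := fun x => by
        funext t
        exact map_star (σ t) x }
  coassoc := hadd
  podles := by
    refine eq_top_iff.2 (le_trans ?_ (Submodule.le_topologicalClosure _))
    intro F _
    have hF : F = ∑ s, Pi.single s (F s) := by
      funext t; simp [Finset.sum_apply, Pi.single_apply]
    rw [hF]
    refine Submodule.sum_mem _ fun s _ => Submodule.subset_span
      ⟨σ (-s) (F s), Pi.single s 1, ?_⟩
    funext t
    change (Pi.single s (F s) : ZMod N → X) t = (Pi.single s (1 : ℂ) : ZMod N → ℂ) t • σ t (σ (-s) (F s))
    by_cases ht : t = s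
    · subst ht
      simp [hadd, h0]
    · simp [ht]

section PermCoaction

variable {N : ℕ} [NeZero N] {ω : ℂ}

/-- The relations are homogeneous when `q i j` has degree `j - i`. -/
theorem permGen_rotate (hω : IsPrimitiveRoot ω N) (t : ZMod N) :
    PermRelations ω Eq (fun i j => rootPow ω (t * (j - i)) • permGen N ω i j) := by
  have h := permGen_relations (N := N) (ω := ω)
  refine ⟨fun i => ?_, fun i => ?_, fun i j => ?_, fun i j k => ?_, fun i j k => ?_⟩
  · rw [h.zero_left]
    by_cases hi : i = 0
    · subst hi; simp [rootPow_zero]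
    · simp [hi]
  · rw [h.zero_right]
    by_cases hi : i = 0
    · subst hi; simp [rootPow_zero]
    · simp [hi]
  · rw [star_smul, h.star_eq, star_rootPow hω, smul_smul, smul_smul, ← rootPow_add hω,
      ← rootPow_add hω]
    congr 2
    ring
  · rw [h.col_add, Finset.smul_sum]
    refine Finset.sum_congr rfl fun l _ => ?_
    rw [smul_mul_smul_comm, smul_smul, smul_smul, ← rootPow_add hω, ← rootPow_add hω,
      ← rootPow_add hω]
    congr 2
    ring
  · rw [h.row_add, Finset.smul_sum]
    refine Finset.sum_congr rfl fun l _ => ?_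
    rw [smul_mul_smul_comm, smul_smul, smul_smul, ← rootPow_add hω, ← rootPow_add hω,
      ← rootPow_add hω]
    congr 2
    ring

/-- The coaction on the universal `C*`-algebra, `ρ_t (q i j) = ω ^ (t (j - i)) q i j`. -/
noncomputable def permCoaction (hω : IsPrimitiveRoot ω N) : Coaction N (PermAlg N ω) :=
  Coaction.ofAction (fun t => permLift _ (permGen_rotate hω t))
    (fun x => by
      have : permLift _ (permGen_rotate hω 0) = StarAlgHom.id ℂ (PermAlg N ω) :=
        permAlg_hom_ext fun i j => by
          rw [permLift_gen, zero_mul, rootPow_zero, one_smul]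
          rfl
      rw [this]
      rfl)
    (fun x s t => by
      have : (permLift _ (permGen_rotate hω s)).comp (permLift _ (permGen_rotate hω t)) =
          permLift _ (permGen_rotate hω (s + t)) :=
        permAlg_hom_ext fun i j => by
          rw [StarAlgHom.comp_apply, permLift_gen, permLift_gen, map_smul, permLift_gen,
            smul_smul, ← rootPow_add hω, ← add_mul, add_comm t s]
      rw [← this]
      rfl)

theorem permCoaction_gen (hω : IsPrimitiveRoot ω N) (i j t : ZMod N) :
    (permCoaction hω).ρ (permGen N ω i j) t = rootPow ω (t * (j - i)) • permGen N ω i j :=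
  permLift_gen _ (permGen_rotate hω t) i j

end PermCoaction
end Anyonic
namespace Anyonic


/-! ### Hilbert space tensor products -/

section HilbertTensor

open scoped TensorProduct

/-- The Hilbert space tensor product. -/
def HTensor (H K : Type*) [NormedAddCommGroup H] [InnerProductSpace ℂ H]
    [NormedAddCommGroup K] [InnerProductSpace ℂ K] : Type _ :=
  UniformSpace.Completion (H ⊗[ℂ] K)

noncomputable instance instNormedAddCommGroupHTensor (H K : Type*) [NormedAddCommGroup H]
    [InnerProductSpace ℂ H] [NormedAddCommGroup K] [InnerProductSpace ℂ K] :
    NormedAddCommGroup (HTensor H K) :=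
  inferInstanceAs (NormedAddCommGroup (UniformSpace.Completion (H ⊗[ℂ] K)))

noncomputable instance instInnerProductSpaceHTensor (H K : Type*) [NormedAddCommGroup H]
    [InnerProductSpace ℂ H] [NormedAddCommGroup K] [InnerProductSpace ℂ K] :
    InnerProductSpace ℂ (HTensor H K) :=
  inferInstanceAs (InnerProductSpace ℂ (UniformSpace.Completion (H ⊗[ℂ] K)))

instance instCompleteSpaceHTensor (H K : Type*) [NormedAddCommGroup H]
    [InnerProductSpace ℂ H] [NormedAddCommGroup K] [InnerProductSpace ℂ K] :
    CompleteSpace (HTensor H K) :=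
  inferInstanceAs (CompleteSpace (UniformSpace.Completion (H ⊗[ℂ] K)))

variable {H K H' K' H'' K'' : Type*}
  [NormedAddCommGroup H] [InnerProductSpace ℂ H] [CompleteSpace H]
  [NormedAddCommGroup K] [InnerProductSpace ℂ K] [CompleteSpace K]
  [NormedAddCommGroup H'] [InnerProductSpace ℂ H'] [CompleteSpace H']
  [NormedAddCommGroup K'] [InnerProductSpace ℂ K'] [CompleteSpace K']
  [NormedAddCommGroup H''] [InnerProductSpace ℂ H''] [CompleteSpace H'']
  [NormedAddCommGroup K''] [InnerProductSpace ℂ K''] [CompleteSpace K'']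

/-- The embedding of the algebraic tensor product. -/
noncomputable def hcoe (H K : Type*) [NormedAddCommGroup H] [InnerProductSpace ℂ H]
    [NormedAddCommGroup K] [InnerProductSpace ℂ K] : H ⊗[ℂ] K →ₗᵢ[ℂ] HTensor H K :=
  UniformSpace.Completion.toComplₗᵢ

/-- The elementary tensor of two vectors. -/
noncomputable def htmul (x : H) (y : K) : HTensor H K := hcoe H K (x ⊗ₜ[ℂ] y)

/-- The tensor product of two bounded operators, `x ⊗ y ↦ f x ⊗ g y`. -/
noncomputable def tmap (f : H →L[ℂ] H') (g : K →L[ℂ] K') : HTensor H K →L[ℂ] HTensor H' K' :=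
  (TensorProduct.mapL f g).completion

/-- The flip `x ⊗ y ↦ y ⊗ x`. -/
noncomputable def tflip (H K : Type*) [NormedAddCommGroup H] [InnerProductSpace ℂ H]
    [NormedAddCommGroup K] [InnerProductSpace ℂ K] : HTensor H K →L[ℂ] HTensor K H :=
  ((TensorProduct.commIsometry ℂ H K : H ⊗[ℂ] K ≃ₗᵢ[ℂ] K ⊗[ℂ] H) :
    H ⊗[ℂ] K →L[ℂ] K ⊗[ℂ] H).completion

theorem tmap_htmul (f : H →L[ℂ] H') (g : K →L[ℂ] K') (x : H) (y : K) :
    tmap f g (htmul x y) = htmul (f x) (g y) :=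
  ContinuousLinearMap.completion_apply_coe _ _

theorem tflip_htmul (x : H) (y : K) : tflip H K (htmul x y) = htmul y x :=
  ContinuousLinearMap.completion_apply_coe _ _

/-- Bounded operators on a tensor product are determined by elementary tensors. -/
theorem htensor_ext {E : Type*} [NormedAddCommGroup E] [NormedSpace ℂ E]
    {S T : HTensor H K →L[ℂ] E} (h : ∀ x y, S (htmul x y) = T (htmul x y)) : S = T := by
  have key : ∀ a : H ⊗[ℂ] K, S (hcoe H K a) = T (hcoe H K a) := fun a => by
    induction a using TensorProduct.induction_on with
    | zero => rw [map_zero, map_zero, map_zero]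
    | tmul x y => exact h x y
    | add a b ha hb => rw [map_add, map_add, map_add, ha, hb]
  have hd : DenseRange (hcoe H K) :=
    UniformSpace.Completion.denseRange_coe (α := H ⊗[ℂ] K)
  exact DFunLike.coe_injective
    (hd.equalizer S.continuous T.continuous (funext key))

theorem htmul_add_left (x x' : H) (y : K) : htmul (x + x') y = htmul x y + htmul x' y := by
  rw [htmul, TensorProduct.add_tmul, map_add]; rfl

theorem htmul_add_right (x : H) (y y' : K) : htmul x (y + y') = htmul x y + htmul x y' := by
  rw [htmul, TensorProduct.tmul_add, map_add]; rfl

theorem htmul_smul_left (c : ℂ) (x : H) (y : K) : htmul (c • x) y = c • htmul x y := by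
  rw [htmul, ← TensorProduct.smul_tmul', map_smul]; rfl

theorem htmul_smul_right (c : ℂ) (x : H) (y : K) : htmul x (c • y) = c • htmul x y := by
  rw [htmul, TensorProduct.tmul_smul, map_smul]; rfl

theorem inner_htmul (x x' : H) (y y' : K) :
    inner ℂ (htmul x y) (htmul x' y') = inner ℂ x x' * inner ℂ y y' := by
  rw [htmul, htmul, LinearIsometry.inner_map_map, TensorProduct.inner_tmul]

theorem tmap_comp (f' : H' →L[ℂ] H'') (g' : K' →L[ℂ] K'') (f : H →L[ℂ] H') (g : K →L[ℂ] K') :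
    tmap f' g' ∘L tmap f g = tmap (f' ∘L f) (g' ∘L g) :=
  htensor_ext fun x y => by
    simp only [ContinuousLinearMap.comp_apply, tmap_htmul]

theorem tmap_mul (f' f : H →L[ℂ] H) (g' g : K →L[ℂ] K) :
    tmap f' g' * tmap f g = tmap (f' * f) (g' * g) := tmap_comp _ _ _ _

theorem tmap_one : tmap (1 : H →L[ℂ] H) (1 : K →L[ℂ] K) = 1 :=
  htensor_ext fun x y => by rw [tmap_htmul]; rfl

theorem tmap_add_left (f f' : H →L[ℂ] H') (g : K →L[ℂ] K') :
    tmap (f + f') g = tmap f g + tmap f' g :=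
  htensor_ext fun x y => by
    simp only [add_apply, tmap_htmul, htmul_add_left]

theorem tmap_add_right (f : H →L[ℂ] H') (g g' : K →L[ℂ] K') :
    tmap f (g + g') = tmap f g + tmap f g' :=
  htensor_ext fun x y => by
    simp only [add_apply, tmap_htmul, htmul_add_right]

theorem tmap_smul_left (c : ℂ) (f : H →L[ℂ] H') (g : K →L[ℂ] K') :
    tmap (c • f) g = c • tmap f g :=
  htensor_ext fun x y => by
    simp only [smul_apply, tmap_htmul, htmul_smul_left]

theorem tmap_smul_right (c : ℂ) (f : H →L[ℂ] H') (g : K →L[ℂ] K') :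
    tmap f (c • g) = c • tmap f g :=
  htensor_ext fun x y => by
    simp only [smul_apply, tmap_htmul, htmul_smul_right]

theorem tmap_zero_left (g : K →L[ℂ] K') : tmap (0 : H →L[ℂ] H') g = 0 := by
  rw [← zero_smul ℂ (0 : H →L[ℂ] H'), tmap_smul_left, zero_smul]

theorem tmap_zero_right (f : H →L[ℂ] H') : tmap f (0 : K →L[ℂ] K') = 0 := by
  rw [← zero_smul ℂ (0 : K →L[ℂ] K'), tmap_smul_right, zero_smul]

theorem tmap_sum_left {ι : Type*} (s : Finset ι) (f : ι → H →L[ℂ] H') (g : K →L[ℂ] K') :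
    tmap (∑ i ∈ s, f i) g = ∑ i ∈ s, tmap (f i) g := by
  induction s using Finset.cons_induction with
  | empty => rw [Finset.sum_empty, Finset.sum_empty, tmap_zero_left]
  | cons a s h ih => rw [Finset.sum_cons, Finset.sum_cons, tmap_add_left, ih]

theorem tmap_sum_right {ι : Type*} (s : Finset ι) (f : H →L[ℂ] H') (g : ι → K →L[ℂ] K') :
    tmap f (∑ i ∈ s, g i) = ∑ i ∈ s, tmap f (g i) := by
  induction s using Finset.cons_induction with
  | empty => rw [Finset.sum_empty, Finset.sum_empty, tmap_zero_right]
  | cons a s h ih => rw [Finset.sum_cons, Finset.sum_cons, tmap_add_right, ih]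

theorem tflip_comp_tmap (f : H →L[ℂ] H') (g : K →L[ℂ] K') :
    tflip H' K' ∘L tmap f g = tmap g f ∘L tflip H K :=
  htensor_ext fun x y => by
    simp only [ContinuousLinearMap.comp_apply, tmap_htmul, tflip_htmul]

theorem tflip_tflip : tflip K H ∘L tflip H K = 1 :=
  htensor_ext fun x y => by
    simp only [ContinuousLinearMap.comp_apply, tflip_htmul]
    rfl

theorem inner_ext_htensor {u v : HTensor H K}
    (h : ∀ x y, inner ℂ (htmul x y) u = inner ℂ (htmul x y) v) : u = v := by
  have h1 := htensor_ext (S := innerSL ℂ u) (T := innerSL ℂ v) fun x y => by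
    have := congrArg (starRingEnd ℂ) (h x y)
    rw [inner_conj_symm, inner_conj_symm] at this
    rw [innerSL_apply_apply, innerSL_apply_apply, this]
  refine ext_inner_right ℂ fun z => ?_
  have := congrArg (fun f : HTensor H K →L[ℂ] ℂ => f z) h1
  simpa only [innerSL_apply_apply] using this

theorem adjoint_tmap (f : H →L[ℂ] H') (g : K →L[ℂ] K') :
    (tmap f g).adjoint = tmap f.adjoint g.adjoint :=
  htensor_ext fun x y => inner_ext_htensor fun x' y' => by
    rw [ContinuousLinearMap.adjoint_inner_right, tmap_htmul, tmap_htmul, inner_htmul, inner_htmul,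
      ContinuousLinearMap.adjoint_inner_right, ContinuousLinearMap.adjoint_inner_right]

theorem adjoint_tflip : (tflip H K).adjoint = tflip K H :=
  htensor_ext fun x y => inner_ext_htensor fun x' y' => by
    rw [ContinuousLinearMap.adjoint_inner_right, tflip_htmul, tflip_htmul, inner_htmul,
      inner_htmul, mul_comm]

theorem star_tmap (f : H →L[ℂ] H) (g : K →L[ℂ] K) :
    star (tmap f g) = tmap (star f) (star g) := adjoint_tmap f g

end HilbertTensor

/-! ### Unitary representations of `ℤ/N` and the braiding -/

section Braiding

/-- Unitary representations of `ℤ/N` on a Hilbert space. -/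
abbrev URep (N : ℕ) (H : Type*) [NormedAddCommGroup H] [InnerProductSpace ℂ H] [CompleteSpace H] :
    Type _ := Multiplicative (ZMod N) →* unitary (H →L[ℂ] H)

variable {N : ℕ} [NeZero N] {H K : Type*}
  [NormedAddCommGroup H] [InnerProductSpace ℂ H] [CompleteSpace H]
  [NormedAddCommGroup K] [InnerProductSpace ℂ K] [CompleteSpace K]

/-- The operator by which `t` acts. -/
noncomputable def URep.op (U : URep N H) (t : ZMod N) : H →L[ℂ] H := (U (Multiplicative.ofAdd t) : H →L[ℂ] H)

theorem URep.op_zero (U : URep N H) : U.op 0 = 1 := by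
  rw [URep.op, ofAdd_zero, map_one]; rfl

theorem URep.op_add (U : URep N H) (s t : ZMod N) : U.op (s + t) = U.op s * U.op t := by
  rw [URep.op, ofAdd_add, map_mul]; rfl

theorem URep.star_op (U : URep N H) (t : ZMod N) : star (U.op t) = U.op (-t) := by
  have h1 : star (U.op t) * U.op t = 1 := Unitary.coe_star_mul_self (U (Multiplicative.ofAdd t))
  calc star (U.op t) = star (U.op t) * (U.op t * U.op (-t)) := by
        rw [← U.op_add, add_neg_cancel, U.op_zero, mul_one]
    _ = U.op (-t) := by rw [← mul_assoc, h1, one_mul]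

/-- The orthogonal projection onto the vectors `v` of degree `m`, i.e. with
`U t v = ω ^ (t m) v` for all `t`. -/
noncomputable def URep.proj (ω : ℂ) (U : URep N H) (m : ZMod N) : H →L[ℂ] H :=
  (N : ℂ)⁻¹ • ∑ t, rootPow ω (-(t * m)) • U.op t

theorem sum_rootPow {ω : ℂ} (hω : IsPrimitiveRoot ω N) (a : ZMod N) :
    ∑ t, rootPow ω (t * a) = if a = 0 then (N : ℂ) else 0 := by
  split_ifs with h
  · subst h
    simp [rootPow_zero, ZMod.card]
  · have h1 : rootPow ω a ≠ 1 := by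
      intro h1
      have h2 := (hω.pow_eq_one_iff_dvd _).1 h1
      have h3 := Nat.eq_zero_of_dvd_of_lt h2 (ZMod.val_lt a)
      exact h ((ZMod.val_eq_zero a).1 h3)
    have h2 : rootPow ω a * ∑ t, rootPow ω (t * a) = ∑ t, rootPow ω (t * a) := by
      rw [Finset.mul_sum]
      refine Fintype.sum_equiv (Equiv.addRight 1) _ _ fun t => ?_
      rw [← rootPow_add hω]
      congr 1
      simp; ring
    have h3 : (rootPow ω a - 1) * ∑ t, rootPow ω (t * a) = 0 := by
      rw [sub_mul, h2, one_mul, sub_self]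
    exact (mul_eq_zero.1 h3).resolve_left (sub_ne_zero.2 h1)

theorem URep.op_mul_proj {ω : ℂ} (hω : IsPrimitiveRoot ω N) (U : URep N H) (s m : ZMod N) :
    U.op s * U.proj ω m = rootPow ω (s * m) • U.proj ω m := by
  have h : U.op s * ∑ t, rootPow ω (-(t * m)) • U.op t =
      rootPow ω (s * m) • ∑ t, rootPow ω (-(t * m)) • U.op t := by
    rw [Finset.mul_sum, Finset.smul_sum]
    refine Fintype.sum_equiv (Equiv.addLeft s) _ _ fun t => ?_
    rw [mul_smul_comm, smul_smul, ← rootPow_add hω, ← U.op_add, Equiv.coe_addLeft]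
    congr 2
    ring
  rw [URep.proj, mul_smul_comm, h, smul_comm]

theorem URep.proj_mul_proj {ω : ℂ} (hω : IsPrimitiveRoot ω N) (U : URep N H) (m n : ZMod N) :
    U.proj ω m * U.proj ω n = if m = n then U.proj ω m else 0 := by
  have h0 : U.proj ω m * U.proj ω n =
      (N : ℂ)⁻¹ • ∑ t, rootPow ω (-(t * m)) • U.op t * U.proj ω n := by
    rw [← Finset.sum_mul, ← smul_mul_assoc]
    rfl
  rw [h0]
  have h : ∀ t, rootPow ω (-(t * m)) • U.op t * U.proj ω n =
      rootPow ω (t * (n - m)) • U.proj ω n := fun t => by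
    rw [smul_mul_assoc, U.op_mul_proj hω, smul_smul, ← rootPow_add hω]
    congr 2
    ring
  rw [Finset.sum_congr rfl fun t _ => h t, ← Finset.sum_smul, sum_rootPow hω, smul_smul]
  by_cases hmn : m = n
  · subst hmn
    simp [NeZero.ne N]
  · rw [if_neg hmn, if_neg (fun h => hmn (sub_eq_zero.1 h).symm)]
    simp

theorem URep.sum_proj {ω : ℂ} (hω : IsPrimitiveRoot ω N) (U : URep N H) :
    ∑ m, U.proj ω m = 1 := by
  simp only [URep.proj]
  rw [← Finset.smul_sum, Finset.sum_comm]
  have h : ∀ t : ZMod N, ∑ m : ZMod N, rootPow ω (-(t * m)) • U.op t =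
      if t = 0 then (N : ℂ) • 1 else 0 := fun t => by
    have h1 := sum_rootPow hω (-t)
    rw [← Finset.sum_smul]
    have h2 : ∑ m : ZMod N, rootPow ω (-(t * m)) = ∑ m, rootPow ω (m * -t) :=
      Finset.sum_congr rfl fun m _ => by congr 1; ring
    rw [h2, h1]
    by_cases ht : t = 0
    · subst ht
      simp [U.op_zero]
    · simp [ht]
  rw [Finset.sum_congr rfl fun t _ => h t]
  simp [smul_smul, NeZero.ne N]

theorem URep.star_proj {ω : ℂ} (hω : IsPrimitiveRoot ω N) (U : URep N H) (m : ZMod N) :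
    star (U.proj ω m) = U.proj ω m := by
  rw [URep.proj, star_smul, star_sum]
  congr 1
  · simp
  · refine Fintype.sum_equiv (Equiv.neg (ZMod N)) _ _ fun t => ?_
    rw [star_smul, star_rootPow hω, U.star_op]
    simp

theorem URep.proj_mul_op {ω : ℂ} (hω : IsPrimitiveRoot ω N) (U : URep N H) (s m : ZMod N) :
    U.proj ω m * U.op s = rootPow ω (s * m) • U.proj ω m := by
  have h := congrArg star (U.op_mul_proj hω (-s) m)
  rw [star_mul, U.star_proj hω, U.star_op, neg_neg, star_smul, U.star_proj hω,
    star_rootPow hω] at h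
  rw [h]
  congr 2
  ring

/-- The braiding `c : H ⊗ K → K ⊗ H`, `v ⊗ w ↦ ω ^ (m n) w ⊗ v` for `v` of degree `m` and `w` of
degree `n`. -/
noncomputable def braid (ω : ℂ) (U : URep N H) (V : URep N K) : HTensor H K →L[ℂ] HTensor K H :=
  tflip H K ∘L
    ∑ p : ZMod N × ZMod N, rootPow ω (p.1 * p.2) • tmap (U.proj ω p.1) (V.proj ω p.2)

/-- The dual braiding `K ⊗ H → H ⊗ K`, `w ⊗ v ↦ ω ^ (-m n) v ⊗ w` for `v` of degree `m` and `w` of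
degree `n`. -/
noncomputable def braidDual (ω : ℂ) (U : URep N H) (V : URep N K) :
    HTensor K H →L[ℂ] HTensor H K :=
  (∑ p : ZMod N × ZMod N, rootPow ω (-(p.1 * p.2)) • tmap (U.proj ω p.1) (V.proj ω p.2)) ∘L
    tflip K H

theorem URep.proj_apply_of_degree {ω : ℂ} (hω : IsPrimitiveRoot ω N) (U : URep N H) {v : H}
    {a : ZMod N} (hv : ∀ t, U.op t v = rootPow ω (t * a) • v) (m : ZMod N) :
    U.proj ω m v = if m = a then v else 0 := by
  have h : U.proj ω m v = ((N : ℂ)⁻¹ * ∑ t, rootPow ω (t * (a - m))) • v := by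
    rw [URep.proj, smul_apply, sum_apply, mul_smul,
      Finset.sum_smul]
    congr 1
    refine Finset.sum_congr rfl fun t _ => ?_
    rw [smul_apply, hv, smul_smul, ← rootPow_add hω]
    congr 2
    ring
  rw [h, sum_rootPow hω]
  by_cases hm : m = a
  · subst hm
    simp [NeZero.ne N]
  · rw [if_neg hm, if_neg (fun h => hm (sub_eq_zero.1 h).symm)]
    simp

/-- The braiding on homogeneous vectors. -/
theorem braid_htmul {ω : ℂ} (hω : IsPrimitiveRoot ω N) (U : URep N H) (V : URep N K) {v : H}
    {w : K} {a b : ZMod N} (hv : ∀ t, U.op t v = rootPow ω (t * a) • v)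
    (hw : ∀ t, V.op t w = rootPow ω (t * b) • w) :
    braid ω U V (htmul v w) = rootPow ω (a * b) • htmul w v := by
  have h0 : htmul (0 : H) (0 : K) = 0 := by
    rw [← zero_smul ℂ (0 : H), htmul_smul_left, zero_smul]
  have h1 : htmul (0 : H) w = 0 := by rw [← zero_smul ℂ (0 : H), htmul_smul_left, zero_smul]
  have h2 : htmul v (0 : K) = 0 := by rw [← zero_smul ℂ (0 : K), htmul_smul_right, zero_smul]
  rw [braid, ContinuousLinearMap.comp_apply, sum_apply, Finset.sum_eq_single (a, b)]
  · rw [smul_apply, tmap_htmul, U.proj_apply_of_degree hω hv, V.proj_apply_of_degree hω hw,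
      if_pos rfl, if_pos rfl, map_smul, tflip_htmul]
  · rintro ⟨m, n⟩ _ hmn
    rw [smul_apply, tmap_htmul, U.proj_apply_of_degree hω hv, V.proj_apply_of_degree hω hw]
    split_ifs with hm hn hn
    · exact absurd (Prod.ext hm hn) hmn
    · rw [h2, smul_zero]
    · rw [h1, smul_zero]
    · rw [h0, smul_zero]
  · simp

theorem tmap_proj_mul {ω : ℂ} (hω : IsPrimitiveRoot ω N) (U : URep N H) (V : URep N K)
    (p q : ZMod N × ZMod N) :
    tmap (U.proj ω p.1) (V.proj ω p.2) * tmap (U.proj ω q.1) (V.proj ω q.2) =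
      if p = q then tmap (U.proj ω p.1) (V.proj ω p.2) else 0 := by
  rw [tmap_mul, U.proj_mul_proj hω, V.proj_mul_proj hω]
  obtain ⟨m, n⟩ := p
  obtain ⟨m', n'⟩ := q
  by_cases h1 : m = m'
  · by_cases h2 : n = n'
    · simp [h1, h2]
    · simp [h2, tmap_zero_right]
  · simp [h1, tmap_zero_left]

theorem sum_tmap_proj {ω : ℂ} (hω : IsPrimitiveRoot ω N) (U : URep N H) (V : URep N K) :
    ∑ p : ZMod N × ZMod N, tmap (U.proj ω p.1) (V.proj ω p.2) = 1 := by
  rw [Fintype.sum_prod_type]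
  simp only [← tmap_sum_right, ← tmap_sum_left, URep.sum_proj hω, tmap_one]

theorem phase_mul_phase {ω : ℂ} (hω : IsPrimitiveRoot ω N) (U : URep N H) (V : URep N K)
    (a b : ZMod N × ZMod N → ZMod N) (hab : ∀ p, a p + b p = 0) :
    (∑ p : ZMod N × ZMod N, rootPow ω (a p) • tmap (U.proj ω p.1) (V.proj ω p.2)) *
      (∑ p : ZMod N × ZMod N, rootPow ω (b p) • tmap (U.proj ω p.1) (V.proj ω p.2)) = 1 := by
  rw [Finset.sum_mul, ← sum_tmap_proj hω U V]
  refine Finset.sum_congr rfl fun p _ => ?_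
  rw [Finset.mul_sum, Finset.sum_eq_single p]
  · rw [smul_mul_smul_comm, tmap_proj_mul hω, if_pos rfl, ← rootPow_add hω, hab, rootPow_zero,
      one_smul]
  · intro q _ hq
    rw [smul_mul_smul_comm, tmap_proj_mul hω, if_neg hq.symm, smul_zero]
  · simp

theorem adjoint_braid {ω : ℂ} (hω : IsPrimitiveRoot ω N) (U : URep N H) (V : URep N K) :
    (braid ω U V).adjoint = braidDual ω U V := by
  rw [braid, braidDual, ContinuousLinearMap.adjoint_comp, adjoint_tflip,
    ← ContinuousLinearMap.star_eq_adjoint, star_sum]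
  congr 1
  refine Finset.sum_congr rfl fun p _ => ?_
  rw [star_smul, star_tmap, U.star_proj hω, V.star_proj hω, star_rootPow hω]

theorem braidDual_comp_braid {ω : ℂ} (hω : IsPrimitiveRoot ω N) (U : URep N H) (V : URep N K) :
    braidDual ω U V ∘L braid ω U V = 1 := by
  rw [braid, braidDual, ContinuousLinearMap.comp_assoc, ← ContinuousLinearMap.comp_assoc
    (tflip K H), tflip_tflip]
  exact phase_mul_phase hω U V (fun p => -(p.1 * p.2)) (fun p => p.1 * p.2)
    fun p => neg_add_cancel _

theorem braid_comp_braidDual {ω : ℂ} (hω : IsPrimitiveRoot ω N) (U : URep N H) (V : URep N K) :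
    braid ω U V ∘L braidDual ω U V = 1 := by
  have h := phase_mul_phase hω U V (fun p => p.1 * p.2) (fun p => -(p.1 * p.2))
    fun p => add_neg_cancel _
  rw [braid, braidDual, ContinuousLinearMap.comp_assoc, ← ContinuousLinearMap.comp_assoc _ _
    (tflip K H)]
  rw [ContinuousLinearMap.mul_def] at h
  rw [h]
  exact tflip_tflip

end Braiding
end Anyonic
namespace Anyonic


/-! ### Braided tensor products -/

/-- A faithful `ℤ/N`-equivariant representation, on a Hilbert space `H`, of a `ℤ/N`-`C*`-algebra. -/
structure CovariantRep {N : ℕ} [NeZero N] {X : Type*} [CStarAlgebra X] (α : Coaction N X)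
    (H : Type*) [NormedAddCommGroup H] [InnerProductSpace ℂ H] [CompleteSpace H] where
  U : URep N H
  π : X →⋆ₐ[ℂ] (H →L[ℂ] H)
  injective : Function.Injective π
  equivariant : ∀ x t, π (α.ρ x t) = U.op t * π x * star (U.op t)

/-- A continuous `*`-endomorphism that preserves a set preserves the `C*`-algebra it generates. -/
theorem map_mem_closure_adjoin {B : Type*} [CStarAlgebra B] (f : B →⋆ₐ[ℂ] B) (hf : Continuous f)
    {G : Set B} (hG : ∀ x ∈ G, f x ∈ G) {T : B}
    (hT : T ∈ (StarAlgebra.adjoin ℂ G).topologicalClosure) :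
    f T ∈ (StarAlgebra.adjoin ℂ G).topologicalClosure := by
  have h : (StarAlgebra.adjoin ℂ G).topologicalClosure ≤
      ((StarAlgebra.adjoin ℂ G).topologicalClosure).comap f :=
    StarSubalgebra.topologicalClosure_minimal
      (StarAlgebra.adjoin_le fun x hx =>
        StarSubalgebra.le_topologicalClosure _ (StarAlgebra.subset_adjoin ℂ G (hG x hx)))
      ((StarSubalgebra.isClosed_topologicalClosure _).preimage hf)
  exact h hT

section Braided

variable {N : ℕ} [NeZero N] {ω : ℂ} {X Y : Type*} [CStarAlgebra X] [CStarAlgebra Y]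
  {α : Coaction N X} {β : Coaction N Y} {H K : Type*}
  [NormedAddCommGroup H] [InnerProductSpace ℂ H] [CompleteSpace H]
  [NormedAddCommGroup K] [InnerProductSpace ℂ K] [CompleteSpace K]

/-- The operator `j₁(x) = x ⊗ 1` on `H ⊗ K`. -/
noncomputable def opJ₁ (r : CovariantRep α H) (_s : CovariantRep β K) :
    X →⋆ₐ[ℂ] (HTensor H K →L[ℂ] HTensor H K) where
  toFun x := tmap (r.π x) 1
  map_one' := by rw [map_one, tmap_one]
  map_mul' x y := by rw [map_mul, tmap_mul, one_mul]
  map_zero' := by rw [map_zero, tmap_zero_left]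
  map_add' x y := by rw [map_add, tmap_add_left]
  commutes' c := by
    rw [Algebra.algebraMap_eq_smul_one, Algebra.algebraMap_eq_smul_one, map_smul, map_one,
      tmap_smul_left, tmap_one]
  map_star' x := by rw [map_star, star_tmap, star_one]

/-- The operator `j₂(y) = c' (y ⊗ 1) c` on `H ⊗ K`, where `c : H ⊗ K → K ⊗ H` is the braiding and
`c' : K ⊗ H → H ⊗ K` its dual. -/
noncomputable def opJ₂ (hω : IsPrimitiveRoot ω N) (r : CovariantRep α H) (s : CovariantRep β K) :
    Y →⋆ₐ[ℂ] (HTensor H K →L[ℂ] HTensor H K) where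
  toFun y := braidDual ω r.U s.U ∘L tmap (s.π y) 1 ∘L braid ω r.U s.U
  map_one' := by
    rw [map_one, tmap_one]
    exact braidDual_comp_braid hω r.U s.U
  map_mul' x y := by
    have h := braid_comp_braidDual hω r.U s.U
    rw [map_mul, ← one_mul (1 : H →L[ℂ] H), ← tmap_mul, one_mul, ContinuousLinearMap.mul_def,
      ContinuousLinearMap.mul_def]
    simp only [ContinuousLinearMap.comp_assoc]
    rw [← ContinuousLinearMap.comp_assoc (braid ω r.U s.U), h]
    rfl
  map_zero' := by
    rw [map_zero, tmap_zero_left, ContinuousLinearMap.zero_comp, ContinuousLinearMap.comp_zero]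
  map_add' x y := by
    rw [map_add, tmap_add_left, ContinuousLinearMap.add_comp, ContinuousLinearMap.comp_add]
  commutes' c := by
    rw [Algebra.algebraMap_eq_smul_one, Algebra.algebraMap_eq_smul_one, map_smul, map_one,
      tmap_smul_left, tmap_one, ContinuousLinearMap.smul_comp, ContinuousLinearMap.comp_smul]
    exact congrArg (c • ·) (braidDual_comp_braid hω r.U s.U)
  map_star' y := by
    have h1 := adjoint_braid hω r.U s.U
    have h2 : (braidDual ω r.U s.U).adjoint = braid ω r.U s.U := by
      rw [← h1, ContinuousLinearMap.adjoint_adjoint]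
    rw [ContinuousLinearMap.star_eq_adjoint, ContinuousLinearMap.adjoint_comp,
      ContinuousLinearMap.adjoint_comp, h1, h2, adjoint_tmap, map_star,
      ContinuousLinearMap.star_eq_adjoint, ← ContinuousLinearMap.star_eq_adjoint (1 : H →L[ℂ] H),
      star_one, ContinuousLinearMap.comp_assoc]

/-- The braided tensor product `X ⊠ Y`: the `C*`-algebra of operators on `H ⊗ K` generated by the
products `j₁(x) j₂(y)`. -/
noncomputable def braidedSubalgebra (hω : IsPrimitiveRoot ω N) (r : CovariantRep α H)
    (s : CovariantRep β K) : StarSubalgebra ℂ (HTensor H K →L[ℂ] HTensor H K) :=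
  (StarAlgebra.adjoin ℂ {T | ∃ x y, T = opJ₁ r s x * opJ₂ hω r s y}).topologicalClosure

/-- The braided tensor product as a type. -/
def Braided (hω : IsPrimitiveRoot ω N) (r : CovariantRep α H) (s : CovariantRep β K) : Type _ :=
  braidedSubalgebra hω r s

theorem isClosed_braided (hω : IsPrimitiveRoot ω N) (r : CovariantRep α H)
    (s : CovariantRep β K) :
    IsClosed (braidedSubalgebra hω r s : Set (HTensor H K →L[ℂ] HTensor H K)) :=
  StarSubalgebra.isClosed_topologicalClosure _

noncomputable instance instCStarAlgebraBraided (hω : IsPrimitiveRoot ω N) (r : CovariantRep α H)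
    (s : CovariantRep β K) : CStarAlgebra (Braided hω r s) :=
  StarSubalgebra.cstarAlgebra (braidedSubalgebra hω r s) (h_closed := isClosed_braided hω r s)

/-- The inclusion of the braided tensor product into the bounded operators. -/
noncomputable def braidedIncl (hω : IsPrimitiveRoot ω N) (r : CovariantRep α H)
    (s : CovariantRep β K) : Braided hω r s →⋆ₐ[ℂ] (HTensor H K →L[ℂ] HTensor H K) :=
  (braidedSubalgebra hω r s).subtype

theorem braidedIncl_injective (hω : IsPrimitiveRoot ω N) (r : CovariantRep α H)
    (s : CovariantRep β K) : Function.Injective (braidedIncl hω r s) :=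
  Subtype.val_injective

theorem opJ₁_mem (hω : IsPrimitiveRoot ω N) (r : CovariantRep α H) (s : CovariantRep β K)
    (x : X) : opJ₁ r s x ∈ braidedSubalgebra hω r s :=
  StarSubalgebra.le_topologicalClosure _
    (StarAlgebra.subset_adjoin ℂ _ ⟨x, 1, by rw [map_one, mul_one]⟩)

theorem opJ₂_mem (hω : IsPrimitiveRoot ω N) (r : CovariantRep α H) (s : CovariantRep β K)
    (y : Y) : opJ₂ hω r s y ∈ braidedSubalgebra hω r s :=
  StarSubalgebra.le_topologicalClosure _
    (StarAlgebra.subset_adjoin ℂ _ ⟨1, y, by rw [map_one, one_mul]⟩)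

/-- The embedding `j₁ : X → X ⊠ Y`. -/
noncomputable def j₁ (hω : IsPrimitiveRoot ω N) (r : CovariantRep α H) (s : CovariantRep β K) :
    X →⋆ₐ[ℂ] Braided hω r s :=
  (opJ₁ r s).codRestrict (braidedSubalgebra hω r s) (opJ₁_mem hω r s)

/-- The embedding `j₂ : Y → X ⊠ Y`. -/
noncomputable def j₂ (hω : IsPrimitiveRoot ω N) (r : CovariantRep α H) (s : CovariantRep β K) :
    Y →⋆ₐ[ℂ] Braided hω r s :=
  (opJ₂ hω r s).codRestrict (braidedSubalgebra hω r s) (opJ₂_mem hω r s)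

/-- The diagonal representation of `ℤ/N` on `H ⊗ K`. -/
noncomputable def URep.tensor (U : URep N H) (V : URep N K) : URep N (HTensor H K) where
  toFun g := ⟨tmap (U g : H →L[ℂ] H) (V g : K →L[ℂ] K), by
    rw [Unitary.mem_iff, star_tmap, tmap_mul, tmap_mul, Unitary.star_mul_self_of_mem (U g).2,
      Unitary.star_mul_self_of_mem (V g).2, Unitary.mul_star_self_of_mem (U g).2,
      Unitary.mul_star_self_of_mem (V g).2, tmap_one]
    exact ⟨rfl, rfl⟩⟩
  map_one' := Subtype.ext (by rw [map_one, map_one]; exact tmap_one)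
  map_mul' g h := Subtype.ext (by rw [map_mul, map_mul]; exact (tmap_mul _ _ _ _).symm)

theorem URep.op_tensor (U : URep N H) (V : URep N K) (t : ZMod N) :
    (U.tensor V).op t = tmap (U.op t) (V.op t) := rfl

theorem braid_comp_op (hω : IsPrimitiveRoot ω N) (U : URep N H) (V : URep N K) (t : ZMod N) :
    braid ω U V ∘L (U.tensor V).op t = (V.tensor U).op t ∘L braid ω U V := by
  rw [braid, URep.op_tensor, URep.op_tensor, ← ContinuousLinearMap.comp_assoc, ← tflip_comp_tmap,
    ContinuousLinearMap.comp_assoc, ContinuousLinearMap.comp_assoc]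
  refine congrArg (tflip H K ∘L ·) ?_
  rw [← ContinuousLinearMap.mul_def, ← ContinuousLinearMap.mul_def]
  rw [Finset.sum_mul, Finset.mul_sum]
  refine Finset.sum_congr rfl fun p _ => ?_
  rw [smul_mul_assoc, mul_smul_comm, tmap_mul, tmap_mul, U.proj_mul_op hω, V.proj_mul_op hω,
    U.op_mul_proj hω, V.op_mul_proj hω]

theorem braidDual_comp_op (hω : IsPrimitiveRoot ω N) (U : URep N H) (V : URep N K) (t : ZMod N) :
    braidDual ω U V ∘L (V.tensor U).op t = (U.tensor V).op t ∘L braidDual ω U V := by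
  have h := congrArg (fun T => braidDual ω U V ∘L T ∘L braidDual ω U V) (braid_comp_op hω U V t)
  simp only [ContinuousLinearMap.comp_assoc, braid_comp_braidDual hω] at h
  simp only [← ContinuousLinearMap.comp_assoc, braidDual_comp_braid hω] at h
  exact h.symm

/-- Conjugation by the diagonal representation. -/
noncomputable def conjOp (U : URep N H) (t : ZMod N) : (H →L[ℂ] H) →⋆ₐ[ℂ] (H →L[ℂ] H) :=
  let e := Unitary.conjStarAlgAut ℂ (H →L[ℂ] H) (U (Multiplicative.ofAdd t))
  { toFun := e
    map_one' := map_one e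
    map_mul' := map_mul e
    map_zero' := map_zero e
    map_add' := map_add e
    commutes' := AlgHomClass.commutes e
    map_star' := map_star e }

theorem conjOp_apply (U : URep N H) (t : ZMod N) (T : H →L[ℂ] H) :
    conjOp U t T = U.op t * T * star (U.op t) := rfl

theorem opJ₁_apply (r : CovariantRep α H) (s : CovariantRep β K) (x : X) :
    opJ₁ r s x = tmap (r.π x) 1 := rfl

theorem opJ₂_apply (hω : IsPrimitiveRoot ω N) (r : CovariantRep α H) (s : CovariantRep β K)
    (y : Y) :
    opJ₂ hω r s y = braidDual ω r.U s.U ∘L tmap (s.π y) 1 ∘L braid ω r.U s.U := rfl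

theorem conjOp_opJ₁ (r : CovariantRep α H) (s : CovariantRep β K) (t : ZMod N) (x : X) :
    conjOp (r.U.tensor s.U) t (opJ₁ r s x) = opJ₁ r s (α.ρ x t) := by
  have h : s.U.op t * star (s.U.op t) = 1 :=
    Unitary.coe_mul_star_self (s.U (Multiplicative.ofAdd t))
  rw [conjOp_apply, opJ₁_apply, opJ₁_apply, URep.op_tensor, star_tmap, r.equivariant, tmap_mul,
    tmap_mul, mul_one, h]

theorem conjOp_opJ₂ (hω : IsPrimitiveRoot ω N) (r : CovariantRep α H) (s : CovariantRep β K)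
    (t : ZMod N) (y : Y) :
    conjOp (r.U.tensor s.U) t (opJ₂ hω r s y) = opJ₂ hω r s (β.ρ y t) := by
  have h : r.U.op t * star (r.U.op t) = 1 :=
    Unitary.coe_mul_star_self (r.U (Multiplicative.ofAdd t))
  have h3 : tmap (s.π (β.ρ y t)) 1 =
      (s.U.tensor r.U).op t * tmap (s.π y) 1 * (s.U.tensor r.U).op (-t) := by
    rw [← URep.star_op, URep.op_tensor, star_tmap, s.equivariant, tmap_mul, tmap_mul, mul_one, h]
  have e1 := braidDual_comp_op hω r.U s.U t
  have e2 := braid_comp_op hω r.U s.U (-t)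
  rw [conjOp_apply, URep.star_op, opJ₂_apply, opJ₂_apply, h3, ContinuousLinearMap.mul_def,
    ContinuousLinearMap.mul_def, ContinuousLinearMap.mul_def, ContinuousLinearMap.mul_def]
  simp only [ContinuousLinearMap.comp_assoc]
  rw [e2, ← ContinuousLinearMap.comp_assoc _ (braidDual ω r.U s.U), ← e1,
    ContinuousLinearMap.comp_assoc]

theorem continuous_conjOp (U : URep N H) (t : ZMod N) : Continuous (conjOp U t) := by
  have : ⇑(conjOp U t) = fun T => U.op t * T * star (U.op t) := funext (conjOp_apply U t)
  rw [this]
  exact (continuous_const.mul continuous_id).mul continuous_const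

theorem conjOp_mem (hω : IsPrimitiveRoot ω N) (r : CovariantRep α H) (s : CovariantRep β K)
    (t : ZMod N) {T : HTensor H K →L[ℂ] HTensor H K} (hT : T ∈ braidedSubalgebra hω r s) :
    conjOp (r.U.tensor s.U) t T ∈ braidedSubalgebra hω r s := by
  refine map_mem_closure_adjoin (conjOp (r.U.tensor s.U) t) (continuous_conjOp _ _) ?_ hT
  rintro _ ⟨x, y, rfl⟩
  rw [map_mul, conjOp_opJ₁, conjOp_opJ₂]
  exact ⟨_, _, rfl⟩

/-- The automorphism of the braided tensor product by which `t` acts. -/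
noncomputable def braidedAct (hω : IsPrimitiveRoot ω N) (r : CovariantRep α H)
    (s : CovariantRep β K) (t : ZMod N) : Braided hω r s →⋆ₐ[ℂ] Braided hω r s :=
  ((conjOp (r.U.tensor s.U) t).comp (braidedIncl hω r s)).codRestrict (braidedSubalgebra hω r s)
    fun T => conjOp_mem hω r s t T.2

theorem braidedIncl_act (hω : IsPrimitiveRoot ω N) (r : CovariantRep α H)
    (s : CovariantRep β K) (t : ZMod N) (T : Braided hω r s) :
    braidedIncl hω r s (braidedAct hω r s t T) =
      (r.U.tensor s.U).op t * braidedIncl hω r s T * star ((r.U.tensor s.U).op t) :=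
  conjOp_apply _ t _

/-- The coaction on the braided tensor product. -/
noncomputable def braidedCoaction (hω : IsPrimitiveRoot ω N) (r : CovariantRep α H)
    (s : CovariantRep β K) : Coaction N (Braided hω r s) :=
  Coaction.ofAction (braidedAct hω r s)
    (fun T => braidedIncl_injective hω r s (by
      rw [braidedIncl_act, URep.op_zero, star_one, one_mul, mul_one]))
    (fun T t u => braidedIncl_injective hω r s (by
      rw [braidedIncl_act, braidedIncl_act, braidedIncl_act, URep.op_add, star_mul]
      simp only [mul_assoc]))

/-- `j₁` is equivariant. -/
theorem j₁_equivariant (hω : IsPrimitiveRoot ω N) (r : CovariantRep α H) (s : CovariantRep β K) :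
    IsEquivariant α (braidedCoaction hω r s) (j₁ hω r s) :=
  fun x t => braidedIncl_injective hω r s (conjOp_opJ₁ r s t x)

/-- `j₂` is equivariant. -/
theorem j₂_equivariant (hω : IsPrimitiveRoot ω N) (r : CovariantRep α H) (s : CovariantRep β K) :
    IsEquivariant β (braidedCoaction hω r s) (j₂ hω r s) :=
  fun y t => braidedIncl_injective hω r s (conjOp_opJ₂ hω r s t y)

/-- The braided tensor product is faithfully and equivariantly represented on `H ⊗ K`; this is used
to form iterated braided tensor products. -/
noncomputable def CovariantRep.braided (hω : IsPrimitiveRoot ω N) (r : CovariantRep α H)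
    (s : CovariantRep β K) : CovariantRep (braidedCoaction hω r s) (HTensor H K) where
  U := r.U.tensor s.U
  π := braidedIncl hω r s
  injective := braidedIncl_injective hω r s
  equivariant T t := braidedIncl_act hω r s t T

end Braided

/-! ### Anyonic compact quantum groups -/

/-- `F : X₁ ⊠ X₂ → Y₁ ⊠ Y₂` is the braided tensor product of the `*`-homomorphisms `f : X₁ → Y₁` and
`g : X₂ → Y₂`. -/
def IsBraidedMap {N : ℕ} [NeZero N] {ω : ℂ} (hω : IsPrimitiveRoot ω N)
    {X₁ X₂ Y₁ Y₂ : Type*} [CStarAlgebra X₁] [CStarAlgebra X₂] [CStarAlgebra Y₁] [CStarAlgebra Y₂]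
    {α₁ : Coaction N X₁} {α₂ : Coaction N X₂} {β₁ : Coaction N Y₁} {β₂ : Coaction N Y₂}
    {H₁ H₂ K₁ K₂ : Type*}
    [NormedAddCommGroup H₁] [InnerProductSpace ℂ H₁] [CompleteSpace H₁]
    [NormedAddCommGroup H₂] [InnerProductSpace ℂ H₂] [CompleteSpace H₂]
    [NormedAddCommGroup K₁] [InnerProductSpace ℂ K₁] [CompleteSpace K₁]
    [NormedAddCommGroup K₂] [InnerProductSpace ℂ K₂] [CompleteSpace K₂]
    (r₁ : CovariantRep α₁ H₁) (r₂ : CovariantRep α₂ H₂)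
    (s₁ : CovariantRep β₁ K₁) (s₂ : CovariantRep β₂ K₂)
    (f : X₁ →⋆ₐ[ℂ] Y₁) (g : X₂ →⋆ₐ[ℂ] Y₂)
    (F : Braided hω r₁ r₂ →⋆ₐ[ℂ] Braided hω s₁ s₂) : Prop :=
  IsEquivariant (braidedCoaction hω r₁ r₂) (braidedCoaction hω s₁ s₂) F ∧
    ∀ x₁ x₂, F (j₁ hω r₁ r₂ x₁ * j₂ hω r₁ r₂ x₂) = j₁ hω s₁ s₂ (f x₁) * j₂ hω s₁ s₂ (g x₂)

section QuantumGroup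

variable {N : ℕ} [NeZero N] {ω : ℂ} (hω : IsPrimitiveRoot ω N) {A : Type*} [CStarAlgebra A]
  {α : Coaction N A} {L : Type*} [NormedAddCommGroup L] [InnerProductSpace ℂ L] [CompleteSpace L]
  (r : CovariantRep α L)

/-- `a : (A ⊠ A) ⊠ A → A ⊠ (A ⊠ A)` is the canonical isomorphism, which respects the three embeddings
of `A`. -/
def IsAssociator
    (a : Braided hω (r.braided hω r) r ≃⋆ₐ[ℂ] Braided hω r (r.braided hω r)) : Prop :=
  (∀ x, a (j₁ hω (r.braided hω r) r (j₁ hω r r x)) = j₁ hω r (r.braided hω r) x) ∧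
  (∀ x, a (j₁ hω (r.braided hω r) r (j₂ hω r r x)) = j₂ hω r (r.braided hω r) (j₁ hω r r x)) ∧
  (∀ x, a (j₂ hω (r.braided hω r) r x) = j₂ hω r (r.braided hω r) (j₂ hω r r x))

/-- Coassociativity: `(Δ ⊠ id) ∘ Δ = (id ⊠ Δ) ∘ Δ` up to the canonical identification of
`(A ⊠ A) ⊠ A` with `A ⊠ (A ⊠ A)`. The maps `Δ ⊠ id`, `id ⊠ Δ` and the identification are uniquely
determined by the conditions. -/
def IsCoassociative (Δ : A →⋆ₐ[ℂ] Braided hω r r) : Prop :=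
  ∃ (ΔI : Braided hω r r →⋆ₐ[ℂ] Braided hω (r.braided hω r) r)
    (IΔ : Braided hω r r →⋆ₐ[ℂ] Braided hω r (r.braided hω r))
    (a : Braided hω (r.braided hω r) r ≃⋆ₐ[ℂ] Braided hω r (r.braided hω r)),
    IsBraidedMap hω r r (r.braided hω r) r Δ (StarAlgHom.id ℂ A) ΔI ∧
    IsBraidedMap hω r r r (r.braided hω r) (StarAlgHom.id ℂ A) Δ IΔ ∧
    IsAssociator hω r a ∧
    ∀ x, a (ΔI (Δ x)) = IΔ (Δ x)

/-- `(A, α, Δ)` is an anyonic compact quantum group, where `A ⊠ A` is formed through the faithful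
equivariant representation `r`. -/
structure IsAnyonicCompactQuantumGroup (Δ : A →⋆ₐ[ℂ] Braided hω r r) : Prop where
  equivariant : IsEquivariant α (braidedCoaction hω r r) Δ
  coassociative : IsCoassociative hω r Δ
  simplifiable_right :
    (Submodule.span ℂ {T | ∃ x y, T = Δ x * j₂ hω r r y}).topologicalClosure = ⊤
  simplifiable_left :
    (Submodule.span ℂ {T | ∃ x y, T = Δ x * j₁ hω r r y}).topologicalClosure = ⊤

end QuantumGroup
end Anyonic

/-!
A faithful equivariant representation is obtained from a faithful representation `π₀` of the
underlying `C*`-algebra (a direct sum of GNS representations) by letting `x` act on `ℓ²(ℤ/N, H)` as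
`π₀ (ρ_s x)` at the point `s`, with `ℤ/N` acting by translations.

Conjugating `X ⊠ Y` by the braiding without its flip turns `j₂ y` into `1 ⊗ π y` and `j₁ x` into
`∑ b, π (ρ_b x) ⊗ P_b`, where `P_b` is the spectral projection of degree `b`. Norms in `X ⊠ Y` are
therefore norms in a minimal tensor product, which do not depend on the faithful representation of
`X`; this makes `⊠` functorial in `X`, and conjugation by the flip does the same for `Y`. The
associator of Hilbert space tensor products intertwines the two triples of embeddings into the
iterated braided tensor products.

The two embeddings satisfy `j₂ y * j₁ x = j₁ (ρ_{-n} x) * j₂ y` for `y` of degree `n`. Hence the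
entries of `j₁ q` and `j₂ q` commute up to powers of `ω`, and the product of these two matrices
satisfies the defining relations again; this is the comultiplication. Unitarity of `q` recovers
`j₁ q` from `Δ q` and `j₂ q`, and similarly `j₂ q` from `Δ q` and `j₁ q`; by the commutation
relation the closed linear spans in question absorb all products of generators.
-/

namespace Anyonic

open scoped CStarAlgebra

/-! ### Generators -/

namespace FreeStarAlgebra

variable {X B C : Type*} [Ring B] [StarRing B] [Algebra ℂ B] [Ring C] [StarRing C] [Algebra ℂ C]

theorem adjoin_range_gen : StarAlgebra.adjoin ℂ (Set.range (gen : X → FreeStarAlgebra X)) = ⊤ := by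
  refine eq_top_iff.2 fun p _ => ?_
  induction p using induction with
  | h1 c => exact algebraMap_mem _ c
  | h2 a =>
    obtain ⟨x, e⟩ := a
    have hx : gen x ∈ StarAlgebra.adjoin ℂ (Set.range (gen : X → FreeStarAlgebra X)) :=
      StarAlgebra.subset_adjoin ℂ _ ⟨x, rfl⟩
    cases e
    · exact hx
    · rw [← star_gen]
      exact star_mem hx
  | h3 p q hp hq => exact mul_mem (hp trivial) (hq trivial)
  | h4 p q hp hq => exact add_mem (hp trivial) (hq trivial)

theorem hom_ext {f g : FreeStarAlgebra X →⋆ₐ[ℂ] B} (h : ∀ x, f (gen x) = g (gen x)) : f = g :=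
  StarAlgHom.ext_of_adjoin_eq_top adjoin_range_gen <| by rintro _ ⟨x, rfl⟩; exact h x

variable [StarModule ℂ B] [StarModule ℂ C]

theorem map_eval (f : B →⋆ₐ[ℂ] C) (b : X → B) (p : FreeStarAlgebra X) :
    f (eval b p) = eval (fun x => f (b x)) p := by
  have h : f.comp (eval b) = eval fun x => f (b x) :=
    hom_ext fun x => by rw [StarAlgHom.comp_apply, eval_gen, eval_gen]
  exact congr($h p)

theorem range_eval (b : X → B) : (eval b).range = StarAlgebra.adjoin ℂ (Set.range b) := by
  have h : eval b '' Set.range gen = Set.range b := by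
    rw [← Set.range_comp]
    exact congrArg Set.range (funext (eval_gen b))
  rw [← h, ← StarAlgHom.map_adjoin, adjoin_range_gen, StarAlgHom.range_eq_map_top]

end FreeStarAlgebra

section Generated

variable {X Y : Type*} [CStarAlgebra X] [CStarAlgebra Y]

/-- The `C*`-subalgebra generated by a set. -/
noncomputable def generated (S : Set X) : StarSubalgebra ℂ X :=
  (StarAlgebra.adjoin ℂ S).topologicalClosure

theorem isClosed_generated (S : Set X) : IsClosed (generated S : Set X) :=
  StarSubalgebra.isClosed_topologicalClosure _

theorem subset_generated (S : Set X) : S ⊆ generated S :=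
  (StarAlgebra.subset_adjoin ℂ S).trans (StarSubalgebra.le_topologicalClosure _)

theorem generated_le {S : Set X} {M : StarSubalgebra ℂ X} (hS : S ⊆ M)
    (hM : IsClosed (M : Set X)) : generated S ≤ M :=
  StarSubalgebra.topologicalClosure_minimal (StarAlgebra.adjoin_le hS) hM

theorem starAlgHom_ext_of_generated {S : Set X} (hS : generated S = ⊤) {f g : X →⋆ₐ[ℂ] Y}
    (h : ∀ x ∈ S, f x = g x) : f = g := by
  have hle : generated S ≤ StarAlgHom.equalizer f g :=
    generated_le h (isClosed_eq (map_continuous f) (map_continuous g))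
  rw [hS] at hle
  exact StarAlgHom.ext fun x => hle trivial

theorem denseRange_eval_iff {ι : Type*} {g : ι → X} :
    DenseRange (FreeStarAlgebra.eval g) ↔ generated (Set.range g) = ⊤ := by
  rw [DenseRange, dense_iff_closure_eq, generated, ← FreeStarAlgebra.range_eval]
  exact SetLike.coe_set_eq (p := (FreeStarAlgebra.eval g).range.topologicalClosure) (q := ⊤)

theorem exists_starAlgHom_of_norm_le {A : Type*} [Ring A] [StarRing A] [Algebra ℂ A]
    {f : A →⋆ₐ[ℂ] X} {g : A →⋆ₐ[ℂ] Y} (hf : DenseRange f) (hgf : ∀ a, ‖g a‖ ≤ ‖f a‖) :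
    ∃ F : X →⋆ₐ[ℂ] Y, ∀ a, F (f a) = g a := by
  let F : X →L[ℂ] Y := g.toAlgHom.toLinearMap.extendOfNorm f.toAlgHom.toLinearMap
  have hF : ∀ a, F (f a) = g a :=
    LinearMap.extendOfNorm_eq hf ⟨1, fun a => (hgf a).trans_eq (one_mul _).symm⟩
  have F_mul : ∀ x y, F (x * y) = F x * F y := fun x y =>
    hf.induction_on₂ (p := fun x y => F (x * y) = F x * F y)
      (isClosed_eq (by fun_prop) (by fun_prop))
      (fun a b => by rw [← map_mul, hF, hF, hF, map_mul]) x y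
  have F_star : ∀ x, F (star x) = star (F x) := fun x =>
    hf.induction_on (p := fun x => F (star x) = star (F x)) x
      (isClosed_eq (by fun_prop) (by fun_prop))
      fun a => by rw [← map_star, hF, hF, map_star]
  have F_one : F 1 = 1 := by rw [← map_one f, hF, map_one]
  exact ⟨{ AlgHom.ofLinearMap F.toLinearMap F_one F_mul with map_star' := F_star }, hF⟩

theorem exists_starAlgHom_of_generators {ι : Type*} {g : ι → X} {g' : ι → Y}
    (hg : generated (Set.range g) = ⊤)
    (h : ∀ p, ‖FreeStarAlgebra.eval g' p‖ ≤ ‖FreeStarAlgebra.eval g p‖) :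
    ∃ F : X →⋆ₐ[ℂ] Y, ∀ i, F (g i) = g' i := by
  obtain ⟨F, hF⟩ := exists_starAlgHom_of_norm_le (denseRange_eval_iff.2 hg) h
  exact ⟨F, fun i => by simpa only [FreeStarAlgebra.eval_gen] using hF (FreeStarAlgebra.gen i)⟩

end Generated

/-! ### Coactions -/

section Coaction

variable {N : ℕ} [NeZero N] {X Y : Type*} [CStarAlgebra X] [CStarAlgebra Y]

/-- The endomorphism `ρ_t` of a `ℤ/N`-`C*`-algebra. -/
noncomputable def Coaction.act (α : Coaction N X) (t : ZMod N) : X →⋆ₐ[ℂ] X :=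
  (Pi.evalStarAlgHom ℂ (fun _ => X) t).comp α.ρ

theorem Coaction.act_apply (α : Coaction N X) (t : ZMod N) (x : X) : α.act t x = α.ρ x t := rfl

/-- The Podleś condition makes the idempotent endomorphism `ρ_0` surjective. -/
theorem Coaction.ρ_zero (α : Coaction N X) (x : X) : α.ρ x 0 = x := by
  let ev : (ZMod N → X) →ₗ[ℂ] X := LinearMap.proj 0
  have hle : (⊤ : Submodule ℂ (ZMod N → X)) ≤
      ((α.act 0).toAlgHom.toLinearMap ∘ₗ ev).eqLocus ev := by
    rw [← α.podles]
    refine Submodule.topologicalClosure_minimal _ (Submodule.span_le.2 ?_)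
      (isClosed_eq ((map_continuous (α.act 0)).comp (continuous_apply 0)) (continuous_apply 0))
    rintro _ ⟨x, f, rfl⟩
    change α.act 0 (f 0 • α.ρ x 0) = f 0 • α.ρ x 0
    rw [map_smul, α.act_apply, α.coassoc, zero_add]
  exact hle (x := fun _ => x) trivial

theorem isEquivariant_of_generated {α : Coaction N X} {β : Coaction N Y} {S : Set X}
    (hS : generated S = ⊤) {f : X →⋆ₐ[ℂ] Y} (h : ∀ x ∈ S, ∀ t, β.ρ (f x) t = f (α.ρ x t)) :
    IsEquivariant α β f := fun x t => by
  have heq : (β.act t).comp f = f.comp (α.act t) :=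
    starAlgHom_ext_of_generated hS fun x hx => h x hx t
  exact congr($heq x)

end Coaction

/-! ### Faithful representations -/

universe u

section GelfandNaimark

open scoped ComplexOrder ComplexStarModule

variable {B : Type*} [CStarAlgebra B]

/-- A real functional `f` that is nonnegative on the positive cone is made complex linear by
complexifying `b ↦ f (ℜ b)`. -/
theorem exists_positiveLinearMap_star_mul_self_ne_zero [PartialOrder B] [StarOrderedRing B] {a : B}
    (ha : a ≠ 0) : ∃ φ : B →ₚ[ℂ] ℂ, φ (star a * a) ≠ 0 := by
  have hneg : -(star a * a) ∉ ProperCone.positive ℝ B := fun h =>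
    ha ((CStarRing.star_mul_self_eq_zero_iff a).1
      (le_antisymm (neg_nonneg.1 h) (star_mul_self_nonneg a)))
  obtain ⟨f, hf, hfa⟩ := ProperCone.hyperplane_separation_point _ hneg
  let φ : B →ₗ[ℂ] ℂ := Module.Dual.extendRCLike (𝕜 := ℂ)
    (f.toLinearMap ∘ₗ (selfAdjoint.submodule ℝ B).subtype ∘ₗ realPart)
  have hφ : ∀ b, IsSelfAdjoint b → φ b = f b := fun b hb => by
    change ((f (ℜ b : B) : ℝ) : ℂ) - Complex.I * ((f (ℜ (Complex.I • b) : B) : ℝ) : ℂ) = f b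
    simp [realPart_I_smul, hb.coe_realPart, hb.imaginaryPart]
  refine ⟨.mk₀ φ fun b hb => ?_, ?_⟩
  · rw [hφ b (.of_nonneg hb)]
    exact_mod_cast hf b hb
  · change φ _ ≠ 0
    rw [hφ _ (.star_mul_self a)]
    rw [map_neg] at hfa
    exact_mod_cast (neg_neg_iff_pos.1 hfa).ne'

section DirectSum

variable {ι : Type*} {E : ι → Type*} [∀ i, NormedAddCommGroup (E i)]
  [∀ i, InnerProductSpace ℂ (E i)] [∀ i, CompleteSpace (E i)]

/-- The direct sum of a family of representations. -/
noncomputable def directSumRep (π : ∀ i, B →⋆ₐ[ℂ] (E i →L[ℂ] E i)) :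
    B →⋆ₐ[ℂ] (lp E 2 →L[ℂ] lp E 2) where
  toFun b := lp.mapCLM 2 (fun i => π i b) (norm_nonneg b) fun i =>
    NonUnitalStarAlgHom.norm_apply_le (π i) b
  map_one' := by ext ξ i; simp
  map_mul' x y := by ext ξ i; simp
  map_zero' := by ext ξ i; simp
  map_add' x y := by ext ξ i; simp
  commutes' c := by ext ξ i; simp [Algebra.algebraMap_eq_smul_one]
  map_star' x := by
    rw [ContinuousLinearMap.star_eq_adjoint, ContinuousLinearMap.eq_adjoint_iff]
    intro ξ η
    rw [lp.inner_eq_tsum, lp.inner_eq_tsum]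
    refine tsum_congr fun i => ?_
    change inner ℂ (π i (star x) (ξ i)) (η i) = inner ℂ (ξ i) (π i x (η i))
    rw [map_star, ContinuousLinearMap.star_eq_adjoint, ContinuousLinearMap.adjoint_inner_left]

theorem directSumRep_apply (π : ∀ i, B →⋆ₐ[ℂ] (E i →L[ℂ] E i)) (b : B) (ξ : lp E 2) (i : ι) :
    directSumRep π b ξ i = π i b (ξ i) := rfl

theorem directSumRep_injective {π : ∀ i, B →⋆ₐ[ℂ] (E i →L[ℂ] E i)}
    (h : ∀ b ≠ 0, ∃ i, π i b ≠ 0) : Function.Injective (directSumRep π) := by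
  classical
  refine (injective_iff_map_eq_zero _).2 fun b hb => of_not_not fun hb0 => ?_
  obtain ⟨i, hi⟩ := h b hb0
  refine hi (ContinuousLinearMap.ext fun v => ?_)
  simpa [directSumRep_apply] using congr($hb (lp.single 2 i v) i)

end DirectSum

theorem gnsStarAlgHom_apply_ne_zero [PartialOrder B] [StarOrderedRing B] (φ : B →ₚ[ℂ] ℂ) {a : B}
    (ha : φ (star a * a) ≠ 0) : φ.gnsStarAlgHom a ≠ 0 := by
  intro h
  have hcyc : φ.gnsStarAlgHom a (φ.toPreGNS 1 : φ.PreGNS) = (φ.toPreGNS a : φ.PreGNS) :=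
    φ.gnsNonUnitalStarAlgHom_apply_coe.trans (by simp)
  have hnorm := φ.preGNS_norm_sq (φ.toPreGNS a)
  rw [← UniformSpace.Completion.norm_coe, ← hcyc, h] at hnorm
  exact ha (by simpa using hnorm.symm)

theorem exists_injective_rep (B : Type u) [CStarAlgebra B] :
    ∃ (H : Type u) (_ : NormedAddCommGroup H) (_ : InnerProductSpace ℂ H) (_ : CompleteSpace H)
      (π : B →⋆ₐ[ℂ] (H →L[ℂ] H)), Function.Injective π := by
  let := CStarAlgebra.spectralOrder B
  have := CStarAlgebra.spectralOrderedRing B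
  choose φ hφ using fun a : {a : B // a ≠ 0} => exists_positiveLinearMap_star_mul_self_ne_zero a.2
  exact ⟨lp (fun a => (φ a).GNS) 2, inferInstance, inferInstance, inferInstance,
    directSumRep fun a => (φ a).gnsStarAlgHom,
    directSumRep_injective fun b hb => ⟨⟨b, hb⟩, gnsStarAlgHom_apply_ne_zero _ (hφ ⟨b, hb⟩)⟩⟩

end GelfandNaimark

section RegularRep

variable {N : ℕ} [NeZero N]

/-- The translation `ξ ↦ ξ (· + t)` on `ℓ²(ℤ/N, H)`. -/
noncomputable def translation (H : Type*) [NormedAddCommGroup H] [InnerProductSpace ℂ H]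
    (t : ZMod N) : lp (fun _ : ZMod N => H) 2 ≃ₗᵢ[ℂ] lp (fun _ : ZMod N => H) 2 :=
  (lpPiLpₗᵢ (fun _ : ZMod N => H) ℂ).trans
    ((LinearIsometryEquiv.piLpCongrLeft 2 ℂ H (Equiv.subRight t)).trans
      (lpPiLpₗᵢ (fun _ : ZMod N => H) ℂ).symm)

theorem translation_apply {H : Type*} [NormedAddCommGroup H] [InnerProductSpace ℂ H]
    (t : ZMod N) (ξ : lp (fun _ : ZMod N => H) 2) (s : ZMod N) :
    translation H t ξ s = ξ (s + t) := rfl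

/-- The regular representation of `ℤ/N` on `ℓ²(ℤ/N, H)`. -/
noncomputable def regularURep (N : ℕ) [NeZero N] (H : Type*) [NormedAddCommGroup H]
    [InnerProductSpace ℂ H] [CompleteSpace H] : URep N (lp (fun _ : ZMod N => H) 2) where
  toFun g := Unitary.linearIsometryEquiv.symm (translation H g.toAdd)
  map_one' := by
    ext ξ s
    simp [translation_apply]
  map_mul' g h := by
    ext ξ s
    simp [translation_apply, add_left_comm, add_comm]

theorem regularURep_op_apply {H : Type*} [NormedAddCommGroup H] [InnerProductSpace ℂ H]
    [CompleteSpace H] (t : ZMod N) (ξ : lp (fun _ : ZMod N => H) 2) (s : ZMod N) :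
    (regularURep N H).op t ξ s = ξ (s + t) := rfl

theorem exists_covariantRep {X : Type u} [CStarAlgebra X] (α : Coaction N X) :
    ∃ (L : Type u) (_ : NormedAddCommGroup L) (_ : InnerProductSpace ℂ L) (_ : CompleteSpace L),
      Nonempty (CovariantRep α L) := by
  obtain ⟨H, _, _, _, π, hπ⟩ := exists_injective_rep X
  refine ⟨lp (fun _ : ZMod N => H) 2, inferInstance, inferInstance, inferInstance,
    ⟨{ U := regularURep N H
       π := directSumRep fun s => π.comp (α.act s)
       injective := directSumRep_injective fun x hx => ⟨0, ?_⟩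
       equivariant := fun x t => ?_ }⟩⟩
  · rw [StarAlgHom.comp_apply, α.act_apply, α.ρ_zero]
    exact (map_ne_zero_iff π hπ).2 hx
  · ext ξ s
    simp [URep.star_op, regularURep_op_apply, directSumRep_apply, Coaction.act_apply, α.coassoc]

end RegularRep

/-! ### Amplification -/

section NormComparison

variable {A X Y : Type*} [Ring A] [StarRing A] [Algebra ℂ A]
  [CStarAlgebra X] [CStarAlgebra Y]

/-- The first projection is injective, hence isometric, on the `C*`-algebra closure of the range of
`(f, g)`. -/
theorem norm_apply_le_of_separating {κ V V' : Type*} [NormedAddCommGroup V]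
    [NormedAddCommGroup V'] {f : A →⋆ₐ[ℂ] X} {g : A →⋆ₐ[ℂ] Y} {E : κ → X → V} {E' : κ → Y → V'}
    (hE : ∀ k, Continuous (E k)) (hE' : ∀ k, Continuous (E' k)) (hE₀ : ∀ k, E k 0 = 0)
    (hsep : ∀ y, (∀ k, E' k y = 0) → y = 0) (hle : ∀ k a, ‖E' k (g a)‖ ≤ ‖E k (f a)‖) (a : A) :
    ‖g a‖ ≤ ‖f a‖ := by
  let D := (f.prod g).range.topologicalClosure
  have : IsClosed (D : Set (X × Y)) := StarSubalgebra.isClosed_topologicalClosure _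
  let _ : CStarAlgebra D := StarSubalgebra.cstarAlgebra D
  have hD : ∀ d ∈ D, ∀ k, ‖E' k d.2‖ ≤ ‖E k d.1‖ := fun d hd k =>
    le_on_closure (s := Set.range (f.prod g)) (f := fun d => ‖E' k d.2‖)
      (g := fun d => ‖E k d.1‖) (by rintro _ ⟨a, rfl⟩; exact hle k a)
      ((hE' k).comp continuous_snd).norm.continuousOn
      ((hE k).comp continuous_fst).norm.continuousOn hd
  let p : D →⋆ₐ[ℂ] X := (StarAlgHom.fst ℂ X Y).comp D.subtype
  have hp : Function.Injective p := (injective_iff_map_eq_zero p).2 fun d hd =>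
    Subtype.ext (Prod.ext hd (hsep _ fun k => norm_le_zero_iff.1 ((hD d d.2 k).trans
      (by rw [show (d : X × Y).1 = 0 from hd, hE₀, norm_zero]))))
  let d : D := ⟨f.prod g a, StarSubalgebra.le_topologicalClosure _ ⟨a, rfl⟩⟩
  calc ‖g a‖ ≤ ‖d‖ := norm_snd_le (f.prod g a)
    _ = ‖f a‖ := (NonUnitalStarAlgHom.norm_map p hp d).symm

end NormComparison

section HTensor

open scoped TensorProduct

variable {H K : Type*} [NormedAddCommGroup H] [InnerProductSpace ℂ H] [CompleteSpace H]
  [NormedAddCommGroup K] [InnerProductSpace ℂ K] [CompleteSpace K]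

/-- The operator `x ↦ x ⊗ k`. -/
noncomputable def htmulRight (H : Type*) [NormedAddCommGroup H] [InnerProductSpace ℂ H]
    [CompleteSpace H] (k : K) :
    H →L[ℂ] HTensor H K :=
  LinearMap.mkContinuous
    { toFun := fun x => htmul x k
      map_add' := fun x y => htmul_add_left x y k
      map_smul' := fun c x => htmul_smul_left c x k } ‖k‖
    fun x => by
      change ‖hcoe H K (x ⊗ₜ k)‖ ≤ ‖k‖ * ‖x‖
      rw [LinearIsometry.norm_map, TensorProduct.norm_tmul, mul_comm]

theorem htmulRight_apply (x : H) (k : K) : htmulRight H k x = htmul x k := rfl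

/-- The slice of an operator on `H ⊗ K` by the vector functional of `k` and `k'` on `B(K)`. -/
noncomputable def slice (k k' : K) (T : HTensor H K →L[ℂ] HTensor H K) : H →L[ℂ] H :=
  (htmulRight H k).adjoint ∘L T ∘L htmulRight H k'

theorem inner_slice_apply (k k' : K) (T : HTensor H K →L[ℂ] HTensor H K) (x x' : H) :
    inner ℂ x (slice k k' T x') = inner ℂ (htmul x k) (T (htmul x' k')) := by
  simp only [slice, ContinuousLinearMap.comp_apply, ContinuousLinearMap.adjoint_inner_right,
    htmulRight_apply]

theorem continuous_slice (k k' : K) : Continuous (slice (H := H) k k') := by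
  unfold slice
  fun_prop

theorem slice_zero (k k' : K) : slice (H := H) k k' 0 = 0 := by
  rw [slice, ContinuousLinearMap.zero_comp, ContinuousLinearMap.comp_zero]

theorem slice_add (k k' : K) (S T : HTensor H K →L[ℂ] HTensor H K) :
    slice k k' (S + T) = slice k k' S + slice k k' T := by
  rw [slice, ContinuousLinearMap.add_comp, ContinuousLinearMap.comp_add]
  rfl

theorem eq_zero_of_slice_eq_zero {T : HTensor H K →L[ℂ] HTensor H K}
    (h : ∀ k k', slice k k' T = 0) : T = 0 :=
  htensor_ext fun x' k' => inner_ext_htensor fun x k => by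
    rw [← inner_slice_apply, h]
    simp

theorem slice_tmap (k k' : K) (T : H →L[ℂ] H) (R : K →L[ℂ] K) :
    slice k k' (tmap T R) = inner ℂ k (R k') • T :=
  ContinuousLinearMap.ext fun x' => ext_inner_left ℂ fun x => by
    rw [inner_slice_apply, tmap_htmul, inner_htmul, smul_apply,
      inner_smul_right, mul_comm]

end HTensor

section Amplify

open scoped TensorProduct

variable {X : Type*} [CStarAlgebra X] {H H' K E E' : Type*}
  [NormedAddCommGroup H] [InnerProductSpace ℂ H] [CompleteSpace H]
  [NormedAddCommGroup H'] [InnerProductSpace ℂ H'] [CompleteSpace H']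
  [NormedAddCommGroup K] [InnerProductSpace ℂ K] [CompleteSpace K]
  [NormedAddCommGroup E] [InnerProductSpace ℂ E] [CompleteSpace E]
  [NormedAddCommGroup E'] [InnerProductSpace ℂ E'] [CompleteSpace E']

/-- The representation `T ↦ T ⊗ 1`. -/
noncomputable def tmapLeft (H K : Type*) [NormedAddCommGroup H] [InnerProductSpace ℂ H]
    [CompleteSpace H] [NormedAddCommGroup K] [InnerProductSpace ℂ K] [CompleteSpace K] :
    (H →L[ℂ] H) →⋆ₐ[ℂ] (HTensor H K →L[ℂ] HTensor H K) where
  toFun T := tmap T 1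
  map_one' := tmap_one
  map_mul' S T := by rw [tmap_mul, one_mul]
  map_zero' := tmap_zero_left 1
  map_add' S T := tmap_add_left S T 1
  commutes' c := by
    rw [Algebra.algebraMap_eq_smul_one, Algebra.algebraMap_eq_smul_one, tmap_smul_left, tmap_one]
  map_star' T := by rw [star_tmap, star_one]

/-- The representation `R ↦ 1 ⊗ R`. -/
noncomputable def tmapRight (H K : Type*) [NormedAddCommGroup H] [InnerProductSpace ℂ H]
    [CompleteSpace H] [NormedAddCommGroup K] [InnerProductSpace ℂ K] [CompleteSpace K] :
    (K →L[ℂ] K) →⋆ₐ[ℂ] (HTensor H K →L[ℂ] HTensor H K) where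
  toFun R := tmap 1 R
  map_one' := tmap_one
  map_mul' R S := by rw [tmap_mul, one_mul]
  map_zero' := tmap_zero_right 1
  map_add' R S := tmap_add_right 1 R S
  commutes' c := by
    rw [Algebra.algebraMap_eq_smul_one, Algebra.algebraMap_eq_smul_one, tmap_smul_right, tmap_one]
  map_star' R := by rw [star_tmap, star_one]

theorem tmapLeft_mul_tmapRight (T : H →L[ℂ] H) (R : K →L[ℂ] K) :
    tmapLeft H K T * tmapRight H K R = tmap T R := by
  change tmap T 1 * tmap 1 R = tmap T R
  rw [tmap_mul, one_mul, mul_one]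

theorem tmapRight_mul_tmapLeft (T : H →L[ℂ] H) (R : K →L[ℂ] K) :
    tmapRight H K R * tmapLeft H K T = tmap T R := by
  change tmap 1 R * tmap T 1 = tmap T R
  rw [tmap_mul, one_mul, mul_one]

/-- The amplification `x ⊗ R ↦ π x ⊗ R` of a representation `π` to the algebraic tensor product
with `B(K)`. -/
noncomputable def amplify (K : Type*) [NormedAddCommGroup K] [InnerProductSpace ℂ K]
    [CompleteSpace K] (π : X →⋆ₐ[ℂ] (H →L[ℂ] H)) :
    X ⊗[ℂ] (K →L[ℂ] K) →⋆ₐ[ℂ] (HTensor H K →L[ℂ] HTensor H K) where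
  toAlgHom := Algebra.TensorProduct.lift ((tmapLeft H K).comp π).toAlgHom (tmapRight H K).toAlgHom
    fun x R => (tmapLeft_mul_tmapRight (π x) R).trans (tmapRight_mul_tmapLeft (π x) R).symm
  map_star' t := by
    induction t using TensorProduct.induction_on with
    | zero => simp
    | tmul x R =>
      change tmapLeft H K (π (star x)) * tmapRight H K (star R) =
        star (tmapLeft H K (π x) * tmapRight H K R)
      rw [tmapLeft_mul_tmapRight, tmapLeft_mul_tmapRight, star_tmap, map_star]
    | add t u ht hu => simp_all

theorem amplify_tmul (π : X →⋆ₐ[ℂ] (H →L[ℂ] H)) (x : X) (R : K →L[ℂ] K) :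
    amplify K π (x ⊗ₜ R) = tmap (π x) R := tmapLeft_mul_tmapRight (π x) R

theorem exists_slice_amplify (k k' : K) (t : X ⊗[ℂ] (K →L[ℂ] K)) (π : X →⋆ₐ[ℂ] (H →L[ℂ] H))
    (σ : X →⋆ₐ[ℂ] (H' →L[ℂ] H')) :
    ∃ x, slice k k' (amplify K π t) = π x ∧ slice k k' (amplify K σ t) = σ x := by
  induction t using TensorProduct.induction_on with
  | zero =>
    exact ⟨0, by rw [map_zero, slice_zero, map_zero], by rw [map_zero, slice_zero, map_zero]⟩
  | tmul x R =>
    exact ⟨inner ℂ k (R k') • x, by rw [amplify_tmul, slice_tmap, map_smul],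
      by rw [amplify_tmul, slice_tmap, map_smul]⟩
  | add t u ht hu =>
    obtain ⟨x, hx, hx'⟩ := ht
    obtain ⟨y, hy, hy'⟩ := hu
    exact ⟨x + y, by rw [map_add, slice_add, hx, hy, map_add],
      by rw [map_add, slice_add, hx', hy', map_add]⟩

/-- The minimal tensor norm does not depend on the faithful representation: slicing by vector
functionals separates operators on `H ⊗ K`, and slices of amplifications lie in the range of the
representation. -/
theorem norm_amplify_le {π : X →⋆ₐ[ℂ] (H →L[ℂ] H)} (hπ : Function.Injective π)
    (σ : X →⋆ₐ[ℂ] (H' →L[ℂ] H')) (t : X ⊗[ℂ] (K →L[ℂ] K)) :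
    ‖amplify K σ t‖ ≤ ‖amplify K π t‖ := by
  refine norm_apply_le_of_separating (κ := K × K) (E := fun k => slice k.1 k.2)
    (E' := fun k => slice k.1 k.2) (fun k => continuous_slice k.1 k.2)
    (fun k => continuous_slice k.1 k.2) (fun k => slice_zero k.1 k.2)
    (fun T hT => eq_zero_of_slice_eq_zero fun k k' => hT (k, k')) (fun k t => ?_) t
  obtain ⟨x, hx, hx'⟩ := exists_slice_amplify k.1 k.2 t π σ
  rw [hx, hx', NonUnitalStarAlgHom.norm_map π hπ]
  exact NonUnitalStarAlgHom.norm_apply_le σ x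

theorem norm_conjStarAlgEquiv (e : E ≃ₗᵢ[ℂ] H) (T : E →L[ℂ] E) : ‖e.conjStarAlgEquiv T‖ = ‖T‖ :=
  NonUnitalStarAlgHom.norm_map e.conjStarAlgEquiv e.conjStarAlgEquiv.injective T

theorem norm_eval_le_of_amplify {π : X →⋆ₐ[ℂ] (H →L[ℂ] H)} (hπ : Function.Injective π)
    (σ : X →⋆ₐ[ℂ] (H' →L[ℂ] H')) (e : E ≃ₗᵢ[ℂ] HTensor H K) (e' : E' ≃ₗᵢ[ℂ] HTensor H' K)
    {ι : Type*} {g : ι → E →L[ℂ] E} {g' : ι → E' →L[ℂ] E'} {t : ι → X ⊗[ℂ] (K →L[ℂ] K)}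
    (hg : ∀ i, e.conjStarAlgEquiv (g i) = amplify K π (t i))
    (hg' : ∀ i, e'.conjStarAlgEquiv (g' i) = amplify K σ (t i)) (p : FreeStarAlgebra ι) :
    ‖FreeStarAlgebra.eval g' p‖ ≤ ‖FreeStarAlgebra.eval g p‖ := by
  have he : e.conjStarAlgEquiv (FreeStarAlgebra.eval g p) =
      amplify K π (FreeStarAlgebra.eval t p) := by
    rw [FreeStarAlgebra.map_eval (B := X ⊗[ℂ] (K →L[ℂ] K)) (amplify K π), ← funext hg]
    exact FreeStarAlgebra.map_eval e.conjStarAlgEquiv.toStarAlgHom g p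
  have he' : e'.conjStarAlgEquiv (FreeStarAlgebra.eval g' p) =
      amplify K σ (FreeStarAlgebra.eval t p) := by
    rw [FreeStarAlgebra.map_eval (B := X ⊗[ℂ] (K →L[ℂ] K)) (amplify K σ), ← funext hg']
    exact FreeStarAlgebra.map_eval e'.conjStarAlgEquiv.toStarAlgHom g' p
  rw [← norm_conjStarAlgEquiv e, ← norm_conjStarAlgEquiv e', he, he']
  exact norm_amplify_le hπ σ _

end Amplify

/-! ### Braided tensor products -/

section Unitary

variable {E H : Type*} [NormedAddCommGroup E] [InnerProductSpace ℂ E] [CompleteSpace E]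
  [NormedAddCommGroup H] [InnerProductSpace ℂ H] [CompleteSpace H]

/-- A unitary operator as an isometric isomorphism of Hilbert spaces. -/
noncomputable def unitaryEquiv (Z : E →L[ℂ] H) (h₁ : Z.adjoint ∘L Z = 1)
    (h₂ : Z ∘L Z.adjoint = 1) : E ≃ₗᵢ[ℂ] H where
  toLinearEquiv := .ofLinearMap Z.toLinearMap Z.adjoint.toLinearMap
    (LinearMap.ext fun v => congr($h₂ v)) (LinearMap.ext fun v => congr($h₁ v))
  norm_map' := (ContinuousLinearMap.norm_map_iff_adjoint_comp_self Z).2 h₁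

theorem conjStarAlgEquiv_eq_of_intertwine {e : E ≃ₗᵢ[ℂ] H} {T : E →L[ℂ] E} {S : H →L[ℂ] H}
    (h : ∀ v, e (T v) = S (e v)) : e.conjStarAlgEquiv T = S :=
  ContinuousLinearMap.ext fun v => by
    rw [LinearIsometryEquiv.conjStarAlgEquiv_apply_apply, h, e.apply_symm_apply]

theorem norm_eval_conjStarAlgEquiv (e : E ≃ₗᵢ[ℂ] H) {ι : Type*} (g : ι → E →L[ℂ] E)
    (p : FreeStarAlgebra ι) :
    ‖FreeStarAlgebra.eval (fun i => e.conjStarAlgEquiv (g i)) p‖ = ‖FreeStarAlgebra.eval g p‖ := by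
  rw [← norm_conjStarAlgEquiv e (FreeStarAlgebra.eval g p)]
  exact congrArg norm (FreeStarAlgebra.map_eval e.conjStarAlgEquiv.toStarAlgHom g p).symm

end Unitary

section BraidPhase

variable {N : ℕ} [NeZero N] {ω : ℂ} {H K : Type*}
  [NormedAddCommGroup H] [InnerProductSpace ℂ H] [CompleteSpace H]
  [NormedAddCommGroup K] [InnerProductSpace ℂ K] [CompleteSpace K]

theorem URep.op_eq_sum (hω : IsPrimitiveRoot ω N) (U : URep N H) (t : ZMod N) :
    U.op t = ∑ a, rootPow ω (t * a) • U.proj ω a := by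
  calc U.op t = U.op t * ∑ a, U.proj ω a := by rw [U.sum_proj hω, mul_one]
    _ = ∑ a, rootPow ω (t * a) • U.proj ω a := by
      rw [Finset.mul_sum]
      exact Finset.sum_congr rfl fun a _ => U.op_mul_proj hω t a

/-- The unitary `v ⊗ w ↦ ω ^ (m n) v ⊗ w` for `v` of degree `m` and `w` of degree `n`: the braiding
without the flip. -/
noncomputable def braidPhase (ω : ℂ) (U : URep N H) (V : URep N K) :
    HTensor H K →L[ℂ] HTensor H K :=
  ∑ p : ZMod N × ZMod N, rootPow ω (p.1 * p.2) • tmap (U.proj ω p.1) (V.proj ω p.2)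

theorem braidPhase_eq_sum_op_left (hω : IsPrimitiveRoot ω N) (U : URep N H) (V : URep N K) :
    braidPhase ω U V = ∑ b, tmap (U.op b) (V.proj ω b) := by
  rw [braidPhase, Fintype.sum_prod_type, Finset.sum_comm]
  refine Finset.sum_congr rfl fun b _ => ?_
  rw [U.op_eq_sum hω, tmap_sum_left]
  refine Finset.sum_congr rfl fun a _ => ?_
  rw [tmap_smul_left, mul_comm]

theorem braidPhase_eq_sum_op_right (hω : IsPrimitiveRoot ω N) (U : URep N H) (V : URep N K) :
    braidPhase ω U V = ∑ a, tmap (U.proj ω a) (V.op a) := by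
  rw [braidPhase, Fintype.sum_prod_type]
  refine Finset.sum_congr rfl fun b _ => ?_
  rw [V.op_eq_sum hω, tmap_sum_right]
  refine Finset.sum_congr rfl fun a _ => ?_
  rw [tmap_smul_right]

theorem tflip_comp_braid (U : URep N H) (V : URep N K) :
    tflip K H ∘L braid ω U V = braidPhase ω U V := by
  change tflip K H ∘L tflip H K ∘L braidPhase ω U V = _
  rw [← ContinuousLinearMap.comp_assoc, tflip_tflip]
  rfl

theorem braidPhase_comp_braidDual (hω : IsPrimitiveRoot ω N) (U : URep N H) (V : URep N K) :
    braidPhase ω U V ∘L braidDual ω U V = tflip K H := by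
  rw [← tflip_comp_braid, ContinuousLinearMap.comp_assoc, braid_comp_braidDual hω]
  rfl

theorem adjoint_braidPhase (hω : IsPrimitiveRoot ω N) (U : URep N H) (V : URep N K) :
    (braidPhase ω U V).adjoint = braidDual ω U V ∘L tflip H K := by
  rw [← tflip_comp_braid, ContinuousLinearMap.adjoint_comp, adjoint_braid hω, adjoint_tflip]

/-- `braidPhase` as an isometric isomorphism. -/
noncomputable def braidPhaseEquiv (hω : IsPrimitiveRoot ω N) (U : URep N H) (V : URep N K) :
    HTensor H K ≃ₗᵢ[ℂ] HTensor H K :=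
  unitaryEquiv (braidPhase ω U V)
    (by
      rw [adjoint_braidPhase hω, ContinuousLinearMap.comp_assoc]
      exact braidDual_comp_braid hω U V)
    (by
      rw [adjoint_braidPhase hω, ← ContinuousLinearMap.comp_assoc, braidPhase_comp_braidDual hω,
        tflip_tflip])

/-- `tflip` as an isometric isomorphism. -/
noncomputable def tflipEquiv (H K : Type*) [NormedAddCommGroup H] [InnerProductSpace ℂ H]
    [CompleteSpace H] [NormedAddCommGroup K] [InnerProductSpace ℂ K] [CompleteSpace K] :
    HTensor H K ≃ₗᵢ[ℂ] HTensor K H :=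
  unitaryEquiv (tflip H K) (by rw [adjoint_tflip, tflip_tflip]) (by rw [adjoint_tflip, tflip_tflip])

end BraidPhase

section Embeddings

open scoped TensorProduct

variable {N : ℕ} [NeZero N] {ω : ℂ} {X Y : Type*} [CStarAlgebra X] [CStarAlgebra Y]
  {α : Coaction N X} {β : Coaction N Y} {H K : Type*}
  [NormedAddCommGroup H] [InnerProductSpace ℂ H] [CompleteSpace H]
  [NormedAddCommGroup K] [InnerProductSpace ℂ K] [CompleteSpace K]

theorem CovariantRep.π_ρ_mul_op (r : CovariantRep α H) (x : X) (t : ZMod N) :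
    r.π (α.ρ x t) * r.U.op t = r.U.op t * r.π x := by
  rw [r.equivariant, mul_assoc, URep.star_op, ← URep.op_add, neg_add_cancel, URep.op_zero, mul_one]

theorem CovariantRep.op_mul_π_ρ_neg (r : CovariantRep α H) (x : X) (t : ZMod N) :
    r.U.op t * r.π (α.ρ x (-t)) = r.π x * r.U.op t := by
  rw [← r.π_ρ_mul_op, α.coassoc, add_neg_cancel, α.ρ_zero]

theorem braidPhase_mul_opJ₁ (hω : IsPrimitiveRoot ω N) (r : CovariantRep α H)
    (s : CovariantRep β K) (x : X) :
    braidPhase ω r.U s.U * opJ₁ r s x =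
      (∑ b, tmap (r.π (α.ρ x b)) (s.U.proj ω b)) * braidPhase ω r.U s.U := by
  rw [braidPhase_eq_sum_op_left hω, opJ₁_apply, Finset.sum_mul, Finset.sum_mul]
  refine Finset.sum_congr rfl fun b _ => ?_
  rw [Finset.mul_sum, Finset.sum_eq_single_of_mem b (Finset.mem_univ b)]
  · rw [tmap_mul, tmap_mul, s.U.proj_mul_proj hω, if_pos rfl, mul_one, r.π_ρ_mul_op]
  · intro c _ hc
    rw [tmap_mul, s.U.proj_mul_proj hω, if_neg hc.symm, tmap_zero_right]

theorem braidPhase_mul_opJ₂ (hω : IsPrimitiveRoot ω N) (r : CovariantRep α H)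
    (s : CovariantRep β K) (y : Y) :
    braidPhase ω r.U s.U * opJ₂ hω r s y = tmap 1 (s.π y) * braidPhase ω r.U s.U := by
  simp only [ContinuousLinearMap.mul_def]
  rw [opJ₂_apply, ← ContinuousLinearMap.comp_assoc, braidPhase_comp_braidDual hω,
    ← ContinuousLinearMap.comp_assoc, tflip_comp_tmap, ContinuousLinearMap.comp_assoc,
    tflip_comp_braid]

theorem opJ₂_eq_sum (hω : IsPrimitiveRoot ω N) (r : CovariantRep α H)
    (s : CovariantRep β K) (y : Y) :
    opJ₂ hω r s y = ∑ a, tmap (r.U.proj ω a) (s.π (β.ρ y (-a))) := by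
  have h : braidPhase ω r.U s.U * opJ₂ hω r s y =
      braidPhase ω r.U s.U * ∑ a, tmap (r.U.proj ω a) (s.π (β.ρ y (-a))) := by
    rw [braidPhase_mul_opJ₂, braidPhase_eq_sum_op_right hω, Finset.mul_sum, Finset.sum_mul]
    refine Finset.sum_congr rfl fun a _ => ?_
    rw [Finset.mul_sum, Finset.sum_eq_single_of_mem a (Finset.mem_univ a)]
    · rw [tmap_mul, tmap_mul, r.U.proj_mul_proj hω, if_pos rfl, one_mul, s.op_mul_π_ρ_neg]
    · intro c _ hc
      rw [tmap_mul, r.U.proj_mul_proj hω, if_neg hc.symm, tmap_zero_left]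
  exact ContinuousLinearMap.ext fun v =>
    (braidPhaseEquiv hω r.U s.U).injective congr($h v)

theorem conj_braidPhase_opJ₁ (hω : IsPrimitiveRoot ω N) (r : CovariantRep α H)
    (s : CovariantRep β K) (x : X) :
    (braidPhaseEquiv hω r.U s.U).conjStarAlgEquiv (opJ₁ r s x) =
      amplify K r.π (∑ b, α.ρ x b ⊗ₜ s.U.proj ω b) := by
  simp only [map_sum, amplify_tmul]
  exact conjStarAlgEquiv_eq_of_intertwine fun v => congr($(braidPhase_mul_opJ₁ hω r s x) v)

theorem conj_braidPhase_opJ₂ (hω : IsPrimitiveRoot ω N) (r : CovariantRep α H)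
    (s : CovariantRep β K) (y : Y) :
    (braidPhaseEquiv hω r.U s.U).conjStarAlgEquiv (opJ₂ hω r s y) =
      amplify K r.π (1 ⊗ₜ s.π y) := by
  rw [amplify_tmul, map_one]
  exact conjStarAlgEquiv_eq_of_intertwine fun v => congr($(braidPhase_mul_opJ₂ hω r s y) v)

theorem conj_tflip_tmap (T : H →L[ℂ] H) (R : K →L[ℂ] K) :
    (tflipEquiv H K).conjStarAlgEquiv (tmap T R) = tmap R T :=
  conjStarAlgEquiv_eq_of_intertwine fun v => congr($(tflip_comp_tmap T R) v)

theorem conj_tflip_opJ₁ (r : CovariantRep α H) (s : CovariantRep β K) (x : X) :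
    (tflipEquiv H K).conjStarAlgEquiv (opJ₁ r s x) = amplify H s.π (1 ⊗ₜ r.π x) := by
  rw [amplify_tmul, map_one, opJ₁_apply, conj_tflip_tmap]

theorem conj_tflip_opJ₂ (hω : IsPrimitiveRoot ω N) (r : CovariantRep α H)
    (s : CovariantRep β K) (y : Y) :
    (tflipEquiv H K).conjStarAlgEquiv (opJ₂ hω r s y) =
      amplify H s.π (∑ a, β.ρ y (-a) ⊗ₜ r.U.proj ω a) := by
  simp only [opJ₂_eq_sum, map_sum, amplify_tmul, conj_tflip_tmap]

theorem norm_braidedIncl (hω : IsPrimitiveRoot ω N) (r : CovariantRep α H)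
    (s : CovariantRep β K) (T : Braided hω r s) : ‖braidedIncl hω r s T‖ = ‖T‖ :=
  NonUnitalStarAlgHom.norm_map _ (braidedIncl_injective hω r s) T

theorem norm_eval_braidedIncl (hω : IsPrimitiveRoot ω N) (r : CovariantRep α H)
    (s : CovariantRep β K) {ι : Type*} (g : ι → Braided hω r s) (p : FreeStarAlgebra ι) :
    ‖FreeStarAlgebra.eval (fun i => braidedIncl hω r s (g i)) p‖ = ‖FreeStarAlgebra.eval g p‖ := by
  rw [← FreeStarAlgebra.map_eval, norm_braidedIncl]

theorem generated_range_j₁_union_range_j₂ (hω : IsPrimitiveRoot ω N) (r : CovariantRep α H)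
    (s : CovariantRep β K) :
    generated (Set.range (j₁ hω r s) ∪ Set.range (j₂ hω r s)) = ⊤ := by
  set S := generated (Set.range (j₁ hω r s) ∪ Set.range (j₂ hω r s))
  have hclosed : IsClosed (braidedIncl hω r s '' (S : Set (Braided hω r s))) :=
    (NonUnitalStarAlgHom.isometry (braidedIncl hω r s)
      (braidedIncl_injective hω r s)).isClosedEmbedding.isClosedMap _ (isClosed_generated _)
  have hle : braidedSubalgebra hω r s ≤ S.map (braidedIncl hω r s) := by
    refine StarSubalgebra.topologicalClosure_minimal (StarAlgebra.adjoin_le ?_) hclosed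
    rintro _ ⟨x, y, rfl⟩
    exact ⟨j₁ hω r s x * j₂ hω r s y, mul_mem (subset_generated _ (Or.inl ⟨x, rfl⟩))
      (subset_generated _ (Or.inr ⟨y, rfl⟩)), rfl⟩
  refine eq_top_iff.2 fun T _ => ?_
  obtain ⟨T', hT', h⟩ := hle T.2
  rwa [← braidedIncl_injective hω r s h]

end Embeddings

section Functoriality

open scoped TensorProduct

variable {N : ℕ} [NeZero N] {ω : ℂ} {hω : IsPrimitiveRoot ω N} {X₁ X₂ Y₁ Y₂ : Type*}
  [CStarAlgebra X₁] [CStarAlgebra X₂] [CStarAlgebra Y₁] [CStarAlgebra Y₂]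
  {α₁ : Coaction N X₁} {α₂ : Coaction N X₂} {β₁ : Coaction N Y₁} {β₂ : Coaction N Y₂}
  {H₁ H₂ K₁ K₂ : Type*}
  [NormedAddCommGroup H₁] [InnerProductSpace ℂ H₁] [CompleteSpace H₁]
  [NormedAddCommGroup H₂] [InnerProductSpace ℂ H₂] [CompleteSpace H₂]
  [NormedAddCommGroup K₁] [InnerProductSpace ℂ K₁] [CompleteSpace K₁]
  [NormedAddCommGroup K₂] [InnerProductSpace ℂ K₂] [CompleteSpace K₂]
  {r₁ : CovariantRep α₁ H₁} {r₂ : CovariantRep α₂ H₂}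
  {s₁ : CovariantRep β₁ K₁} {s₂ : CovariantRep β₂ K₂} {f : X₁ →⋆ₐ[ℂ] Y₁} {g : X₂ →⋆ₐ[ℂ] Y₂}

theorem IsBraidedMap.map_j₁ {F : Braided hω r₁ r₂ →⋆ₐ[ℂ] Braided hω s₁ s₂}
    (hF : IsBraidedMap hω r₁ r₂ s₁ s₂ f g F) (x : X₁) :
    F (j₁ hω r₁ r₂ x) = j₁ hω s₁ s₂ (f x) := by
  simpa only [map_one, mul_one] using hF.2 x 1

theorem IsBraidedMap.map_j₂ {F : Braided hω r₁ r₂ →⋆ₐ[ℂ] Braided hω s₁ s₂}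
    (hF : IsBraidedMap hω r₁ r₂ s₁ s₂ f g F) (y : X₂) :
    F (j₂ hω r₁ r₂ y) = j₂ hω s₁ s₂ (g y) := by
  simpa only [map_one, one_mul] using hF.2 1 y

theorem isBraidedMap_of_map_j {F : Braided hω r₁ r₂ →⋆ₐ[ℂ] Braided hω s₁ s₂}
    (hf : IsEquivariant α₁ β₁ f) (hg : IsEquivariant α₂ β₂ g)
    (h₁ : ∀ x, F (j₁ hω r₁ r₂ x) = j₁ hω s₁ s₂ (f x))
    (h₂ : ∀ y, F (j₂ hω r₁ r₂ y) = j₂ hω s₁ s₂ (g y)) : IsBraidedMap hω r₁ r₂ s₁ s₂ f g F := by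
  refine ⟨isEquivariant_of_generated (generated_range_j₁_union_range_j₂ hω r₁ r₂) ?_,
    fun x y => by rw [map_mul, h₁, h₂]⟩
  rintro _ (⟨x, rfl⟩ | ⟨y, rfl⟩) t
  · rw [h₁, j₁_equivariant, j₁_equivariant, h₁, hf]
  · rw [h₂, j₂_equivariant, j₂_equivariant, h₂, hg]

theorem exists_isBraidedMap_of_norm_eval_le (hf : IsEquivariant α₁ β₁ f)
    (hg : IsEquivariant α₂ β₂ g)
    (h : ∀ p : FreeStarAlgebra (X₁ ⊕ X₂),
      ‖FreeStarAlgebra.eval (Sum.elim (opJ₁ s₁ s₂ ∘ f) (opJ₂ hω s₁ s₂ ∘ g)) p‖ ≤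
        ‖FreeStarAlgebra.eval (Sum.elim (opJ₁ r₁ r₂) (opJ₂ hω r₁ r₂)) p‖) :
    ∃ F, IsBraidedMap hω r₁ r₂ s₁ s₂ f g F := by
  obtain ⟨F, hF⟩ := exists_starAlgHom_of_generators
    (g := Sum.elim (j₁ hω r₁ r₂) (j₂ hω r₁ r₂))
    (g' := Sum.elim (j₁ hω s₁ s₂ ∘ f) (j₂ hω s₁ s₂ ∘ g))
    (by rw [Set.Sum.elim_range, generated_range_j₁_union_range_j₂])
    (fun p => by
      rw [← norm_eval_braidedIncl, ← norm_eval_braidedIncl]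
      convert h p using 4
      all_goals exact funext fun i => by cases i <;> rfl)
  exact ⟨F, isBraidedMap_of_map_j hf hg (fun x => hF (.inl x)) fun y => hF (.inr y)⟩

theorem isEquivariant_id {X : Type*} [CStarAlgebra X] (α : Coaction N X) :
    IsEquivariant α α (StarAlgHom.id ℂ X) := fun _ _ => rfl

variable (hω r₁ r₂ s₁ s₂)

theorem exists_isBraidedMap_id_right (hf : IsEquivariant α₁ β₁ f) :
    ∃ F, IsBraidedMap hω r₁ r₂ s₁ r₂ f (StarAlgHom.id ℂ X₂) F := by
  refine exists_isBraidedMap_of_norm_eval_le hf (isEquivariant_id α₂) fun p =>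
    norm_eval_le_of_amplify r₁.injective (s₁.π.comp f) (braidPhaseEquiv hω r₁.U r₂.U)
      (braidPhaseEquiv hω s₁.U r₂.U)
      (t := Sum.elim (fun x => ∑ b, α₁.ρ x b ⊗ₜ r₂.U.proj ω b) (fun y => 1 ⊗ₜ r₂.π y)) ?_ ?_ p
  · rintro (x | y)
    · exact conj_braidPhase_opJ₁ hω r₁ r₂ x
    · exact conj_braidPhase_opJ₂ hω r₁ r₂ y
  · rintro (x | y)
    · refine (conj_braidPhase_opJ₁ hω s₁ r₂ (f x)).trans ?_
      simp only [Sum.elim_inl, map_sum, amplify_tmul, StarAlgHom.comp_apply, hf x]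
    · refine (conj_braidPhase_opJ₂ hω s₁ r₂ y).trans ?_
      simp only [Sum.elim_inr, amplify_tmul, map_one]

theorem exists_isBraidedMap_id_left (hg : IsEquivariant α₂ β₂ g) :
    ∃ F, IsBraidedMap hω r₁ r₂ r₁ s₂ (StarAlgHom.id ℂ X₁) g F := by
  refine exists_isBraidedMap_of_norm_eval_le (isEquivariant_id α₁) hg fun p =>
    norm_eval_le_of_amplify r₂.injective (s₂.π.comp g) (tflipEquiv H₁ H₂) (tflipEquiv H₁ K₂)
      (t := Sum.elim (fun x => 1 ⊗ₜ r₁.π x) (fun y => ∑ a, α₂.ρ y (-a) ⊗ₜ r₁.U.proj ω a)) ?_ ?_ p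
  · rintro (x | y)
    · exact conj_tflip_opJ₁ r₁ r₂ x
    · exact conj_tflip_opJ₂ hω r₁ r₂ y
  · rintro (x | y)
    · refine (conj_tflip_opJ₁ r₁ s₂ x).trans ?_
      simp only [Sum.elim_inl, amplify_tmul, map_one]
    · refine (conj_tflip_opJ₂ hω r₁ s₂ (g y)).trans ?_
      simp only [Sum.elim_inr, map_sum, amplify_tmul, StarAlgHom.comp_apply, hg y]

end Functoriality

/-! ### Associativity -/

section HAssoc

open scoped TensorProduct

variable {H K M : Type*}
  [NormedAddCommGroup H] [InnerProductSpace ℂ H] [CompleteSpace H]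
  [NormedAddCommGroup K] [InnerProductSpace ℂ K] [CompleteSpace K]
  [NormedAddCommGroup M] [InnerProductSpace ℂ M] [CompleteSpace M]

/-- The operator `y ↦ x ⊗ y`. -/
noncomputable def htmulLeft (K : Type*) [NormedAddCommGroup K] [InnerProductSpace ℂ K]
    [CompleteSpace K] (x : H) : K →L[ℂ] HTensor H K :=
  tflip K H ∘L htmulRight K x

theorem htmulLeft_apply (x : H) (y : K) : htmulLeft K x y = htmul x y := tflip_htmul y x

theorem htensor_ext_left {E : Type*} [NormedAddCommGroup E] [NormedSpace ℂ E]
    {S T : HTensor (HTensor H K) M →L[ℂ] E}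
    (h : ∀ x y z, S (htmul (htmul x y) z) = T (htmul (htmul x y) z)) : S = T :=
  htensor_ext fun u z => by
    have hz : S ∘L htmulRight _ z = T ∘L htmulRight _ z := htensor_ext fun x y => h x y z
    exact congr($hz u)

theorem htensor_ext_right {E : Type*} [NormedAddCommGroup E] [NormedSpace ℂ E]
    {S T : HTensor H (HTensor K M) →L[ℂ] E}
    (h : ∀ x y z, S (htmul x (htmul y z)) = T (htmul x (htmul y z))) : S = T :=
  htensor_ext fun x u => by
    have hx : S ∘L htmulLeft _ x = T ∘L htmulLeft _ x := htensor_ext fun y z => by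
      simpa only [ContinuousLinearMap.comp_apply, htmulLeft_apply] using h x y z
    simpa only [ContinuousLinearMap.comp_apply, htmulLeft_apply] using congr($hx u)

/-- The inclusion of the algebraic threefold tensor product, bracketed to the left. -/
noncomputable def hcoeLeft (H K M : Type*) [NormedAddCommGroup H] [InnerProductSpace ℂ H]
    [NormedAddCommGroup K] [InnerProductSpace ℂ K]
    [NormedAddCommGroup M] [InnerProductSpace ℂ M] :
    (H ⊗[ℂ] K) ⊗[ℂ] M →ₗᵢ[ℂ] HTensor (HTensor H K) M :=
  (hcoe (HTensor H K) M).comp (TensorProduct.mapIsometry (hcoe H K) LinearIsometry.id)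

/-- The inclusion of the algebraic threefold tensor product, bracketed to the right. -/
noncomputable def hcoeRight (H K M : Type*) [NormedAddCommGroup H] [InnerProductSpace ℂ H]
    [NormedAddCommGroup K] [InnerProductSpace ℂ K]
    [NormedAddCommGroup M] [InnerProductSpace ℂ M] :
    H ⊗[ℂ] (K ⊗[ℂ] M) →ₗᵢ[ℂ] HTensor H (HTensor K M) :=
  (hcoe H (HTensor K M)).comp (TensorProduct.mapIsometry LinearIsometry.id (hcoe K M))

theorem denseRange_of_functional_eq_zero {V E : Type*} [AddCommGroup V] [Module ℂ V]
    [NormedAddCommGroup E] [InnerProductSpace ℂ E] [CompleteSpace E] {j : V →ₗ[ℂ] E}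
    (h : ∀ φ : E →L[ℂ] ℂ, (∀ v, φ (j v) = 0) → φ = 0) : DenseRange j := by
  have htop : (LinearMap.range j).topologicalClosure = ⊤ := by
    rw [Submodule.topologicalClosure_eq_top_iff, Submodule.eq_bot_iff]
    intro w hw
    have hφ : innerSL ℂ w = 0 := h _ fun v =>
      Submodule.inner_left_of_mem_orthogonal (LinearMap.mem_range_self j v) hw
    simpa using congr($hφ w)
  exact Submodule.dense_iff_topologicalClosure_eq_top.2 htop

theorem denseRange_hcoeLeft : DenseRange (hcoeLeft H K M) :=
  denseRange_of_functional_eq_zero (j := (hcoeLeft H K M).toLinearMap) fun _ hφ =>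
    htensor_ext_left fun x y z => hφ ((x ⊗ₜ y) ⊗ₜ z)

theorem denseRange_hcoeRight : DenseRange (hcoeRight H K M) :=
  denseRange_of_functional_eq_zero (j := (hcoeRight H K M).toLinearMap) fun _ hφ =>
    htensor_ext_right fun x y z => hφ (x ⊗ₜ (y ⊗ₜ z))

/-- The associator `(H ⊗ K) ⊗ M ≃ H ⊗ (K ⊗ M)` of Hilbert space tensor products. -/
noncomputable def hassoc (H K M : Type*) [NormedAddCommGroup H] [InnerProductSpace ℂ H]
    [CompleteSpace H] [NormedAddCommGroup K] [InnerProductSpace ℂ K] [CompleteSpace K]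
    [NormedAddCommGroup M] [InnerProductSpace ℂ M] [CompleteSpace M] :
    HTensor (HTensor H K) M ≃ₗᵢ[ℂ] HTensor H (HTensor K M) :=
  (TensorProduct.assoc ℂ H K M).extendOfIsometry (hcoeLeft H K M).toLinearMap
    (hcoeRight H K M).toLinearMap denseRange_hcoeLeft denseRange_hcoeRight fun a =>
      calc ‖hcoeRight H K M (TensorProduct.assoc ℂ H K M a)‖
        _ = ‖TensorProduct.assocIsometry ℂ H K M a‖ := LinearIsometry.norm_map _ _
        _ = ‖a‖ := LinearIsometryEquiv.norm_map _ a
        _ = ‖hcoeLeft H K M a‖ := (LinearIsometry.norm_map _ a).symm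

theorem hassoc_htmul (x : H) (y : K) (z : M) :
    hassoc H K M (htmul (htmul x y) z) = htmul x (htmul y z) :=
  LinearEquiv.extendOfIsometry_eq _ _ _ denseRange_hcoeLeft denseRange_hcoeRight _ ((x ⊗ₜ y) ⊗ₜ z)

theorem conj_hassoc_tmap (S : H →L[ℂ] H) (T : K →L[ℂ] K) (R : M →L[ℂ] M) :
    (hassoc H K M).conjStarAlgEquiv (tmap (tmap S T) R) = tmap S (tmap T R) := by
  have h : (hassoc H K M : _ →L[ℂ] _) ∘L tmap (tmap S T) R =
      tmap S (tmap T R) ∘L (hassoc H K M : _ →L[ℂ] _) :=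
    htensor_ext_left fun x y z => by
      change hassoc H K M (tmap (tmap S T) R (htmul (htmul x y) z)) =
        tmap S (tmap T R) (hassoc H K M (htmul (htmul x y) z))
      rw [tmap_htmul, tmap_htmul, hassoc_htmul, hassoc_htmul, tmap_htmul, tmap_htmul]
  exact conjStarAlgEquiv_eq_of_intertwine fun v => congr($h v)

end HAssoc

section Associator

variable {N : ℕ} [NeZero N] {ω : ℂ} {X Y Z : Type*} [CStarAlgebra X] [CStarAlgebra Y]
  [CStarAlgebra Z] {α : Coaction N X} {β : Coaction N Y} {γ : Coaction N Z} {H K M : Type*}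
  [NormedAddCommGroup H] [InnerProductSpace ℂ H] [CompleteSpace H]
  [NormedAddCommGroup K] [InnerProductSpace ℂ K] [CompleteSpace K]
  [NormedAddCommGroup M] [InnerProductSpace ℂ M] [CompleteSpace M]

theorem URep.proj_tensor (hω : IsPrimitiveRoot ω N) (U : URep N H) (V : URep N K) (c : ZMod N) :
    (U.tensor V).proj ω c = ∑ a, tmap (U.proj ω a) (V.proj ω (c - a)) := by
  have h : ∀ t, rootPow ω (-(t * c)) • (U.tensor V).op t =
      ∑ a, tmap (U.proj ω a) (rootPow ω (-(t * (c - a))) • V.op t) := fun t => by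
    rw [URep.op_tensor, U.op_eq_sum hω, tmap_sum_left, Finset.smul_sum]
    refine Finset.sum_congr rfl fun a _ => ?_
    rw [tmap_smul_left, tmap_smul_right, smul_smul, ← rootPow_add hω]
    congr 2
    ring
  rw [URep.proj, Finset.sum_congr rfl fun t _ => h t, Finset.sum_comm, Finset.smul_sum]
  refine Finset.sum_congr rfl fun a _ => ?_
  rw [← tmap_sum_right, ← tmap_smul_right]
  rfl

variable (hω : IsPrimitiveRoot ω N) (r : CovariantRep α H) (s : CovariantRep β K)
  (u : CovariantRep γ M)

theorem conj_hassoc_opJ₁_j₁ (x : X) :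
    (hassoc H K M).conjStarAlgEquiv (opJ₁ (r.braided hω s) u (j₁ hω r s x)) =
      opJ₁ r (s.braided hω u) x := by
  change (hassoc H K M).conjStarAlgEquiv (tmap (tmap (r.π x) 1) 1) = tmap (r.π x) 1
  rw [conj_hassoc_tmap, tmap_one]

theorem conj_hassoc_opJ₁_j₂ (y : Y) :
    (hassoc H K M).conjStarAlgEquiv (opJ₁ (r.braided hω s) u (j₂ hω r s y)) =
      opJ₂ hω r (s.braided hω u) (j₁ hω s u y) := by
  have hρ : ∀ t, (s.braided hω u).π ((braidedCoaction hω s u).ρ (j₁ hω s u y) t) =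
      tmap (s.π (β.ρ y t)) 1 := fun t => by
    rw [j₁_equivariant]
    rfl
  change (hassoc H K M).conjStarAlgEquiv (tmap (opJ₂ hω r s y) 1) = _
  simp only [opJ₂_eq_sum, tmap_sum_left, map_sum, conj_hassoc_tmap, hρ]

theorem conj_hassoc_opJ₂ (z : Z) :
    (hassoc H K M).conjStarAlgEquiv (opJ₂ hω (r.braided hω s) u z) =
      opJ₂ hω r (s.braided hω u) (j₂ hω s u z) := by
  have hρ : ∀ t, (s.braided hω u).π ((braidedCoaction hω s u).ρ (j₂ hω s u z) t) =
      ∑ b, tmap (s.U.proj ω b) (u.π (γ.ρ z (-b + t))) := fun t => by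
    rw [j₂_equivariant]
    refine (opJ₂_eq_sum hω s u (γ.ρ z t)).trans ?_
    simp only [γ.coassoc]
  have hproj : ∀ c, (r.braided hω s).U.proj ω c =
      ∑ a, tmap (r.U.proj ω a) (s.U.proj ω (c - a)) := URep.proj_tensor hω r.U s.U
  simp only [opJ₂_eq_sum, hρ, hproj, tmap_sum_left, tmap_sum_right, map_sum, conj_hassoc_tmap]
  rw [Finset.sum_comm]
  refine Finset.sum_congr rfl fun a _ => Fintype.sum_equiv (Equiv.subRight a) _ _ fun c => ?_
  rw [Equiv.subRight_apply, ← neg_add, sub_add_cancel]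

/-- The three embeddings into `(X ⊠ Y) ⊠ Z`. -/
noncomputable def embLeft : (X ⊕ Y) ⊕ Z → Braided hω (r.braided hω s) u :=
  Sum.elim (j₁ hω (r.braided hω s) u ∘ Sum.elim (j₁ hω r s) (j₂ hω r s)) (j₂ hω (r.braided hω s) u)

/-- The three embeddings into `X ⊠ (Y ⊠ Z)`. -/
noncomputable def embRight : (X ⊕ Y) ⊕ Z → Braided hω r (s.braided hω u) :=
  Sum.elim (Sum.elim (j₁ hω r (s.braided hω u)) (j₂ hω r (s.braided hω u) ∘ j₁ hω s u))
    (j₂ hω r (s.braided hω u) ∘ j₂ hω s u)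

theorem map_mem_generated {B C : Type*} [CStarAlgebra B] [CStarAlgebra C] (f : B →⋆ₐ[ℂ] C)
    {S : Set B} {S' : Set C} (hS : generated S = ⊤) (h : ∀ x ∈ S, f x ∈ generated S') (x : B) :
    f x ∈ generated S' := by
  have hle : generated S ≤ (generated S').comap f :=
    generated_le h ((isClosed_generated S').preimage (map_continuous f))
  exact hle (hS ▸ trivial : x ∈ generated S)

theorem generated_range_embLeft : generated (Set.range (embLeft hω r s u)) = ⊤ := by
  rw [eq_top_iff, ← generated_range_j₁_union_range_j₂]
  refine generated_le ?_ (isClosed_generated _)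
  rintro _ (⟨T, rfl⟩ | ⟨z, rfl⟩)
  · refine map_mem_generated (j₁ hω (r.braided hω s) u)
      (generated_range_j₁_union_range_j₂ hω r s) ?_ T
    rintro _ (⟨x, rfl⟩ | ⟨y, rfl⟩)
    · exact subset_generated _ ⟨.inl (.inl x), rfl⟩
    · exact subset_generated _ ⟨.inl (.inr y), rfl⟩
  · exact subset_generated _ ⟨.inr z, rfl⟩

theorem generated_range_embRight : generated (Set.range (embRight hω r s u)) = ⊤ := by
  rw [eq_top_iff, ← generated_range_j₁_union_range_j₂]
  refine generated_le ?_ (isClosed_generated _)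
  rintro _ (⟨x, rfl⟩ | ⟨T, rfl⟩)
  · exact subset_generated _ ⟨.inl (.inl x), rfl⟩
  · refine map_mem_generated (j₂ hω r (s.braided hω u))
      (generated_range_j₁_union_range_j₂ hω s u) ?_ T
    rintro _ (⟨y, rfl⟩ | ⟨z, rfl⟩)
    · exact subset_generated _ ⟨.inl (.inr y), rfl⟩
    · exact subset_generated _ ⟨.inr z, rfl⟩

theorem norm_eval_embRight (p : FreeStarAlgebra ((X ⊕ Y) ⊕ Z)) :
    ‖FreeStarAlgebra.eval (embRight hω r s u) p‖ =
      ‖FreeStarAlgebra.eval (embLeft hω r s u) p‖ := by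
  have h : ∀ i, braidedIncl hω _ _ (embRight hω r s u i) =
      (hassoc H K M).conjStarAlgEquiv (braidedIncl hω _ _ (embLeft hω r s u i)) := by
    rintro ((x | y) | z)
    · exact (conj_hassoc_opJ₁_j₁ hω r s u x).symm
    · exact (conj_hassoc_opJ₁_j₂ hω r s u y).symm
    · exact (conj_hassoc_opJ₂ hω r s u z).symm
  rw [← norm_eval_braidedIncl, funext h, norm_eval_conjStarAlgEquiv, norm_eval_braidedIncl]

theorem exists_starAlgEquiv_of_norm_eval_eq {B C ι : Type*} [CStarAlgebra B] [CStarAlgebra C]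
    {g : ι → B} {g' : ι → C} (hg : generated (Set.range g) = ⊤)
    (hg' : generated (Set.range g') = ⊤)
    (h : ∀ p, ‖FreeStarAlgebra.eval g' p‖ = ‖FreeStarAlgebra.eval g p‖) :
    ∃ F : B ≃⋆ₐ[ℂ] C, ∀ i, F (g i) = g' i := by
  obtain ⟨F, hF⟩ := exists_starAlgHom_of_generators hg fun p => (h p).le
  obtain ⟨G, hG⟩ := exists_starAlgHom_of_generators hg' fun p => (h p).ge
  have hGF : G.comp F = StarAlgHom.id ℂ B := starAlgHom_ext_of_generated hg <| by
    rintro _ ⟨i, rfl⟩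
    rw [StarAlgHom.comp_apply, hF, hG]
    rfl
  have hFG : F.comp G = StarAlgHom.id ℂ C := starAlgHom_ext_of_generated hg' <| by
    rintro _ ⟨i, rfl⟩
    rw [StarAlgHom.comp_apply, hG, hF]
    rfl
  exact ⟨.ofStarAlgHom F G hGF hFG, hF⟩

theorem exists_associator :
    ∃ a : Braided hω (r.braided hω s) u ≃⋆ₐ[ℂ] Braided hω r (s.braided hω u),
      ∀ i, a (embLeft hω r s u i) = embRight hω r s u i :=
  exists_starAlgEquiv_of_norm_eval_eq (generated_range_embLeft hω r s u)
    (generated_range_embRight hω r s u) (norm_eval_embRight hω r s u)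

end Associator

/-! ### Commutation relations -/

section Homogeneous

variable {N : ℕ} [NeZero N] {ω : ℂ} {X : Type*} [CStarAlgebra X]

/-- The elements of degree `n` for the grading by `ZMod N` that corresponds to a coaction. -/
def IsHomogeneous (ω : ℂ) (α : Coaction N X) (n : ZMod N) (x : X) : Prop :=
  ∀ t, α.ρ x t = rootPow ω (t * n) • x

/-- The component of degree `n` of an element, obtained by Fourier inversion. -/
noncomputable def Coaction.component (ω : ℂ) (α : Coaction N X) (n : ZMod N) (x : X) : X :=
  (N : ℂ)⁻¹ • ∑ t, rootPow ω (-(t * n)) • α.ρ x t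

theorem Coaction.isHomogeneous_component (hω : IsPrimitiveRoot ω N) (α : Coaction N X) (n : ZMod N)
    (x : X) : IsHomogeneous ω α n (α.component ω n x) := by
  intro s
  rw [← α.act_apply, Coaction.component, map_smul, map_sum, smul_comm,
    Finset.smul_sum (r := rootPow ω (s * n))]
  congr 1
  refine Fintype.sum_equiv (Equiv.addLeft s) _ _ fun t => ?_
  rw [map_smul, α.act_apply, α.coassoc, smul_smul, ← rootPow_add hω, Equiv.coe_addLeft]
  congr 2
  ring

theorem Coaction.sum_component (hω : IsPrimitiveRoot ω N) (α : Coaction N X) (x : X) :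
    ∑ n, α.component ω n x = x := by
  have orthogonality : ∀ t : ZMod N, ∑ n, rootPow ω (-(t * n)) = if t = 0 then (N : ℂ) else 0 :=
    fun t => by simpa only [neg_eq_zero, mul_neg, mul_comm t] using sum_rootPow hω (-t)
  calc ∑ n, α.component ω n x
    _ = (N : ℂ)⁻¹ • ∑ t, (∑ n, rootPow ω (-(t * n))) • α.ρ x t := by
      simp only [Coaction.component]
      rw [← Finset.smul_sum, Finset.sum_comm]
      simp only [Finset.sum_smul]
    _ = x := by
      simp [orthogonality, ite_smul, α.ρ_zero, smul_smul, NeZero.ne N]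

end Homogeneous

section Commutation

theorem map_sum_mul {ι A B : Type*} [Fintype ι] [CStarAlgebra A] [CStarAlgebra B] (f : A →⋆ₐ[ℂ] B)
    (a : ι → A) (b : B) : f (∑ i, a i) * b = ∑ i, f (a i) * b := by
  rw [map_sum, Finset.sum_mul]

variable {N : ℕ} [NeZero N] {ω : ℂ} {X Y : Type*} [CStarAlgebra X] [CStarAlgebra Y]
  {α : Coaction N X} {β : Coaction N Y} {H K : Type*}
  [NormedAddCommGroup H] [InnerProductSpace ℂ H] [CompleteSpace H]
  [NormedAddCommGroup K] [InnerProductSpace ℂ K] [CompleteSpace K]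

theorem braidPhase_mul_opJ₁_of_isHomogeneous (hω : IsPrimitiveRoot ω N)
    (r : CovariantRep α H) (s : CovariantRep β K) {m : ZMod N} {x : X}
    (hx : IsHomogeneous ω α m x) :
    braidPhase ω r.U s.U * opJ₁ r s x = tmap (r.π x) (s.U.op m) * braidPhase ω r.U s.U := by
  rw [braidPhase_mul_opJ₁ hω, s.U.op_eq_sum hω, tmap_sum_right]
  congr 1
  refine Finset.sum_congr rfl fun b _ => ?_
  rw [hx, map_smul, tmap_smul_left, tmap_smul_right, mul_comm]

variable (hω : IsPrimitiveRoot ω N) (r : CovariantRep α H) (s : CovariantRep β K)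

theorem opJ₂_of_isHomogeneous {n : ZMod N} {y : Y} (hy : IsHomogeneous ω β n y) :
    opJ₂ hω r s y = tmap (r.U.op (-n)) (s.π y) := by
  rw [opJ₂_eq_sum, r.U.op_eq_sum hω, tmap_sum_left]
  refine Finset.sum_congr rfl fun a _ => ?_
  rw [hy, map_smul, tmap_smul_right, tmap_smul_left, neg_mul_comm, mul_comm a, neg_mul_comm]

theorem j₂_mul_j₁_of_isHomogeneous {n : ZMod N} {y : Y} (hy : IsHomogeneous ω β n y) (x : X) :
    j₂ hω r s y * j₁ hω r s x = j₁ hω r s (α.ρ x (-n)) * j₂ hω r s y := by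
  refine braidedIncl_injective hω r s ?_
  rw [map_mul, map_mul]
  change opJ₂ hω r s y * opJ₁ r s x = opJ₁ r s (α.ρ x (-n)) * opJ₂ hω r s y
  rw [opJ₂_of_isHomogeneous hω r s hy, opJ₁_apply, opJ₁_apply, tmap_mul, tmap_mul, r.π_ρ_mul_op,
    one_mul, mul_one]

theorem j₁_mul_j₂_of_isHomogeneous {m : ZMod N} {x : X} (hx : IsHomogeneous ω α m x) (y : Y) :
    j₁ hω r s x * j₂ hω r s y = j₂ hω r s (β.ρ y m) * j₁ hω r s x := by
  refine braidedIncl_injective hω r s ?_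
  rw [map_mul, map_mul]
  change opJ₁ r s x * opJ₂ hω r s y = opJ₂ hω r s (β.ρ y m) * opJ₁ r s x
  have h : braidPhase ω r.U s.U * (opJ₁ r s x * opJ₂ hω r s y) =
      braidPhase ω r.U s.U * (opJ₂ hω r s (β.ρ y m) * opJ₁ r s x) := by
    rw [← mul_assoc, braidPhase_mul_opJ₁_of_isHomogeneous hω r s hx, mul_assoc,
      braidPhase_mul_opJ₂, ← mul_assoc, ← mul_assoc, braidPhase_mul_opJ₂,
      mul_assoc _ (braidPhase ..), braidPhase_mul_opJ₁_of_isHomogeneous hω r s hx, ← mul_assoc,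
      tmap_mul, tmap_mul, s.π_ρ_mul_op, one_mul, mul_one]
  exact ContinuousLinearMap.ext fun v => (braidPhaseEquiv hω r.U s.U).injective congr($h v)

theorem j₂_mul_j₁ (y : Y) (x : X) :
    j₂ hω r s y * j₁ hω r s x =
      ∑ n, j₁ hω r s (α.ρ x n) * j₂ hω r s (β.component ω (-n) y) := by
  conv_lhs => rw [← β.sum_component hω y, map_sum_mul]
  refine Fintype.sum_equiv (Equiv.neg (ZMod N)) _ _ fun n => ?_
  rw [j₂_mul_j₁_of_isHomogeneous hω r s (β.isHomogeneous_component hω n y), Equiv.neg_apply,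
    neg_neg]

theorem j₁_mul_j₂ (x : X) (y : Y) :
    j₁ hω r s x * j₂ hω r s y =
      ∑ n, j₂ hω r s (β.ρ y n) * j₁ hω r s (α.component ω n x) := by
  conv_lhs => rw [← α.sum_component hω x, map_sum_mul]
  exact Finset.sum_congr rfl fun n _ =>
    j₁_mul_j₂_of_isHomogeneous hω r s (α.isHomogeneous_component hω n x) y

end Commutation

/-! ### Closed spans of products -/

section ClosedMulSpan

variable {X Y B : Type*} [CStarAlgebra X] [CStarAlgebra Y] [CStarAlgebra B]

theorem submodule_eq_top_of_generated {S : Set B} (hS : generated S = ⊤) {M : Submodule ℂ B}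
    (hM : IsClosed (M : Set B)) (one_mem : 1 ∈ M) (mul_mem : ∀ x ∈ S ∪ star S, ∀ m ∈ M, x * m ∈ M) :
    M = ⊤ := by
  have key : ∀ x ∈ StarAlgebra.adjoin ℂ S, ∀ m ∈ M, x * m ∈ M := by
    intro x hx
    rw [← StarSubalgebra.mem_toSubalgebra, StarAlgebra.adjoin_toSubalgebra] at hx
    induction hx using Algebra.adjoin_induction with
    | mem x hx => exact mul_mem x hx
    | algebraMap c => exact fun m hm => by rw [← Algebra.smul_def]; exact M.smul_mem c hm
    | add x y _ _ hx hy => exact fun m hm => by rw [add_mul]; exact M.add_mem (hx m hm) (hy m hm)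
    | mul x y _ _ hx hy => exact fun m hm => by rw [mul_assoc]; exact hx _ (hy m hm)
  refine eq_top_iff.2 fun x _ => ?_
  have hx : x ∈ generated S := hS ▸ trivial
  exact closure_minimal (fun y hy => mul_one y ▸ key y hy 1 one_mem) hM hx

/-- The closed linear span of the products `f x * g y`. -/
noncomputable def closedMulSpan (f : X →⋆ₐ[ℂ] B) (g : Y →⋆ₐ[ℂ] B) : Submodule ℂ B :=
  (Submodule.span ℂ {T | ∃ x y, T = f x * g y}).topologicalClosure

variable {f : X →⋆ₐ[ℂ] B} {g : Y →⋆ₐ[ℂ] B}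

variable (f g) in
theorem isClosed_closedMulSpan : IsClosed (closedMulSpan f g : Set B) :=
  Submodule.isClosed_topologicalClosure _

variable (f g) in
theorem mul_mem_closedMulSpan (x : X) (y : Y) : f x * g y ∈ closedMulSpan f g :=
  Submodule.le_topologicalClosure _ (Submodule.subset_span ⟨x, y, rfl⟩)

variable (f g) in
theorem one_mem_closedMulSpan : 1 ∈ closedMulSpan f g := by
  simpa only [map_one, one_mul] using mul_mem_closedMulSpan f g 1 1

theorem closedMulSpan_le {M : Submodule ℂ B} (hM : IsClosed (M : Set B))
    (h : ∀ x y, f x * g y ∈ M) : closedMulSpan f g ≤ M :=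
  Submodule.topologicalClosure_minimal _
    (Submodule.span_le.2 <| by rintro _ ⟨x, y, rfl⟩; exact h x y) hM

theorem map_mul_mem_closedMulSpan (x : X) {m : B} (hm : m ∈ closedMulSpan f g) :
    f x * m ∈ closedMulSpan f g :=
  closedMulSpan_le (M := (closedMulSpan f g).comap (LinearMap.mulLeft ℂ (f x)))
    ((isClosed_closedMulSpan f g).preimage (continuous_const_mul (f x)))
    (fun x' y => by
      rw [Submodule.mem_comap, LinearMap.mulLeft_apply, ← mul_assoc, ← map_mul]
      exact mul_mem_closedMulSpan f g _ y) hm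

theorem mul_map_mem_closedMulSpan {m : B} (hm : m ∈ closedMulSpan f g) (y : Y) :
    m * g y ∈ closedMulSpan f g :=
  closedMulSpan_le (M := (closedMulSpan f g).comap (LinearMap.mulRight ℂ (g y)))
    ((isClosed_closedMulSpan f g).preimage (continuous_mul_const (g y)))
    (fun x y' => by
      rw [Submodule.mem_comap, LinearMap.mulRight_apply, mul_assoc, ← map_mul]
      exact mul_mem_closedMulSpan f g x _) hm

theorem closedMulSpan_eq_top_of_mul_mem (hfg : generated (Set.range f ∪ Set.range g) = ⊤)
    (h : ∀ y x, g y * f x ∈ closedMulSpan f g) : closedMulSpan f g = ⊤ := by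
  refine submodule_eq_top_of_generated hfg (isClosed_closedMulSpan f g)
    (one_mem_closedMulSpan f g) fun z hz m hm => ?_
  have hstar : star (Set.range f ∪ Set.range g) ⊆ Set.range f ∪ Set.range g := by
    rintro z (⟨x, hx⟩ | ⟨y, hy⟩)
    · exact .inl ⟨star x, by rw [map_star, hx, star_star]⟩
    · exact .inr ⟨star y, by rw [map_star, hy, star_star]⟩
  obtain ⟨x, rfl⟩ | ⟨y, rfl⟩ := Set.union_subset subset_rfl hstar hz
  · exact map_mul_mem_closedMulSpan x hm
  · refine closedMulSpan_le (M := (closedMulSpan f g).comap (LinearMap.mulLeft ℂ (g y)))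
      ((isClosed_closedMulSpan f g).preimage (continuous_const_mul (g y))) (fun x y' => ?_) hm
    rw [Submodule.mem_comap, LinearMap.mulLeft_apply, ← mul_assoc]
    exact mul_map_mem_closedMulSpan (h y x) y'

variable {N : ℕ} [NeZero N]

/-- By the commutation relation, the `z` with `u (ρ_t z)` in the closed span of the products
`Δ a * v y` for all `t` are stable under left multiplication by `S`. -/
theorem closedMulSpan_eq_top_of_generators {Z : Type*} [CStarAlgebra Z] {α : Coaction N X}
    {u : X →⋆ₐ[ℂ] B} {v : Y →⋆ₐ[ℂ] B} {Δ : Z →⋆ₐ[ℂ] B} {S : Set X} (hS : generated S = ⊤)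
    (hu : ∀ x ∈ S ∪ star S, ∀ t, u (α.ρ x t) ∈ closedMulSpan Δ v)
    (hvu : ∀ y x, ∃ y' : ZMod N → Y, v y * u x = ∑ n, u (α.ρ x n) * v (y' n))
    (huv : closedMulSpan u v = ⊤) : closedMulSpan Δ v = ⊤ := by
  let M : ZMod N → Submodule ℂ X := fun t =>
    (closedMulSpan Δ v).comap (u.comp (α.act t)).toAlgHom.toLinearMap
  have hM : ∀ {x}, x ∈ ⨅ t, M t ↔ ∀ t, u (α.ρ x t) ∈ closedMulSpan Δ v := Submodule.mem_iInf M
  have hMclosed : IsClosed ((⨅ t, M t : Submodule ℂ X) : Set X) := by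
    rw [Submodule.coe_iInf]
    exact isClosed_iInter fun t =>
      (isClosed_closedMulSpan Δ v).preimage (map_continuous (u.comp (α.act t)))
  have hMtop : ⨅ t, M t = ⊤ := by
    refine submodule_eq_top_of_generated hS hMclosed (hM.2 fun t => ?_) fun x hx m hm =>
      hM.2 fun t => ?_
    · rw [← α.act_apply, map_one, map_one]
      exact one_mem_closedMulSpan Δ v
    · rw [← α.act_apply, map_mul, map_mul]
      refine closedMulSpan_le
        (M := (closedMulSpan Δ v).comap (LinearMap.mulRight ℂ (u (α.ρ m t))))
        ((isClosed_closedMulSpan Δ v).preimage (continuous_mul_const _)) (fun a y => ?_) (hu x hx t)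
      obtain ⟨y', hy'⟩ := hvu y (α.ρ m t)
      rw [Submodule.mem_comap, LinearMap.mulRight_apply, mul_assoc, hy', Finset.mul_sum]
      refine Submodule.sum_mem _ fun n _ => ?_
      rw [α.coassoc]
      exact map_mul_mem_closedMulSpan a (mul_map_mem_closedMulSpan (hM.1 hm _) (y' n))
  rw [eq_top_iff, ← huv]
  refine closedMulSpan_le (isClosed_closedMulSpan Δ v) fun x y => mul_map_mem_closedMulSpan ?_ y
  simpa only [α.ρ_zero] using hM.1 (hMtop ▸ Submodule.mem_top : x ∈ ⨅ t, M t) 0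

end ClosedMulSpan

section BraidedClosedSpan

variable {N : ℕ} [NeZero N] {ω : ℂ} {X Y : Type*} [CStarAlgebra X] [CStarAlgebra Y]
  {α : Coaction N X} {β : Coaction N Y} {H K : Type*}
  [NormedAddCommGroup H] [InnerProductSpace ℂ H] [CompleteSpace H]
  [NormedAddCommGroup K] [InnerProductSpace ℂ K] [CompleteSpace K]
  (hω : IsPrimitiveRoot ω N) (r : CovariantRep α H) (s : CovariantRep β K)

theorem closedMulSpan_j₁_j₂ : closedMulSpan (j₁ hω r s) (j₂ hω r s) = ⊤ :=
  closedMulSpan_eq_top_of_mul_mem (generated_range_j₁_union_range_j₂ hω r s) fun y x => by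
    rw [j₂_mul_j₁]
    exact Submodule.sum_mem _ fun n _ => mul_mem_closedMulSpan _ _ _ _

theorem closedMulSpan_j₂_j₁ : closedMulSpan (j₂ hω r s) (j₁ hω r s) = ⊤ := by
  refine closedMulSpan_eq_top_of_mul_mem ?_ fun x y => ?_
  · rw [Set.union_comm]
    exact generated_range_j₁_union_range_j₂ hω r s
  · rw [j₁_mul_j₂]
    exact Submodule.sum_mem _ fun n _ => mul_mem_closedMulSpan _ _ _ _

end BraidedClosedSpan

/-! ### Products of matrices satisfying the defining relations -/

section Relations

variable {N : ℕ} [NeZero N] {ω : ℂ} {B : Type*} [Ring B] [StarRing B] [Algebra ℂ B]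
  {q q' : ZMod N → ZMod N → B}

/-- The commutation relations between the entries of two matrices that are satisfied by the images
of the generators under the two embeddings into the braided tensor product. -/
def BraidCommute (ω : ℂ) (q q' : ZMod N → ZMod N → B) : Prop :=
  ∀ i j k l, q' k l * q i j = rootPow ω (-((l - k) * (j - i))) • (q i j * q' k l)

theorem BraidCommute.sum_mul_col_add (hω : IsPrimitiveRoot ω N) (hc : BraidCommute ω q q')
    (h : PermRelations ω Eq q) (h' : PermRelations ω Eq q') (i j k : ZMod N) :
    ∑ c, q k c * q' c (i + j) = ∑ l, rootPow ω (-(l * (i - k + l))) •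
      ((∑ a, q (k - l) a * q' a i) * ∑ b, q l b * q' b j) := by
  calc ∑ c, q k c * q' c (i + j)
    _ = ∑ b, ∑ a, rootPow ω (-(b * (i - a))) • (q k (a + b) * (q' a i * q' b j)) := by
      simp only [h'.col_add, Finset.mul_sum]
      rw [Finset.sum_comm]
      refine Finset.sum_congr rfl fun b _ => Fintype.sum_equiv (Equiv.subRight b) _ _ fun c => ?_
      rw [Equiv.subRight_apply, sub_add_cancel, mul_smul_comm, sub_sub_eq_add_sub,
        sub_add_eq_add_sub]
    _ = ∑ b, ∑ a, ∑ l, rootPow ω (-(l * (i - k + l))) •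
        (q (k - l) a * q' a i * (q l b * q' b j)) := by
      refine Finset.sum_congr rfl fun b _ => Finset.sum_congr rfl fun a _ => ?_
      rw [h.col_add, Finset.sum_mul, Finset.smul_sum]
      refine Finset.sum_congr rfl fun l _ => ?_
      rw [mul_assoc (q (k - l) a), ← mul_assoc (q' a i), hc, smul_mul_assoc, smul_mul_assoc,
        mul_smul_comm, smul_smul, smul_smul, ← rootPow_add hω, ← rootPow_add hω]
      simp only [mul_assoc]
      congr 2
      ring
    _ = _ := by
      simp only [Finset.sum_mul_sum, Finset.smul_sum]
      rw [Finset.sum_comm, Finset.sum_congr rfl fun a _ => Finset.sum_comm, Finset.sum_comm]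

theorem BraidCommute.sum_mul_row_add (hω : IsPrimitiveRoot ω N) (hc : BraidCommute ω q q')
    (h : PermRelations ω Eq q) (h' : PermRelations ω Eq q') (i j k : ZMod N) :
    ∑ c, q (i + j) c * q' c k = ∑ l, rootPow ω (-(i * (l - j))) •
      ((∑ a, q j a * q' a l) * ∑ b, q i b * q' b (k - l)) := by
  calc ∑ c, q (i + j) c * q' c k
    _ = ∑ a, ∑ b, rootPow ω (-(i * (a - j))) • (q j a * q i b * q' (b + a) k) := by
      simp only [h.row_add, Finset.sum_mul]
      rw [Finset.sum_comm]
      refine Finset.sum_congr rfl fun a _ => Fintype.sum_equiv (Equiv.subRight a) _ _ fun c => ?_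
      rw [Equiv.subRight_apply, sub_add_cancel, smul_mul_assoc]
    _ = ∑ a, ∑ b, ∑ l, rootPow ω (-(i * (l - j))) •
        (q j a * q' a l * (q i b * q' b (k - l))) := by
      refine Finset.sum_congr rfl fun a _ => Finset.sum_congr rfl fun b _ => ?_
      rw [h'.row_add, Finset.mul_sum, Finset.smul_sum]
      refine Finset.sum_congr rfl fun l _ => ?_
      rw [mul_assoc (q j a) (q' a l), ← mul_assoc (q' a l), hc, smul_mul_assoc, mul_smul_comm,
        mul_smul_comm, smul_smul, smul_smul, ← rootPow_add hω, ← rootPow_add hω]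
      simp only [mul_assoc]
      congr 2
      ring
    _ = _ := by
      simp only [Finset.sum_mul_sum, Finset.smul_sum]
      rw [Finset.sum_congr rfl fun a _ => Finset.sum_comm, Finset.sum_comm]

theorem PermRelations.sum_mul (hω : IsPrimitiveRoot ω N) (h : PermRelations ω Eq q)
    (h' : PermRelations ω Eq q') (hc : BraidCommute ω q q') :
    PermRelations ω Eq (fun i j => ∑ k, q i k * q' k j) where
  zero_left i := by simp [h.zero_left, h'.zero_left]
  zero_right i := by simp [h.zero_right, h'.zero_right]
  star_eq i j := by
    rw [star_sum, Finset.smul_sum]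
    refine Fintype.sum_equiv (Equiv.neg (ZMod N)) _ _ fun k => ?_
    rw [star_mul, h.star_eq, h'.star_eq, smul_mul_smul_comm, hc, smul_smul, ← rootPow_add hω,
      ← rootPow_add hω, Equiv.neg_apply]
    congr 2
    ring
  col_add := hc.sum_mul_col_add hω h h'
  row_add := hc.sum_mul_row_add hω h h'

theorem PermRelations.sum_mul_star_row (hω : IsPrimitiveRoot ω N) (h : PermRelations ω Eq q)
    (k m : ZMod N) : ∑ l, q m l * star (q k l) = if m = k then 1 else 0 := by
  calc ∑ l, q m l * star (q k l)
    _ = rootPow ω (-(k * (k - m))) • q (-k + m) 0 := by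
      rw [h.row_add, Finset.smul_sum]
      refine Finset.sum_congr rfl fun l _ => ?_
      rw [h.star_eq, mul_smul_comm, smul_smul, ← rootPow_add hω, zero_sub]
      congr 2
      ring
    _ = if m = k then 1 else 0 := by
      simp only [h.zero_right, neg_add_eq_zero, eq_comm (a := k)]
      split_ifs with hm
      · rw [hm, sub_self, mul_zero, neg_zero, rootPow_zero, one_smul]
      · rw [smul_zero]

theorem PermRelations.sum_mul_neg_column (h : PermRelations ω Eq q) (k l : ZMod N) :
    ∑ i, rootPow ω (i * k - i * i) • (q i k * q (-i) (-l)) = if k = l then 1 else 0 := by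
  calc ∑ i, rootPow ω (i * k - i * i) • (q i k * q (-i) (-l))
    _ = q 0 (k + -l) := by
      rw [h.col_add]
      refine Fintype.sum_equiv (Equiv.neg (ZMod N)) _ _ fun i => ?_
      rw [Equiv.neg_apply, zero_sub, neg_neg]
      congr 2
      ring
    _ = if k = l then 1 else 0 := by simp only [h.zero_left, ← sub_eq_add_neg, sub_eq_zero]

theorem PermRelations.sum_mul_mul_star (hω : IsPrimitiveRoot ω N) (h' : PermRelations ω Eq q')
    (q : ZMod N → ZMod N → B) (i k : ZMod N) :
    ∑ j, (∑ m, q i m * q' m j) * star (q' k j) = q i k := by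
  simp only [Finset.sum_mul, mul_assoc]
  rw [Finset.sum_comm]
  simp [← Finset.mul_sum, h'.sum_mul_star_row hω]

theorem PermRelations.sum_mul_mul_neg (hω : IsPrimitiveRoot ω N) (h : PermRelations ω Eq q)
    (hc : BraidCommute ω q q') (l j : ZMod N) :
    ∑ i, rootPow ω (l * l - l * j + i * j - i * i) • ((∑ k, q i k * q' k j) * q (-i) (-l)) =
      q' l j := by
  have reorder : ∀ i k, rootPow ω (l * l - l * j + i * j - i * i) •
      (q i k * q' k j * q (-i) (-l)) =
        rootPow ω (l * l - k * l) • (rootPow ω (i * k - i * i) • (q i k * q (-i) (-l)) * q' k j) :=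
    fun i k => by
      rw [mul_assoc, hc, mul_smul_comm, smul_mul_assoc, smul_smul, smul_smul, ← rootPow_add hω,
        ← rootPow_add hω, mul_assoc]
      congr 2
      ring
  simp only [Finset.sum_mul, Finset.smul_sum, reorder]
  rw [Finset.sum_comm]
  simp only [← Finset.smul_sum, ← Finset.sum_mul, h.sum_mul_neg_column]
  simp [rootPow_zero]

end Relations

/-! ### The comultiplication -/

section PermGenerators

variable {N : ℕ} [NeZero N] {ω : ℂ}

theorem generated_range_permGen :
    generated (Set.range fun p : ZMod N × ZMod N => permGen N ω p.1 p.2) = ⊤ := by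
  have h : FreeStarAlgebra.eval (fun p : ZMod N × ZMod N => permGen N ω p.1 p.2) =
      (permSeminorm N ω).coeHom :=
    FreeStarAlgebra.hom_ext fun _ => FreeStarAlgebra.eval_gen _ _
  rw [← denseRange_eval_iff, h]
  exact (permSeminorm N ω).denseRange_coe

theorem permRelations_map {B : Type*} [CStarAlgebra B] (f : PermAlg N ω →⋆ₐ[ℂ] B) :
    PermRelations ω Eq (fun i j => f (permGen N ω i j)) :=
  permGen_relations.map f fun _ _ h => congrArg f h

theorem isHomogeneous_permGen (hω : IsPrimitiveRoot ω N) (i j : ZMod N) :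
    IsHomogeneous ω (permCoaction hω) (j - i) (permGen N ω i j) :=
  fun t => permCoaction_gen hω i j t

theorem closedMulSpan_eq_top_of_map_permGen_mem {Y Z B : Type*} [CStarAlgebra Y] [CStarAlgebra Z]
    [CStarAlgebra B] (hω : IsPrimitiveRoot ω N) {u : PermAlg N ω →⋆ₐ[ℂ] B} {v : Y →⋆ₐ[ℂ] B}
    {Δ : Z →⋆ₐ[ℂ] B} (hu : ∀ i j, u (permGen N ω i j) ∈ closedMulSpan Δ v)
    (hvu : ∀ y x, ∃ y' : ZMod N → Y,
      v y * u x = ∑ n, u ((permCoaction hω).ρ x n) * v (y' n))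
    (huv : closedMulSpan u v = ⊤) : closedMulSpan Δ v = ⊤ := by
  have hρ : ∀ i j t, u ((permCoaction hω).ρ (permGen N ω i j) t) ∈ closedMulSpan Δ v :=
    fun i j t => by
      rw [permCoaction_gen, map_smul]
      exact Submodule.smul_mem _ _ (hu i j)
  refine closedMulSpan_eq_top_of_generators generated_range_permGen ?_ hvu huv
  rintro x (⟨⟨i, j⟩, rfl⟩ | ⟨⟨i, j⟩, hx⟩) t
  · exact hρ i j t
  · rw [← star_star x, ← hx, permGen_relations.star_eq, ← Coaction.act_apply, map_smul, map_smul]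
    exact Submodule.smul_mem _ _ (hρ _ _ t)

end PermGenerators

section Comultiplication

variable {N : ℕ} [NeZero N] {ω : ℂ} (hω : IsPrimitiveRoot ω N) {L : Type*}
  [NormedAddCommGroup L] [InnerProductSpace ℂ L] [CompleteSpace L]
  (r : CovariantRep (permCoaction hω) L)

theorem braidCommute_j₁_j₂_permGen :
    BraidCommute ω (fun i j => j₁ hω r r (permGen N ω i j))
      (fun i j => j₂ hω r r (permGen N ω i j)) := fun i j k l => by
  rw [j₂_mul_j₁_of_isHomogeneous hω r r (isHomogeneous_permGen hω k l), permCoaction_gen, map_smul,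
    smul_mul_assoc, neg_mul]

/-- The comultiplication, with values in the braided tensor square formed in the representation
`r`. -/
noncomputable def comul : PermAlg N ω →⋆ₐ[ℂ] Braided hω r r :=
  permLift _ ((permRelations_map (j₁ hω r r)).sum_mul hω (permRelations_map (j₂ hω r r))
    (braidCommute_j₁_j₂_permGen hω r))

theorem comul_permGen (i j : ZMod N) : comul hω r (permGen N ω i j) =
    ∑ k, j₁ hω r r (permGen N ω i k) * j₂ hω r r (permGen N ω k j) :=
  permLift_gen _ _ i j

theorem map_comul_permGen {C : Type*} [CStarAlgebra C] (F : Braided hω r r →⋆ₐ[ℂ] C)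
    (i j : ZMod N) : F (comul hω r (permGen N ω i j)) =
      ∑ k, F (j₁ hω r r (permGen N ω i k)) * F (j₂ hω r r (permGen N ω k j)) := by
  rw [comul_permGen, map_sum]
  exact Finset.sum_congr rfl fun k _ => map_mul F _ _

theorem comul_equivariant :
    IsEquivariant (permCoaction hω) (braidedCoaction hω r r) (comul hω r) := by
  refine isEquivariant_of_generated generated_range_permGen ?_
  rintro _ ⟨⟨i, j⟩, rfl⟩ t
  rw [permCoaction_gen, map_smul, ← Coaction.act_apply, map_comul_permGen, comul_permGen,
    Finset.smul_sum]
  refine Finset.sum_congr rfl fun k _ => ?_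
  rw [Coaction.act_apply, Coaction.act_apply, j₁_equivariant, j₂_equivariant, permCoaction_gen,
    permCoaction_gen, map_smul, map_smul, smul_mul_smul_comm, ← rootPow_add hω]
  congr 2
  ring

theorem IsBraidedMap.comul_id_comul_permGen
    {F : Braided hω r r →⋆ₐ[ℂ] Braided hω (r.braided hω r) r}
    (hF : IsBraidedMap hω r r (r.braided hω r) r (comul hω r) (StarAlgHom.id ℂ _) F)
    (i j : ZMod N) : F (comul hω r (permGen N ω i j)) =
      ∑ l, ∑ k, embLeft hω r r r (.inl (.inl (permGen N ω i k))) *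
        embLeft hω r r r (.inl (.inr (permGen N ω k l))) *
          embLeft hω r r r (.inr (permGen N ω l j)) := by
  rw [map_comul_permGen]
  refine Finset.sum_congr rfl fun l _ => ?_
  rw [hF.map_j₁, hF.map_j₂, map_comul_permGen]
  exact Finset.sum_mul _ _ _

theorem IsBraidedMap.id_comul_comul_permGen
    {F : Braided hω r r →⋆ₐ[ℂ] Braided hω r (r.braided hω r)}
    (hF : IsBraidedMap hω r r r (r.braided hω r) (StarAlgHom.id ℂ _) (comul hω r) F)
    (i j : ZMod N) : F (comul hω r (permGen N ω i j)) =
      ∑ k, ∑ l, embRight hω r r r (.inl (.inl (permGen N ω i k))) *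
        embRight hω r r r (.inl (.inr (permGen N ω k l))) *
          embRight hω r r r (.inr (permGen N ω l j)) := by
  rw [map_comul_permGen]
  refine Finset.sum_congr rfl fun k _ => ?_
  rw [hF.map_j₁, hF.map_j₂, map_comul_permGen]
  exact (Finset.mul_sum _ _ _).trans (Finset.sum_congr rfl fun l _ => (mul_assoc _ _ _).symm)

theorem comul_coassociative : IsCoassociative hω r (comul hω r) := by
  obtain ⟨ΔI, hΔI⟩ := exists_isBraidedMap_id_right hω r r (r.braided hω r) (comul_equivariant hω r)
  obtain ⟨IΔ, hIΔ⟩ := exists_isBraidedMap_id_left hω r r (r.braided hω r) (comul_equivariant hω r)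
  obtain ⟨a, ha⟩ := exists_associator hω r r r
  refine ⟨ΔI, IΔ, a, hΔI, hIΔ, ⟨fun x => ha (.inl (.inl x)), fun x => ha (.inl (.inr x)),
    fun x => ha (.inr x)⟩, fun x => ?_⟩
  let b : Braided hω (r.braided hω r) r →⋆ₐ[ℂ] Braided hω r (r.braided hω r) := a
  have hb : ∀ i, b (embLeft hω r r r i) = embRight hω r r r i := ha
  have h : (b.comp ΔI).comp (comul hω r) = IΔ.comp (comul hω r) := permAlg_hom_ext fun i j => by
    rw [StarAlgHom.comp_apply, StarAlgHom.comp_apply, StarAlgHom.comp_apply,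
      hΔI.comul_id_comul_permGen, hIΔ.id_comul_comul_permGen, Finset.sum_comm]
    simp only [map_sum, map_mul, hb]
  exact congr($h x)

theorem closedMulSpan_comul_j₂ : closedMulSpan (comul hω r) (j₂ hω r r) = ⊤ := by
  refine closedMulSpan_eq_top_of_map_permGen_mem hω (fun i k => ?_)
    (fun y x => ⟨_, j₂_mul_j₁ hω r r y x⟩) (closedMulSpan_j₁_j₂ hω r r)
  rw [← (permRelations_map (j₂ hω r r)).sum_mul_mul_star hω
    (fun i j => j₁ hω r r (permGen N ω i j)) i k]
  refine Submodule.sum_mem _ fun j _ => ?_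
  rw [← comul_permGen, ← map_star]
  exact mul_mem_closedMulSpan _ _ _ _

theorem closedMulSpan_comul_j₁ : closedMulSpan (comul hω r) (j₁ hω r r) = ⊤ := by
  refine closedMulSpan_eq_top_of_map_permGen_mem hω (fun l j => ?_)
    (fun x y => ⟨_, j₁_mul_j₂ hω r r x y⟩) (closedMulSpan_j₂_j₁ hω r r)
  rw [← (permRelations_map (j₁ hω r r)).sum_mul_mul_neg hω (braidCommute_j₁_j₂_permGen hω r) l j]
  refine Submodule.sum_mem _ fun i _ => Submodule.smul_mem _ _ ?_
  rw [← comul_permGen]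
  exact mul_mem_closedMulSpan _ _ _ _

end Comultiplication

end Anyonic

theorem proposition2 (N : ℕ) [NeZero N] (ω : ℂ) (hω : IsPrimitiveRoot ω N) :
    (∃ (L : Type) (_ : NormedAddCommGroup L) (_ : InnerProductSpace ℂ L) (_ : CompleteSpace L),
      Nonempty (Anyonic.CovariantRep (Anyonic.permCoaction hω) L)) ∧
    ∀ (L : Type*) [NormedAddCommGroup L] [InnerProductSpace ℂ L] [CompleteSpace L]
      (r : Anyonic.CovariantRep (Anyonic.permCoaction hω) L),
      ∃ Δ : Anyonic.PermAlg N ω →⋆ₐ[ℂ] Anyonic.Braided hω r r,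
        (∀ i j : ZMod N, Δ (Anyonic.permGen N ω i j) =
          ∑ k : ZMod N, Anyonic.j₁ hω r r (Anyonic.permGen N ω i k) *
            Anyonic.j₂ hω r r (Anyonic.permGen N ω k j)) ∧
        (∀ Δ' : Anyonic.PermAlg N ω →⋆ₐ[ℂ] Anyonic.Braided hω r r,
          (∀ i j : ZMod N, Δ' (Anyonic.permGen N ω i j) =
            ∑ k : ZMod N, Anyonic.j₁ hω r r (Anyonic.permGen N ω i k) *
              Anyonic.j₂ hω r r (Anyonic.permGen N ω k j)) → Δ' = Δ) ∧
        Anyonic.IsAnyonicCompactQuantumGroup hω r Δ := by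
  refine ⟨Anyonic.exists_covariantRep (Anyonic.permCoaction hω), fun L _ _ _ r => ?_⟩
  exact ⟨Anyonic.comul hω r, Anyonic.comul_permGen hω r,
    fun Δ' hΔ' => Anyonic.permAlg_hom_ext fun i j =>
      (hΔ' i j).trans (Anyonic.comul_permGen hω r i j).symm,
    { equivariant := Anyonic.comul_equivariant hω r
      coassociative := Anyonic.comul_coassociative hω r
      simplifiable_right := Anyonic.closedMulSpan_comul_j₂ hω r
      simplifiable_left := Anyonic.closedMulSpan_comul_j₁ hω r }⟩
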